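/- Let $\beta=(\sqrt{17}-3)/2$, $h(s)=(s(1-s))^{\beta/2}$ for $s\in[0,1]$, and $B(a,b)=\int_0^1t^{a-1}(1-t)^{b-1}\,dt$. Below, $\stackrel{d}{=}$ between expressions in $s$ means equality in law of random functions of $s\in[0,1]$; $U,V,V_\ell,V_r,U_d,U_u$ denote independent uniform random variables on $[0,1]$, and $X^{(1)},X^{(2)},\dots$ denote independent copies of a process $X$, independent of these uniform variables. Write $\|\cdot\|$ for the supremum norm on $C[0,1]$. There exist random continuous functions $Z^{=},Z^{\perp}$ on $[0,1]$ such that $\mathbf E[Z^{=}(s)]=\mathbf E[Z^{\perp}(s)]=h(s)$ for all $s\in[0,1]$, $\mathbf E\|Z^{=}\|^p<\infty$ and $\mathbf E\|Z^{\perp}\|^p<\infty$ for all $p>0$, and $$Z^{=}(s)\stackrel{d}{=}\mathbf 1_{\{s<U\}}\Big[(UV_\ell)^\beta Z^{(=,1)}\big(\tfrac sU\big)+(U(1-V_\ell))^\beta Z^{(=,2)}\big(\tfrac sU\big)\Big]+\mathbf 1_{\{s\ge U\}}\Big[((1-U)V_r)^\beta Z^{(=,3)}\big(\tfrac{s-U}{1-U}\big)+((1-U)(1-V_r))^\beta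 Z^{(=,4)}\big(\tfrac{s-U}{1-U}\big)\Big],\tag{1}$$ $$Z^{\perp}(s)\stackrel{d}{=}\mathbf 1_{\{s<U_d\}}(U_dV)^\beta Z^{(\perp,1)}\big(\tfrac s{U_d}\big)+\mathbf 1_{\{s<U_u\}}(U_u(1-V))^\beta Z^{(\perp,2)}\big(\tfrac s{U_u}\big)+\mathbf 1_{\{s\ge U_d\}}((1-U_d)V)^\beta Z^{(\perp,3)}\big(\tfrac{s-U_d}{1-U_d}\big)+\mathbf 1_{\{s\ge U_u\}}((1-U_u)(1-V))^\beta Z^{(\perp,4)}\big(\tfrac{s-U_u}{1-U_u}\big).\tag{2}$$ The law of $Z^{=}$ on $C[0,1]$ is unique among those of random continuous functions $X$ that satisfy (1), $\mathbf E[X(s)]=h(s)$ and $\mathbf E|X(s)|^p<\infty$ for all $s\in[0,1]$ and $p>0$; likewise the law of $Z^{\perp}$ with (2) in place of (1). Moreover: 1. $$\frac2{\beta+1}Z^{\perp}(s)\stackrel{d}{=}V^\beta Z^{(=,1)}(s)+(1-V)^\beta Z^{(=,2)}(s),$$ $$\frac{\beta+1}2Z^{=}(s)\stackrel{d}{=}\mathbf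 1_{\{s<U\}}U^\beta Z^{(\perp,1)}\big(\tfrac sU\big)+\mathbf 1_{\{s\ge U\}}(1-U)^\beta Z^{(\perp,2)}\big(\tfrac{s-U}{1-U}\big).$$ 2. Let $(U_u)_u$, $(V_u)_u$ be independent families of independent uniform random variables on $[0,1]$, indexed by the nodes $u$ of the infinite quaternary tree with root $\varnothing$. Put $Z_0^u=h$ and let $Z_{n+1}^u(s)$ be the right-hand side of (1) with $U=U_u$, $V_\ell=V_r=V_u$ and $Z_n^{u1},\dots,Z_n^{u4}$ in place of $Z^{(=,1)},\dots,Z^{(=,4)}$. Almost surely, $Z_n^{\varnothing}$ converges uniformly on $[0,1]$ to a random continuous function $Z$ (the limit process of partial match queries in quadtrees), and for each fixed $s\in[0,1]$ the random variables $Z^{=}(s)$ and $Z(s)$ have the same law. With $c_2=2B(\beta+1,\beta+1)\frac{2\beta+1}{3(1-\beta)}$, for every $s\in[0,1]$, $$\mathrm{Var}(Z^{=}(s))=(c_2-1)h(s)^2,\qquad \mathrm{Var}(Z^{\perp}(s))=K_2^{\perp}h(s)^2,$$ $$K_2^{\perp}=\frac{2c_2}{2\beta+1}\Big(\frac{\beta+1}2\Big)^2+2B(\beta+1,\beta+1)\Big(\frac{\beta+1}2\Big)^2-1.$$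 3. If $\xi$ is uniform on $[0,1]$ and independent of the processes, then $$\mathrm{Var}(Z^{=}(\xi))=\mathrm{Var}(Z(\xi))=\frac{2(2\beta+1)}{3(1-\beta)}B(\beta+1,\beta+1)^2-B\big(\tfrac\beta2+1,\tfrac\beta2+1\big)^2,$$ $$\mathrm{Var}(Z^{\perp}(\xi))=K_3^{\perp}=\Big(\frac{2c_2}{2\beta+1}+2B(\beta+1,\beta+1)\Big)\Big(\frac{\beta+1}2\Big)^2B(\beta+1,\beta+1)-B\big(\tfrac\beta2+1,\tfrac\beta2+1\big)^2.$$ -/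

import Mathlib

open MeasureTheory ProbabilityTheory Filter
open scoped unitInterval NNReal

namespace PartialMatch

/-- The space `C[0,1]` (with its supremum norm) carries its Borel sigma-algebra. -/
instance : MeasurableSpace C(I, ℝ) := borel _

instance : BorelSpace C(I, ℝ) := ⟨rfl⟩

noncomputable section

/-- The exponent `β = (√17 - 3) / 2`. -/
def bexp : ℝ := (Real.sqrt 17 - 3) / 2

/-- `h(s) = (s (1 - s)) ^ (β / 2)`. -/
def h (s : I) : ℝ := ((s : ℝ) * (1 - s)) ^ (bexp / 2)

/-- The position `s / u` of `s` relative to `[0, u]`, used for `s < u` only. -/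
def relLeft (u s : I) : I := Set.projIcc 0 1 zero_le_one ((s : ℝ) / u)

/-- The position `(s - u) / (1 - u)` of `s` relative to `[u, 1]`, used for `u ≤ s` only
(and, up to an event of probability zero, for `u < 1`). -/
def relRight (u s : I) : I := Set.projIcc 0 1 zero_le_one (((s : ℝ) - u) / (1 - u))

/-- The right-hand side of the recursion for `2`-d trees whose root split is parallel to the query:
the interval is cut at `x`, the left strip is cut at height `y`, the right one at height `z`. -/
def parOp (x y z : I) (f : Fin 4 → I → ℝ) (s : I) : ℝ :=
  if s < x then
    ((x : ℝ) * y) ^ bexp * f 0 (relLeft x s) + ((x : ℝ) * (1 - y)) ^ bexp * f 1 (relLeft x s)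
  else
    ((1 - (x : ℝ)) * z) ^ bexp * f 2 (relRight x s)
      + ((1 - (x : ℝ)) * (1 - z)) ^ bexp * f 3 (relRight x s)

/-- The right-hand side of the recursion for `2`-d trees whose root split is perpendicular to the
query: the square is cut at height `v`, the two pieces are then cut at abscissae `xd` and `xu`. -/
def perpOp (xd xu v : I) (f : Fin 4 → I → ℝ) (s : I) : ℝ :=
  (if s < xd then ((xd : ℝ) * v) ^ bexp * f 0 (relLeft xd s) else 0)
    + (if s < xu then ((xu : ℝ) * (1 - v)) ^ bexp * f 1 (relLeft xu s) else 0)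
    + (if xd ≤ s then ((1 - (xd : ℝ)) * v) ^ bexp * f 2 (relRight xd s) else 0)
    + (if xu ≤ s then ((1 - (xu : ℝ)) * (1 - v)) ^ bexp * f 3 (relRight xu s) else 0)

/-- `v ^ β f₀(s) + (1 - v) ^ β f₁(s)`. -/
def mixOp (v : I) (f : Fin 2 → I → ℝ) (s : I) : ℝ :=
  (v : ℝ) ^ bexp * f 0 s + (1 - (v : ℝ)) ^ bexp * f 1 s

/-- `1_{s < u} u ^ β f₀(s / u) + 1_{s ≥ u} (1 - u) ^ β f₁((s - u) / (1 - u))`. -/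
def splitOp (u : I) (f : Fin 2 → I → ℝ) (s : I) : ℝ :=
  if s < u then (u : ℝ) ^ bexp * f 0 (relLeft u s)
  else (1 - (u : ℝ)) ^ bexp * f 1 (relRight u s)

section Solutions

variable {Ω : Type*} [MeasurableSpace Ω]

/-- Equality in law, as random functions of `s`, of `Z` and
`parOp U V_l V_r (Z⁽¹⁾, …, Z⁽⁴⁾)`, where `U, V_l, V_r` are independent uniform variables and the
`Z⁽ⁱ⁾` are independent copies of `Z`, independent of `(U, V_l, V_r)`. Laws of random functions are
taken on the product sigma-algebra, so they amount to all finite-dimensional distributions. -/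
def SolvesPar (Z : Ω → C(I, ℝ)) (P : Measure Ω) : Prop :=
  IdentDistrib (fun ω => (Z ω : I → ℝ))
    (fun q : (I × I × I) × (Fin 4 → Ω) =>
      parOp q.1.1 q.1.2.1 q.1.2.2 (fun i => (Z (q.2 i) : I → ℝ)))
    P ((volume : Measure (I × I × I)).prod (Measure.pi fun _ => P))

/-- The same with `perpOp U_d U_u V` in place of `parOp U V_l V_r`. -/
def SolvesPerp (Z : Ω → C(I, ℝ)) (P : Measure Ω) : Prop :=
  IdentDistrib (fun ω => (Z ω : I → ℝ))
    (fun q : (I × I × I) × (Fin 4 → Ω) =>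
      perpOp q.1.1 q.1.2.1 q.1.2.2 (fun i => (Z (q.2 i) : I → ℝ)))
    P ((volume : Measure (I × I × I)).prod (Measure.pi fun _ => P))

/-- A random continuous function with mean function `h` and finite absolute moments of all orders
at every point. -/
structure IsAdmissible (Z : Ω → C(I, ℝ)) (P : Measure Ω) : Prop where
  measurable : Measurable Z
  memLp : ∀ (s : I) (p : ℝ≥0), MemLp (fun ω => Z ω s) p P
  mean : ∀ s : I, ∫ ω, Z ω s ∂P = h s

end Solutions

/-- The `n`-th approximation `Z_n` in the construction of the limit process of quadtrees.
`w u = (U_u, V_u)` is the pair of uniform variables at the node `u` of the infinite quaternary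
tree; the subtree of the `i`-th child of the root carries the family `v ↦ w (i :: v)`. -/
def quadApprox : ℕ → (List (Fin 4) → I × I) → I → ℝ
  | 0, _ => h
  | n + 1, w =>
      parOp (w []).1 (w []).2 (w []).2 (fun i => quadApprox n (fun v => w (i :: v)))

/-- The law of the family `(U_u, V_u)`: independent uniform variables indexed by the nodes. -/
def quadMeasure : Measure (List (Fin 4) → I × I) :=
  Measure.infinitePi fun _ => (volume : Measure (I × I))

/-- `Z` is the limit process of quadtrees: the almost surely uniform limit of the `Z_n`. -/
def IsQuadLimit (Z : (List (Fin 4) → I × I) → C(I, ℝ)) : Prop :=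
  Measurable Z ∧
    ∀ᵐ w ∂quadMeasure, TendstoUniformly (fun n => quadApprox n w) (fun s => Z w s) atTop

/-- `c₂ = 2 B(β+1, β+1) (2β+1) / (3 (1-β))`. -/
def c2 : ℝ := 2 * beta (bexp + 1) (bexp + 1) * ((2 * bexp + 1) / (3 * (1 - bexp)))

/-- The variance constant of `Z⁼(s)`. -/
def K2 : ℝ := c2 - 1

/-- The variance constant of `Z^⊥(s)`. -/
def K2perp : ℝ :=
  2 * c2 / (2 * bexp + 1) * ((bexp + 1) / 2) ^ 2
    + 2 * beta (bexp + 1) (bexp + 1) * ((bexp + 1) / 2) ^ 2 - 1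

/-- The variance of the quadtree limit process at a uniform location. -/
def K3 : ℝ :=
  2 * (2 * bexp + 1) / (3 * (1 - bexp)) * beta (bexp + 1) (bexp + 1) ^ 2
    - beta (bexp / 2 + 1) (bexp / 2 + 1) ^ 2

/-- The variance of `Z^⊥` at a uniform location. -/
def K3perp : ℝ :=
  (2 * c2 / (2 * bexp + 1) + 2 * beta (bexp + 1) (bexp + 1)) * ((bexp + 1) / 2) ^ 2
      * beta (bexp + 1) (bexp + 1)
    - beta (bexp / 2 + 1) (bexp / 2 + 1) ^ 2

end

end PartialMatch

/-!
Existence comes from the tree construction. With independent cuts attached to the nodes of the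
quaternary tree, the iterates `parApprox n` of the parallel recursion started from `h` all have
mean `h`, because `h` is an eigenfunction of the averaged splitting operator and
`(β + 1) (β + 2) = 4` (`integral_segLen_mul_h`, `integral_parApprox`). Their increments are
therefore centred, independent copies are orthogonal, and the second moments of the increments
decay geometrically at each point. Expanding a `p`-th power into pure and mixed terms propagates
this to all moments, and for large `p` the rate becomes as small as desired
(`exists_momentDecay`). The iterates vanish at the endpoints and are Hölder continuous of exponent
`β / 2`, with a constant growing like `4 ^ n` (`HolderVanish`), so a union bound over a fine grid
turns the pointwise decay into summable bounds on supremum norms (`exists_limit`). At one fixed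
point only one of the two lower cuts matters; hence the one-dimensional marginals are the same for
independent lower cuts and for the equal lower cuts of quadtrees (`IsParLimit.map_eval_eq`).

Uniqueness is proved for both recursions at once (`IsTreeOp.unique`). Two invariant laws are coupled
by feeding the same cuts to both, starting from independence. The difference of the two components
is centred, so its second moment `D` satisfies `D_{n+1} = 2 / (2β+1) * avgSplit D_n`, which after
integration over the location contracts by the factor `4 / ((2β+1) (2β+2)) < 1`
(`lintegral_avgSplit_le`). Integrability of the initial `D` is not assumed: finiteness of the second
moment at the midpoint, read through the recursion, forces it (`lintegral_lt_top_of_avgSplit`).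
The recursion also contracts second moments at the endpoints, so that solutions vanish there and
the recursion preserves continuity (`IsTreeOp.ae_endpoint`). Convergence of the coupling at almost
every location identifies the laws, by continuity of the paths (`eq_of_tendsto_coupling`).

The perpendicular process is *defined* by the first identity between the processes, as
`(β + 1) / 2 (V ^ β f₀ + (1 - V) ^ β f₁)` with independent parallel processes `f₀`, `f₁`
(`perpLaw`). Since `parOp` is a splitting of two mixtures and `perpOp` a mixture of two
splittings, regrouping the independent variables gives the second identity
(`map_splitOp_perpLaw`) and then the perpendicular recursion (`perpLaw_invariant`). The
variances follow from the second moments of the approximations, which solve a scalar affine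
recursion with fixed point `c₂` (`tendsto_sqRatio`), and from Fubini's theorem for a uniform
location.
-/

namespace PartialMatch

open scoped ENNReal Topology

/-! ### The exponent and the averaged splitting operator -/

lemma bexp_quadratic : (bexp + 1) * (bexp + 2) = 4 := by
  have := Real.sq_sqrt (show (0 : ℝ) ≤ 17 by norm_num)
  unfold bexp
  nlinarith

lemma half_lt_bexp : 1 / 2 < bexp := by
  have : (4 : ℝ) < Real.sqrt 17 := Real.lt_sqrt_of_sq_lt (by norm_num)
  unfold bexp
  linarith

lemma bexp_pos : 0 < bexp := by linarith [half_lt_bexp]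

lemma bexp_lt_one : bexp < 1 := by nlinarith [bexp_quadratic, bexp_pos]

lemma h_zero : h 0 = 0 := by
  have := bexp_pos
  simp [h, Real.zero_rpow (by positivity : bexp / 2 ≠ 0)]

lemma h_one : h 1 = 0 := by
  have := bexp_pos
  simp [h, Real.zero_rpow (by positivity : bexp / 2 ≠ 0)]

lemma h_rpow (s : I) {c : ℝ} : h s ^ c = ((s : ℝ) * (1 - s)) ^ (bexp / 2 * c) := by
  rw [h, ← Real.rpow_mul (mul_nonneg s.2.1 (by linarith [s.2.2]))]

lemma h_sq (s : I) : h s ^ 2 = ((s : ℝ) * (1 - s)) ^ bexp := by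
  rw [← Real.rpow_natCast, h_rpow]; norm_num

lemma continuous_h : Continuous h := by
  unfold h
  have := bexp_pos
  exact Continuous.rpow_const (by fun_prop) fun _ => Or.inr (by positivity)

/-- The length of the piece of `[0, 1]`, cut at `u`, that contains `s`. -/
noncomputable def segLen (u s : I) : ℝ := if s < u then u else 1 - u

/-- The position of `s` relative to the piece of `[0, 1]`, cut at `u`, that contains it. -/
noncomputable def segPos (u s : I) : I := if s < u then relLeft u s else relRight u s

lemma segLen_nonneg (u s : I) : 0 ≤ segLen u s := by
  unfold segLen; split_ifs
  exacts [u.2.1, by linarith [u.2.2]]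

lemma segLen_le_one (u s : I) : segLen u s ≤ 1 := by
  unfold segLen; split_ifs
  exacts [u.2.2, by linarith [u.2.1]]

lemma coe_relLeft {u s : I} (hs : s ≤ u) : (relLeft u s : ℝ) = s / u := by
  rw [relLeft, Set.projIcc_of_mem]
  exact ⟨div_nonneg s.2.1 u.2.1, div_le_one_of_le₀ hs u.2.1⟩

lemma coe_relRight {u s : I} (hs : u ≤ s) : (relRight u s : ℝ) = (s - u) / (1 - u) := by
  rw [relRight, Set.projIcc_of_mem]
  have : (u : ℝ) ≤ s := hs
  exact ⟨div_nonneg (by linarith) (by linarith [u.2.2]),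
    div_le_one_of_le₀ (by linarith [s.2.2]) (by linarith [u.2.2])⟩

lemma mul_relLeft {u s : I} (hs : s ≤ u) : (u : ℝ) * relLeft u s = s := by
  rw [coe_relLeft hs]
  rcases eq_or_ne (u : ℝ) 0 with h0 | h0
  · have : (s : ℝ) ≤ u := hs
    rw [h0]; linarith [s.2.1]
  · field_simp

lemma mul_relRight {u s : I} (hs : u ≤ s) : (1 - (u : ℝ)) * relRight u s = s - u := by
  rw [coe_relRight hs]
  rcases eq_or_ne (1 - (u : ℝ)) 0 with h0 | h0
  · have : (u : ℝ) ≤ s := hs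
    rw [h0]; linarith [s.2.2]
  · field_simp

lemma measurable_relLeft : Measurable fun q : I × I => relLeft q.1 q.2 :=
  continuous_projIcc.measurable.comp (by fun_prop)

lemma measurable_relRight : Measurable fun q : I × I => relRight q.1 q.2 :=
  continuous_projIcc.measurable.comp (by fun_prop)

lemma measurableSet_lt_snd_fst : MeasurableSet {q : I × I | q.2 < q.1} :=
  measurableSet_lt measurable_snd measurable_fst

@[fun_prop]
lemma measurable_segPos : Measurable fun q : I × I => segPos q.1 q.2 :=
  Measurable.ite measurableSet_lt_snd_fst measurable_relLeft measurable_relRight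

@[fun_prop]
lemma measurable_segLen : Measurable fun q : I × I => segLen q.1 q.2 :=
  Measurable.ite measurableSet_lt_snd_fst (by fun_prop) (by fun_prop)

/-- The weight `p (1 - p)` of the relative position, rescaled by the squared length, involves no
quotient. -/
lemma segLen_sq_mul_segPos (u s : I) :
    segLen u s ^ 2 * ((segPos u s : ℝ) * (1 - segPos u s))
      = if s < u then (s : ℝ) * (u - s) else (s - u) * (1 - s) := by
  unfold segLen segPos
  split_ifs with hs
  · have := mul_relLeft hs.le
    linear_combination (u * (1 - (relLeft u s : ℝ)) - s) * this
  · have := mul_relRight (not_lt.1 hs)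
    linear_combination ((1 - u) * (1 - (relRight u s : ℝ)) - (s - u)) * this

lemma mul_one_sub_nonneg (s : I) : 0 ≤ (s : ℝ) * (1 - s) :=
  mul_nonneg s.2.1 (by linarith [s.2.2])

lemma segLen_rpow_mul (u s : I) (c : ℝ) :
    segLen u s ^ (2 * c) * ((segPos u s : ℝ) * (1 - segPos u s)) ^ c
      = if s < u then ((s : ℝ) * (u - s)) ^ c else ((s - u) * (1 - s)) ^ c := by
  rw [Real.rpow_mul (segLen_nonneg u s), Real.rpow_two,
    ← Real.mul_rpow (sq_nonneg _) (mul_one_sub_nonneg _), segLen_sq_mul_segPos]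
  split_ifs <;> rfl

lemma integral_unitInterval (g : ℝ → ℝ) : ∫ x : I, g x = ∫ x in (0 : ℝ)..1, g x := by
  rw [unitInterval.measurePreserving_coe.integral_comp unitInterval.measurableEmbedding_coe,
    intervalIntegral.integral_of_le zero_le_one, integral_Icc_eq_integral_Ioc]

/-- The functions `s ↦ (s (1 - s)) ^ c` are eigenfunctions of the averaged splitting operator. -/
lemma integral_segLen_rpow_mul (s : I) {c : ℝ} (hc : 0 < c) :
    ∫ u : I, segLen u s ^ (2 * c) * ((segPos u s : ℝ) * (1 - segPos u s)) ^ c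
      = ((s : ℝ) * (1 - s)) ^ c / (c + 1) := by
  simp_rw [segLen_rpow_mul]
  have e : ∀ u : I, (if s < u then ((s : ℝ) * (u - s)) ^ c else ((s - u) * (1 - s)) ^ c)
      = (fun x : ℝ => if (s : ℝ) < x then ((s : ℝ) * (x - s)) ^ c
          else ((s - x) * (1 - s)) ^ c) u := fun u => rfl
  rw [integral_congr_ae (ae_of_all _ e), integral_unitInterval fun x : ℝ =>
    if (s : ℝ) < x then ((s : ℝ) * (x - s)) ^ c else ((s - x) * (1 - s)) ^ c]
  have hs0 := s.2.1
  have hs1 := s.2.2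
  have c1 : Continuous fun x : ℝ => ((s : ℝ) * (x - s)) ^ c :=
    Continuous.rpow_const (by fun_prop) fun _ => Or.inr hc.le
  have c2 : Continuous fun x : ℝ => ((s - x) * (1 - (s : ℝ))) ^ c :=
    Continuous.rpow_const (by fun_prop) fun _ => Or.inr hc.le
  -- cut the integral at `u = s`: the piece containing `s` is the right one for `u < s`
  have i1 : Set.EqOn (fun x : ℝ => if (s : ℝ) < x then ((s : ℝ) * (x - s)) ^ c
      else ((s - x) * (1 - s)) ^ c) (fun x : ℝ => ((s - x) * (1 - (s : ℝ))) ^ c)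
      (Set.uIoc 0 (s : ℝ)) := by
    intro x hx
    rw [Set.uIoc_of_le hs0] at hx
    simp [not_lt.2 hx.2]
  have i2 : Set.EqOn (fun x : ℝ => if (s : ℝ) < x then ((s : ℝ) * (x - s)) ^ c
      else ((s - x) * (1 - s)) ^ c) (fun x : ℝ => ((s : ℝ) * (x - s)) ^ c)
      (Set.uIoc (s : ℝ) 1) := by
    intro x hx
    rw [Set.uIoc_of_le hs1] at hx
    simp [hx.1]
  rw [← intervalIntegral.integral_add_adjacent_intervals (b := (s : ℝ))
      ((intervalIntegrable_congr i1).2 (c2.intervalIntegrable _ _))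
      ((intervalIntegrable_congr i2).2 (c1.intervalIntegrable _ _)),
    intervalIntegral.integral_congr_ae (ae_of_all _ i1),
    intervalIntegral.integral_congr_ae (ae_of_all _ i2)]
  have j1 : ∫ x in (0 : ℝ)..s, ((s - x) * (1 - (s : ℝ))) ^ c
      = (s : ℝ) ^ (c + 1) / (c + 1) * (1 - s : ℝ) ^ c := by
    have : ∀ x ∈ Set.uIcc 0 (s : ℝ), ((s - x) * (1 - (s : ℝ))) ^ c
        = (s - x : ℝ) ^ c * (1 - s : ℝ) ^ c := fun x hx => by
      rw [Set.uIcc_of_le hs0] at hx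
      exact Real.mul_rpow (by linarith [hx.2]) (by linarith)
    rw [intervalIntegral.integral_congr this, intervalIntegral.integral_mul_const,
      intervalIntegral.integral_comp_sub_left (fun x : ℝ => x ^ c), sub_self, sub_zero,
      integral_rpow (Or.inl (by linarith)), Real.zero_rpow (by linarith), sub_zero]
  have j2 : ∫ x in (s : ℝ)..1, ((s : ℝ) * (x - s)) ^ c
      = (s : ℝ) ^ c * ((1 - s : ℝ) ^ (c + 1) / (c + 1)) := by
    have : ∀ x ∈ Set.uIcc (s : ℝ) 1, ((s : ℝ) * (x - s)) ^ c
        = (s : ℝ) ^ c * (x - s : ℝ) ^ c := fun x hx => by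
      rw [Set.uIcc_of_le hs1] at hx
      exact Real.mul_rpow hs0 (by linarith [hx.1])
    rw [intervalIntegral.integral_congr this, intervalIntegral.integral_const_mul,
      intervalIntegral.integral_comp_sub_right (fun x : ℝ => x ^ c), sub_self,
      integral_rpow (Or.inl (by linarith)), Real.zero_rpow (by linarith), sub_zero]
  rw [j1, j2, Real.mul_rpow hs0 (by linarith), Real.rpow_add_one' hs0 (by linarith),
    Real.rpow_add_one' (by linarith) (by linarith)]
  ring

lemma integral_rpow_unitInterval {c : ℝ} (hc : 0 ≤ c) : ∫ y : I, (y : ℝ) ^ c = 1 / (c + 1) := by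
  rw [integral_unitInterval (fun y => y ^ c), integral_rpow (Or.inl (by linarith)),
    Real.one_rpow, Real.zero_rpow (by linarith), sub_zero]

lemma integral_one_sub_rpow_unitInterval {c : ℝ} (hc : 0 ≤ c) :
    ∫ y : I, (1 - (y : ℝ)) ^ c = 1 / (c + 1) := by
  rw [integral_unitInterval (fun y => (1 - y) ^ c),
    intervalIntegral.integral_comp_sub_left (fun y : ℝ => y ^ c)]
  norm_num
  rw [integral_rpow (Or.inl (by linarith)),
    Real.one_rpow, Real.zero_rpow (by linarith), sub_zero]
  norm_num

lemma integral_mul_one_sub_rpow {c : ℝ} (hc : 0 ≤ c) :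
    ∫ y : I, ((y : ℝ) * (1 - y)) ^ c = beta (c + 1) (c + 1) := by
  rw [integral_unitInterval (fun y => (y * (1 - y)) ^ c),
    beta_eq_betaIntegralReal _ _ (by linarith) (by linarith), Complex.betaIntegral]
  have : ∀ x ∈ Set.uIcc (0 : ℝ) 1,
      (x : ℂ) ^ (((c + 1 : ℝ) : ℂ) - 1) * (1 - (x : ℂ)) ^ (((c + 1 : ℝ) : ℂ) - 1)
        = (((x * (1 - x)) ^ c : ℝ) : ℂ) := fun x hx => by
    rw [Set.uIcc_of_le zero_le_one] at hx
    rw [Real.mul_rpow hx.1 (by linarith [hx.2]), Complex.ofReal_mul,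
      Complex.ofReal_cpow hx.1, Complex.ofReal_cpow (by linarith [hx.2])]
    push_cast
    simp
  rw [intervalIntegral.integral_congr this, intervalIntegral.integral_ofReal, Complex.ofReal_re]

lemma measurable_fix_segLen (s : I) : Measurable fun u : I => segLen u s :=
  measurable_segLen.comp (measurable_id.prodMk measurable_const)

lemma measurable_fix_segPos (s : I) : Measurable fun u : I => segPos u s :=
  measurable_segPos.comp (measurable_id.prodMk measurable_const)

lemma integrable_of_bound {α : Type*} [MeasurableSpace α] {μ : Measure α} [IsFiniteMeasure μ]
    {f : α → ℝ} (hf : Measurable f) (C : ℝ) (hb : ∀ x, |f x| ≤ C) : Integrable f μ :=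
  Integrable.of_bound hf.aestronglyMeasurable C (ae_of_all _ hb)

lemma abs_rpow_le_one {x c : ℝ} (h0 : 0 ≤ x) (h1 : x ≤ 1) (hc : 0 ≤ c) : |x ^ c| ≤ 1 := by
  rw [abs_of_nonneg (Real.rpow_nonneg h0 _)]
  exact Real.rpow_le_one h0 h1 hc

lemma integral_segLen_rpow_le (s : I) {c : ℝ} (hc : 0 ≤ c) :
    ∫ u : I, segLen u s ^ c ≤ 2 / (c + 1) := by
  have a1 : Integrable (fun u : I => (u : ℝ) ^ c) :=
    integrable_of_bound (by fun_prop) 1 fun x => abs_rpow_le_one x.2.1 x.2.2 hc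
  have a2 : Integrable (fun u : I => (1 - u : ℝ) ^ c) :=
    integrable_of_bound (by fun_prop) 1 fun x =>
      abs_rpow_le_one (by linarith [x.2.2]) (by linarith [x.2.1]) hc
  calc ∫ u : I, segLen u s ^ c ≤ ∫ u : I, ((u : ℝ) ^ c + (1 - (u : ℝ)) ^ c) := by
        refine integral_mono (integrable_of_bound ((measurable_fix_segLen s).pow_const c) 1
          fun x => abs_rpow_le_one (segLen_nonneg _ _) (segLen_le_one _ _) hc) (a1.add a2) ?_
        intro u
        have h1 : 0 ≤ (u : ℝ) ^ c := Real.rpow_nonneg u.2.1 _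
        have h2 : 0 ≤ (1 - u : ℝ) ^ c := Real.rpow_nonneg (by linarith [u.2.2]) _
        simp only [segLen]
        split_ifs <;> linarith
    _ = 2 / (c + 1) := by
        rw [integral_add a1 a2, integral_rpow_unitInterval hc,
          integral_one_sub_rpow_unitInterval hc]
        ring

lemma integral_segLen_mul_h (s : I) :
    ∫ u : I, segLen u s ^ bexp * h (segPos u s) = h s / (bexp / 2 + 1) := by
  have := integral_segLen_rpow_mul s (c := bexp / 2) (by linarith [bexp_pos])
  rwa [show 2 * (bexp / 2) = bexp by ring] at this

lemma integral_segLen_mul_h_sq (s : I) :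
    ∫ u : I, segLen u s ^ (2 * bexp) * h (segPos u s) ^ 2 = h s ^ 2 / (bexp + 1) := by
  simp_rw [h_sq]
  exact integral_segLen_rpow_mul s bexp_pos

lemma integral_h : ∫ s : I, h s = beta (bexp / 2 + 1) (bexp / 2 + 1) :=
  integral_mul_one_sub_rpow (by linarith [bexp_pos])

lemma integral_h_sq : ∫ s : I, h s ^ 2 = beta (bexp + 1) (bexp + 1) := by
  simp_rw [h_sq]
  exact integral_mul_one_sub_rpow bexp_pos.le

lemma integral_rpow_mul_one_sub_rpow :
    ∫ y : I, (y : ℝ) ^ bexp * (1 - (y : ℝ)) ^ bexp = beta (bexp + 1) (bexp + 1) := by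
  rw [← integral_mul_one_sub_rpow bexp_pos.le]
  refine integral_congr_ae (ae_of_all _ fun y => ?_)
  exact (Real.mul_rpow y.2.1 (by linarith [y.2.2])).symm

/-! ### Regularity of the splitting and mixing operators -/

lemma splitOp_eq (u s : I) (f : Fin 2 → I → ℝ) :
    splitOp u f s = segLen u s ^ bexp * (if s < u then f 0 else f 1) (segPos u s) := by
  unfold splitOp segLen segPos
  split_ifs <;> rfl

lemma parOp_eq_splitOp_mixOp (x y z : I) (f : Fin 4 → I → ℝ) :
    parOp x y z f = splitOp x ![mixOp y ![f 0, f 1], mixOp z ![f 2, f 3]] := by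
  funext s
  have hx : 0 ≤ 1 - (x : ℝ) := by linarith [x.2.2]
  have hy : 0 ≤ 1 - (y : ℝ) := by linarith [y.2.2]
  have hz : 0 ≤ 1 - (z : ℝ) := by linarith [z.2.2]
  simp only [parOp, splitOp, mixOp, Matrix.cons_val_zero, Matrix.cons_val_one,
    Real.mul_rpow x.2.1 y.2.1, Real.mul_rpow x.2.1 hy, Real.mul_rpow hx z.2.1, Real.mul_rpow hx hz]
  split_ifs <;> ring

lemma perpOp_eq_mixOp_splitOp (xd xu v : I) (f : Fin 4 → I → ℝ) :
    perpOp xd xu v f = mixOp v ![splitOp xd ![f 0, f 2], splitOp xu ![f 1, f 3]] := by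
  funext s
  have hd : 0 ≤ 1 - (xd : ℝ) := by linarith [xd.2.2]
  have hu : 0 ≤ 1 - (xu : ℝ) := by linarith [xu.2.2]
  have hv : 0 ≤ 1 - (v : ℝ) := by linarith [v.2.2]
  simp only [perpOp, splitOp, mixOp, Matrix.cons_val_zero, Matrix.cons_val_one,
    Real.mul_rpow xd.2.1 v.2.1, Real.mul_rpow xu.2.1 hv, Real.mul_rpow hd v.2.1,
    Real.mul_rpow hu hv, ← not_lt]
  split_ifs <;> first | contradiction | ring

lemma relLeft_self {u : I} (hu : u ≠ 0) : relLeft u u = 1 := by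
  have : (u : ℝ) ≠ 0 := fun h0 => hu (Subtype.ext h0)
  ext
  rw [coe_relLeft le_rfl, div_self this]; rfl

lemma relRight_self (u : I) : relRight u u = 0 := by
  ext
  rw [coe_relRight le_rfl, sub_self, zero_div]; rfl

/-- The two pieces are glued continuously at `u` when the functions vanish at the ends that meet
there. -/
lemma continuous_splitOp (u : I) {f : Fin 2 → I → ℝ} (hf : ∀ i, Continuous (f i))
    (h0 : f 1 0 = 0) (h1 : f 0 1 = 0) : Continuous (splitOp u f) := by
  have e : splitOp u f = fun s => if u ≤ s then (1 - (u : ℝ)) ^ bexp * f 1 (relRight u s)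
      else (u : ℝ) ^ bexp * f 0 (relLeft u s) := by
    funext s
    simp only [splitOp, ← not_lt]
    split_ifs <;> first | contradiction | rfl
  have cL : Continuous (relLeft u) := continuous_projIcc.comp (by fun_prop)
  have cR : Continuous (relRight u) := continuous_projIcc.comp (by fun_prop)
  rw [e]
  refine Continuous.if_le (((hf 1).comp cR).const_mul _) (((hf 0).comp cL).const_mul _)
    continuous_const continuous_id ?_
  rintro s rfl
  rw [relRight_self, h0]
  rcases eq_or_ne u 0 with rfl | hu
  · simp [Real.zero_rpow bexp_pos.ne']
  · rw [relLeft_self hu, h1]; simp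

lemma splitOp_zero (u : I) {f : Fin 2 → I → ℝ} (h0 : ∀ i, f i 0 = 0) : splitOp u f 0 = 0 := by
  unfold splitOp
  split_ifs with hu
  · rw [show relLeft u 0 = 0 by simp [relLeft], h0, mul_zero]
  · obtain rfl : u = 0 := le_antisymm (not_lt.1 hu) bot_le
    rw [relRight_self, h0, mul_zero]

lemma splitOp_one (u : I) {f : Fin 2 → I → ℝ} (h1 : ∀ i, f i 1 = 0) : splitOp u f 1 = 0 := by
  unfold splitOp
  rw [if_neg (not_lt.2 (show u ≤ 1 from le_top))]
  rcases eq_or_ne (1 - (u : ℝ)) 0 with h0 | h0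
  · rw [h0, Real.zero_rpow bexp_pos.ne', zero_mul]
  · have : relRight u 1 = 1 := by
      ext
      rw [coe_relRight (show u ≤ 1 from le_top)]
      exact div_self h0
    rw [this, h1, mul_zero]

lemma mixOp_congr_zero (v s : I) {f : Fin 2 → I → ℝ} (h0 : ∀ i, f i s = 0) : mixOp v f s = 0 := by
  simp [mixOp, h0]

/-- Functions vanishing at both endpoints and Hölder continuous of exponent `β / 2`, the
regularity of `h`, with constant `K`. -/
structure HolderVanish (K : ℝ) (f : I → ℝ) : Prop where
  zero : f 0 = 0
  one : f 1 = 0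
  holder : ∀ s t : I, |f s - f t| ≤ K * |(s : ℝ) - t| ^ (bexp / 2)

namespace HolderVanish

variable {K K' : ℝ} {f g : I → ℝ}

lemma nonneg (hf : HolderVanish K f) : 0 ≤ K := by
  have := (abs_nonneg _).trans (hf.holder 0 1)
  simpa using this

lemma abs_le (hf : HolderVanish K f) (s : I) : |f s| ≤ K := by
  have h1 := hf.holder s 0
  rw [hf.zero, sub_zero] at h1
  refine h1.trans (mul_le_of_le_one_right hf.nonneg ?_)
  refine Real.rpow_le_one (abs_nonneg _) ?_ (by linarith [bexp_pos])
  simpa [abs_of_nonneg s.2.1] using s.2.2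

lemma continuous (hf : HolderVanish K f) : Continuous f := by
  rw [continuous_iff_continuousAt]
  intro t
  have hb := bexp_pos
  refine tendsto_iff_dist_tendsto_zero.2 (squeeze_zero (fun _ => dist_nonneg)
    (fun s => (Real.dist_eq _ _).trans_le (hf.holder s t)) ?_)
  have c : Continuous fun s : I => K * |(s : ℝ) - t| ^ (bexp / 2) :=
    continuous_const.mul (Continuous.rpow_const (by fun_prop) fun _ => Or.inr (by positivity))
  have := c.tendsto t
  simpa [Real.zero_rpow (by positivity : bexp / 2 ≠ 0)] using this

lemma sub (hf : HolderVanish K f) (hg : HolderVanish K' g) :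
    HolderVanish (K + K') (fun s => f s - g s) where
  zero := by simp [hf.zero, hg.zero]
  one := by simp [hf.one, hg.one]
  holder s t := by
    calc |f s - g s - (f t - g t)| = |(f s - f t) - (g s - g t)| := by ring_nf
      _ ≤ |f s - f t| + |g s - g t| := abs_sub _ _
      _ ≤ _ := by rw [add_mul]; exact add_le_add (hf.holder s t) (hg.holder s t)

lemma mixOp {f : Fin 2 → I → ℝ} (hf : ∀ i, HolderVanish K (f i)) (v : I) :
    HolderVanish (2 * K) (mixOp v f) where
  zero := mixOp_congr_zero v 0 fun i => (hf i).zero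
  one := mixOp_congr_zero v 1 fun i => (hf i).one
  holder s t := by
    have hb := bexp_pos
    have a0 : |(v : ℝ) ^ bexp| ≤ 1 := abs_rpow_le_one v.2.1 v.2.2 hb.le
    have a1 : |(1 - v : ℝ) ^ bexp| ≤ 1 :=
      abs_rpow_le_one (by linarith [v.2.2]) (by linarith [v.2.1]) hb.le
    calc |PartialMatch.mixOp v f s - PartialMatch.mixOp v f t|
        = |(v : ℝ) ^ bexp * (f 0 s - f 0 t) + (1 - v : ℝ) ^ bexp * (f 1 s - f 1 t)| := by
          unfold PartialMatch.mixOp; ring_nf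
      _ ≤ |(v : ℝ) ^ bexp * (f 0 s - f 0 t)| + |(1 - v : ℝ) ^ bexp * (f 1 s - f 1 t)| :=
          abs_add_le _ _
      _ ≤ |f 0 s - f 0 t| + |f 1 s - f 1 t| := by
          rw [abs_mul, abs_mul]
          exact add_le_add (mul_le_of_le_one_left (abs_nonneg _) a0)
            (mul_le_of_le_one_left (abs_nonneg _) a1)
      _ ≤ _ := by linarith [(hf 0).holder s t, (hf 1).holder s t]

/-- Rescaling to a piece of length `a` keeps the Hölder constant: the factor `a ^ (-β/2)` it costs is
absorbed by the weight `a ^ β`. -/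
lemma splitOp_aux (hf : HolderVanish K f) {a s t : ℝ} {p q : I} (ha : 0 ≤ a) (ha1 : a ≤ 1)
    (hp : a * p - a * q = s - t) :
    |a ^ bexp * f p - a ^ bexp * f q| ≤ K * |s - t| ^ (bexp / 2) := by
  have hb := bexp_pos
  have e : a ^ bexp * |(p : ℝ) - q| ^ (bexp / 2) = a ^ (bexp / 2) * |s - t| ^ (bexp / 2) := by
    rw [← hp, ← mul_sub, abs_mul, abs_of_nonneg ha, Real.mul_rpow ha (abs_nonneg _), ← mul_assoc,
      ← Real.rpow_add_of_nonneg ha (by positivity) (by positivity), add_halves]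
  calc |a ^ bexp * f p - a ^ bexp * f q| = a ^ bexp * |f p - f q| := by
        rw [← mul_sub, abs_mul, abs_of_nonneg (Real.rpow_nonneg ha _)]
    _ ≤ a ^ bexp * (K * |(p : ℝ) - q| ^ (bexp / 2)) :=
        mul_le_mul_of_nonneg_left (hf.holder _ _) (Real.rpow_nonneg ha _)
    _ = K * (a ^ (bexp / 2) * |s - t| ^ (bexp / 2)) := by rw [← e]; ring
    _ ≤ _ := mul_le_mul_of_nonneg_left (mul_le_of_le_one_left
        (Real.rpow_nonneg (abs_nonneg _) _) (Real.rpow_le_one ha ha1 (by positivity))) hf.nonneg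

/-- The Hölder constant at most doubles, the worst case being a pair of points separated by the
cut. -/
lemma splitOp {f : Fin 2 → I → ℝ} (hf : ∀ i, HolderVanish K (f i)) (u : I) :
    HolderVanish (2 * K) (splitOp u f) where
  zero := splitOp_zero u fun i => (hf i).zero
  one := splitOp_one u fun i => (hf i).one
  holder := by
    have hb := bexp_pos
    have hK := (hf 0).nonneg
    have hu0 := u.2.1
    have hu1 := u.2.2
    have L : ∀ s t : I, s ≤ u → t ≤ u → |(u : ℝ) ^ bexp * f 0 (relLeft u s)
        - (u : ℝ) ^ bexp * f 0 (relLeft u t)| ≤ K * |(s : ℝ) - t| ^ (bexp / 2) :=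
      fun s t hs ht => splitOp_aux (hf 0) u.2.1 u.2.2 (by rw [mul_relLeft hs, mul_relLeft ht])
    have R : ∀ s t : I, u ≤ s → u ≤ t → |(1 - u : ℝ) ^ bexp * f 1 (relRight u s)
        - (1 - u : ℝ) ^ bexp * f 1 (relRight u t)| ≤ K * |(s : ℝ) - t| ^ (bexp / 2) :=
      fun s t hs ht => splitOp_aux (hf 1) (by linarith) (by linarith)
        (by rw [mul_relRight hs, mul_relRight ht]; ring)
    have L0 : (u : ℝ) ^ bexp * f 0 (relLeft u u) = 0 := by
      rcases eq_or_ne u 0 with rfl | hu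
      · simp [Real.zero_rpow hb.ne']
      · rw [relLeft_self hu, (hf 0).one, mul_zero]
    have R0 : (1 - u : ℝ) ^ bexp * f 1 (relRight u u) = 0 := by
      rw [relRight_self, (hf 1).zero, mul_zero]
    -- the two points are on different sides: go through the cut, where both pieces vanish
    have C : ∀ s t : I, s < u → u ≤ t → |PartialMatch.splitOp u f s - PartialMatch.splitOp u f t|
        ≤ 2 * K * |(s : ℝ) - t| ^ (bexp / 2) := fun s t hs ht => by
      have hs' : (s : ℝ) < u := hs
      have ht' : (u : ℝ) ≤ t := ht
      have a := L s u hs.le le_rfl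
      have b := R u t le_rfl ht
      rw [L0, sub_zero] at a
      rw [R0, zero_sub, abs_neg] at b
      have m1 : |(s : ℝ) - u| ^ (bexp / 2) ≤ |(s : ℝ) - t| ^ (bexp / 2) :=
        Real.rpow_le_rpow (abs_nonneg _) (by
          rw [abs_of_neg (by linarith), abs_of_neg (by linarith)]; linarith) (by positivity)
      have m2 : |(u : ℝ) - t| ^ (bexp / 2) ≤ |(s : ℝ) - t| ^ (bexp / 2) :=
        Real.rpow_le_rpow (abs_nonneg _) (by
          rw [abs_of_nonpos (by linarith), abs_of_neg (by linarith)]; linarith) (by positivity)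
      unfold PartialMatch.splitOp
      rw [if_pos hs, if_neg (not_lt.2 ht)]
      refine (abs_sub _ _).trans ?_
      nlinarith [mul_le_mul_of_nonneg_left m1 hK, mul_le_mul_of_nonneg_left m2 hK]
    intro s t
    have hK2 : K * |(s : ℝ) - t| ^ (bexp / 2) ≤ 2 * K * |(s : ℝ) - t| ^ (bexp / 2) :=
      mul_le_mul_of_nonneg_right (by linarith) (Real.rpow_nonneg (abs_nonneg _) _)
    rcases lt_or_ge s u with hs | hs <;> rcases lt_or_ge t u with ht | ht
    · simpa [PartialMatch.splitOp, hs, ht] using (L s t hs.le ht.le).trans hK2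
    · exact C s t hs ht
    · rw [abs_sub_comm, abs_sub_comm (s : ℝ)]; exact C t s ht hs
    · simpa [PartialMatch.splitOp, not_lt.2 hs, not_lt.2 ht] using (R s t hs ht).trans hK2

lemma parOp {f : Fin 4 → I → ℝ} (hf : ∀ i, HolderVanish K (f i)) (x y z : I) :
    HolderVanish (4 * K) (parOp x y z f) := by
  rw [parOp_eq_splitOp_mixOp, show 4 * K = 2 * (2 * K) by ring]
  refine HolderVanish.splitOp (fun i => ?_) x
  fin_cases i
  · refine HolderVanish.mixOp (fun i => ?_) y
    fin_cases i
    exacts [hf 0, hf 1]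
  · refine HolderVanish.mixOp (fun i => ?_) z
    fin_cases i
    exacts [hf 2, hf 3]

end HolderVanish

lemma abs_rpow_sub_rpow_le {a b c : ℝ} (ha : 0 ≤ a) (hb : 0 ≤ b) (hc0 : 0 ≤ c) (hc1 : c ≤ 1) :
    |a ^ c - b ^ c| ≤ |a - b| ^ c := by
  wlog hab : b ≤ a generalizing a b
  · rw [abs_sub_comm, abs_sub_comm a]; exact this hb ha (le_of_not_ge hab)
  have h1 : b ^ c ≤ a ^ c := Real.rpow_le_rpow hb hab hc0
  have h2 := Real.rpow_add_le_add_rpow hb (sub_nonneg.2 hab) hc0 hc1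
  rw [add_sub_cancel] at h2
  rw [abs_of_nonneg (by linarith), abs_of_nonneg (by linarith)]
  linarith

lemma holderVanish_h : HolderVanish 1 h where
  zero := h_zero
  one := h_one
  holder s t := by
    have hb := bexp_pos
    rw [one_mul]
    refine (abs_rpow_sub_rpow_le (mul_one_sub_nonneg s) (mul_one_sub_nonneg t) (by positivity)
      (by linarith [bexp_lt_one])).trans (Real.rpow_le_rpow (abs_nonneg _) ?_ (by positivity))
    rw [show (s : ℝ) * (1 - s) - t * (1 - t) = (s - t) * (1 - s - t) by ring, abs_mul]
    refine mul_le_of_le_one_right (abs_nonneg _) ?_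
    rw [abs_le]
    constructor <;> linarith [s.2.1, s.2.2, t.2.1, t.2.2]

/-! ### Laws on `C[0,1]` -/

@[fun_prop]
lemma measurable_evalPair : Measurable fun q : C(I, ℝ) × I => q.1 q.2 :=
  continuous_eval.measurable

/-- Evaluation on a dense set is injective on continuous functions, hence, by the
Lusin-Souslin theorem, evaluation on a countable dense set is a measurable embedding. -/
lemma measurableEmbedding_restrict {S : Set I} (hS : S.Countable) (hd : Dense S) :
    MeasurableEmbedding fun (f : C(I, ℝ)) (s : S) => f s := by
  have : Countable S := hS
  refine Measurable.measurableEmbedding ?_ ?_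
  · exact measurable_pi_lambda _ fun s => (continuous_eval_const (s : I)).measurable
  · intro f g hfg
    exact DFunLike.coe_injective (Continuous.ext_on hd f.continuous g.continuous
      fun s hs => congrFun hfg ⟨s, hs⟩)

lemma measurable_of_eval {Ω : Type*} [MeasurableSpace Ω] {Z : Ω → C(I, ℝ)}
    (hZ : ∀ s, Measurable fun ω => Z ω s) : Measurable Z := by
  obtain ⟨S, hS, hd⟩ := TopologicalSpace.exists_countable_dense I
  rw [← (measurableEmbedding_restrict hS hd).measurable_comp_iff]
  exact measurable_pi_lambda _ fun s => hZ s

lemma measurable_coeFn : Measurable fun (f : C(I, ℝ)) => (f : I → ℝ) :=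
  measurable_pi_lambda _ fun s => (continuous_eval_const s).measurable

/-- A law on `C[0,1]` is determined by the law of the family of evaluations. -/
lemma ext_of_map_coeFn {μ ν : Measure C(I, ℝ)}
    (hμν : μ.map (fun f : C(I, ℝ) => (f : I → ℝ)) = ν.map (fun f : C(I, ℝ) => (f : I → ℝ))) :
    μ = ν := by
  obtain ⟨S, hS, hd⟩ := TopologicalSpace.exists_countable_dense I
  have he := measurableEmbedding_restrict hS hd
  have hr : Measurable fun (g : I → ℝ) (s : S) => g s := by fun_prop
  have := congrArg (Measure.map fun (g : I → ℝ) (s : S) => g s) hμν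
  rw [Measure.map_map hr measurable_coeFn, Measure.map_map hr measurable_coeFn] at this
  rw [← he.comap_map μ, ← he.comap_map ν]
  exact congrArg _ this

lemma norm_exp_mul_I_sub_le (a b : ℝ) :
    ‖Complex.exp (a * Complex.I) - Complex.exp (b * Complex.I)‖ ≤ |a - b| := by
  have e : Complex.exp (a * Complex.I) - Complex.exp (b * Complex.I)
      = Complex.exp (b * Complex.I) * (Complex.exp (Complex.I * (a - b : ℝ)) - 1) := by
    rw [mul_sub, ← Complex.exp_add, mul_one]
    congr 2
    push_cast; ring
  rw [e, norm_mul, Complex.norm_exp_ofReal_mul_I, one_mul]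
  exact Real.norm_exp_I_mul_ofReal_sub_one_le

/-- Two laws on `C[0,1]` are equal as soon as they have couplings whose evaluations at the points
of a dense set get arbitrarily close in mean. -/
lemma eq_of_tendsto_coupling {μ ν : Measure C(I, ℝ)} [IsProbabilityMeasure μ]
    [IsProbabilityMeasure ν] {ρ : ℕ → Measure (C(I, ℝ) × C(I, ℝ))}
    (h1 : ∀ n, (ρ n).map Prod.fst = μ) (h2 : ∀ n, (ρ n).map Prod.snd = ν) {D : Set I}
    (hD : Dense D)
    (hlim : ∀ s ∈ D, Tendsto (fun n => ∫⁻ q, ‖q.1 s - q.2 s‖ₑ ∂ρ n) atTop (𝓝 0)) : μ = ν := by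
  obtain ⟨S, hSD, hS, hd⟩ := hD.exists_countable_dense_subset
  have he := measurableEmbedding_restrict hS hd
  rw [← he.comap_map μ, ← he.comap_map ν]
  congr 1
  have := Measure.isProbabilityMeasure_map (μ := μ) he.measurable.aemeasurable
  have := Measure.isProbabilityMeasure_map (μ := ν) he.measurable.aemeasurable
  -- it suffices to compare the marginals at finitely many points of the dense set
  refine IsProjectiveLimit.unique (P := fun J => (ν.map _).map J.restrict) (fun J => ?_)
    (fun J => rfl)
  have hr : Measurable fun (f : C(I, ℝ)) (j : J) => f (j : S) :=
    measurable_pi_lambda _ fun j => (continuous_eval_const _).measurable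
  have e : ∀ κ : Measure C(I, ℝ), (κ.map fun (f : C(I, ℝ)) (s : S) => f s).map J.restrict
      = κ.map fun (f : C(I, ℝ)) (j : J) => f (j : S) := fun κ => by
    rw [Measure.map_map (Finset.measurable_restrict J) he.measurable]; rfl
  change (μ.map fun (f : C(I, ℝ)) (s : S) => f s).map J.restrict = _
  change _ = (ν.map fun (f : C(I, ℝ)) (s : S) => f s).map J.restrict
  rw [e, e]
  have := Measure.isProbabilityMeasure_map (μ := μ) hr.aemeasurable
  have := Measure.isProbabilityMeasure_map (μ := ν) hr.aemeasurable
  -- characteristic functions of these marginals, compared through the couplings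
  refine Measure.ext_of_charFunDual (funext fun L => ?_)
  have hm : Measurable fun x : J → ℝ => Complex.exp (L x * Complex.I) := by fun_prop
  rw [charFunDual_apply, charFunDual_apply, integral_map hr.aemeasurable
    hm.aestronglyMeasurable, integral_map hr.aemeasurable hm.aestronglyMeasurable]
  set g : C(I, ℝ) → ℂ := fun f => Complex.exp (L (fun j : J => f (j : S)) * Complex.I)
  have hg : Measurable g := hm.comp hr
  have hgb : ∀ f, ‖g f‖ ≤ 1 := fun f => (Complex.norm_exp_ofReal_mul_I _).le
  have bound : ∀ n, ‖∫ f, g f ∂μ - ∫ f, g f ∂ν‖ₑ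
      ≤ ‖L‖ₑ * ∑ j : J, ∫⁻ q, ‖q.1 (j : S) - q.2 (j : S)‖ₑ ∂ρ n := fun n => by
    have : IsProbabilityMeasure (ρ n) := by
      rw [← Measure.isProbabilityMeasure_map_iff (f := Prod.fst) (by fun_prop), h1 n]
      infer_instance
    have i1 : Integrable (fun q : C(I, ℝ) × C(I, ℝ) => g q.1) (ρ n) :=
      Integrable.of_bound (hg.comp measurable_fst).aestronglyMeasurable 1
        (ae_of_all _ fun q => hgb _)
    have i2 : Integrable (fun q : C(I, ℝ) × C(I, ℝ) => g q.2) (ρ n) :=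
      Integrable.of_bound (hg.comp measurable_snd).aestronglyMeasurable 1
        (ae_of_all _ fun q => hgb _)
    calc ‖∫ f, g f ∂μ - ∫ f, g f ∂ν‖ₑ = ‖∫ q, (g q.1 - g q.2) ∂ρ n‖ₑ := by
          rw [integral_sub i1 i2, ← h1 n, ← h2 n, integral_map measurable_fst.aemeasurable
            hg.aestronglyMeasurable, integral_map measurable_snd.aemeasurable
            hg.aestronglyMeasurable]
      _ ≤ ∫⁻ q, ‖g q.1 - g q.2‖ₑ ∂ρ n := enorm_integral_le_lintegral_enorm _
      _ ≤ ∫⁻ q, ‖L‖ₑ * ∑ j : J, ‖q.1 (j : S) - q.2 (j : S)‖ₑ ∂ρ n := by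
          refine lintegral_mono fun q => ?_
          have b1 : ‖g q.1 - g q.2‖ ≤ ‖L‖ * ∑ j : J, ‖q.1 (j : S) - q.2 (j : S)‖ := by
            refine (norm_exp_mul_I_sub_le _ _).trans ?_
            rw [← map_sub, ← Real.norm_eq_abs]
            refine (L.le_opNorm _).trans (mul_le_mul_of_nonneg_left ?_ (norm_nonneg _))
            refine (pi_norm_le_iff_of_nonneg (Finset.sum_nonneg fun _ _ => norm_nonneg _)).2
              fun j => ?_
            exact Finset.single_le_sum (f := fun j : J => ‖q.1 (j : S) - q.2 (j : S)‖)
              (fun _ _ => norm_nonneg _) (Finset.mem_univ j)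
          have b2 := ENNReal.ofReal_le_ofReal b1
          rwa [ENNReal.ofReal_mul (norm_nonneg _),
            ENNReal.ofReal_sum_of_nonneg (fun _ _ => norm_nonneg _), ofReal_norm,
            ofReal_norm, Finset.sum_congr rfl fun _ _ => ofReal_norm _] at b2
      _ = _ := by
          have m : ∀ j : J, Measurable fun q : C(I, ℝ) × C(I, ℝ) =>
              ‖q.1 (j : S) - q.2 (j : S)‖ₑ := fun j =>
            (((continuous_eval_const _).measurable.comp measurable_fst).sub
              ((continuous_eval_const _).measurable.comp measurable_snd)).enorm
          rw [lintegral_const_mul _ (Finset.measurable_sum _ fun j _ => m j),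
            lintegral_finsetSum _ fun j _ => m j]
  have lim : Tendsto (fun n => ‖L‖ₑ * ∑ j : J, ∫⁻ q, ‖q.1 (j : S) - q.2 (j : S)‖ₑ ∂ρ n)
      atTop (𝓝 0) := by
    have := tendsto_finsetSum (Finset.univ : Finset J)
      fun j _ => hlim (j : S) (hSD (j : S).2)
    have := ENNReal.Tendsto.const_mul (a := ‖L‖ₑ) this (Or.inr (by simp))
    simpa using this
  have := ge_of_tendsto' lim bound
  rw [nonpos_iff_eq_zero, enorm_eq_zero, sub_eq_zero] at this
  exact this

/-! ### Independent copies -/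

section Copies

variable {Ω Θ Y : Type*} [MeasurableSpace Ω] [MeasurableSpace Θ] [MeasurableSpace Y]
  {P : Measure Ω} [IsProbabilityMeasure P] {τ : Measure Θ} [IsProbabilityMeasure τ]

lemma map_pi_pair {k : ℕ} {i j : Fin k} (hij : i ≠ j) :
    (Measure.pi fun _ : Fin k => P).map (fun f => (f i, f j)) = P.prod P := by
  have hi := (iIndepFun_pi (μ := fun _ : Fin k => P) (X := fun _ => id)
    (fun _ => aemeasurable_id)).indepFun hij
  have := (indepFun_iff_map_prod_eq_prod_map_map (measurable_pi_apply i).aemeasurable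
    (measurable_pi_apply j).aemeasurable).1 hi
  rw [(measurePreserving_eval (fun _ : Fin k => P) i).map_eq,
    (measurePreserving_eval (fun _ : Fin k => P) j).map_eq] at this
  exact this

/-- The law of a functional of independent copies of `Z` depends on the law of `Z` only. -/
lemma map_prod_pi_comp {E : Type*} [MeasurableSpace E] {k : ℕ} {Z : Ω → E} (hZ : Measurable Z)
    {G : Θ × (Fin k → E) → Y} (hG : Measurable G) :
    (τ.prod (Measure.pi fun _ : Fin k => P)).map (fun q => G (q.1, fun i => Z (q.2 i)))
      = (τ.prod (Measure.pi fun _ : Fin k => P.map Z)).map G := by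
  have := Measure.isProbabilityMeasure_map (μ := P) hZ.aemeasurable
  have hpi : Measurable fun (f : Fin k → Ω) i => Z (f i) := by fun_prop
  rw [← Measure.pi_map_pi (f := fun _ => Z) fun _ => hZ.aemeasurable]
  nth_rewrite 2 [← Measure.map_id (μ := τ)]
  rw [Measure.map_prod_map _ _ measurable_id hpi,
    Measure.map_map hG (measurable_id.prodMap hpi)]
  rfl

lemma memLp_sum_pi {k : ℕ} {X : Fin k → Ω → ℝ} {p : ℝ≥0∞} (hX : ∀ i, MemLp (X i) p P) :
    MemLp (fun ω : Fin k → Ω => ∑ i, X i (ω i)) p (Measure.pi fun _ => P) :=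
  memLp_finsetSum _ fun i _ =>
    (hX i).comp_measurePreserving (measurePreserving_eval (fun _ : Fin k => P) i)

lemma integral_sum_pi {k : ℕ} {X : Fin k → Ω → ℝ} (hX : ∀ i, Integrable (X i) P) :
    ∫ ω : Fin k → Ω, ∑ i, X i (ω i) ∂(Measure.pi fun _ => P) = ∑ i, ∫ ω, X i ω ∂P := by
  have hi : ∀ i, Integrable (fun ω : Fin k → Ω => X i (ω i)) (Measure.pi fun _ => P) := fun i =>
    (measurePreserving_eval (fun _ : Fin k => P) i).integrable_comp_of_integrable (hX i)
  rw [integral_finsetSum _ fun i _ => hi i]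
  exact Finset.sum_congr rfl fun i _ => integral_comp_eval (μ := fun _ : Fin k => P)
    (hX i).aestronglyMeasurable

lemma integral_sum_pi_sq {k : ℕ} {X : Fin k → Ω → ℝ} (hX : ∀ i, MemLp (X i) 2 P) :
    ∫ ω : Fin k → Ω, (∑ i, X i (ω i)) ^ 2 ∂(Measure.pi fun _ => P)
      = ∑ i, variance (X i) P + (∑ i, ∫ ω, X i ω ∂P) ^ 2 := by
  have h1 := variance_eq_sub (memLp_sum_pi hX)
  have h2 := variance_sum_pi (μ := fun _ : Fin k => P) hX
  rw [integral_sum_pi fun i => (hX i).integrable (by norm_num)] at h1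
  have e : (∑ i, fun ω : Fin k → Ω => X i (ω i)) = fun ω => ∑ i, X i (ω i) := by
    ext; simp
  rw [e] at h2
  rw [← h2, h1]
  simp

/-- A law of the three cuts for which the first cut is uniform and independent of each of the two
others. -/
structure IsSplitLaw (τ : Measure (I × I × I)) : Prop where
  left : τ.map (fun θ => (θ.1, θ.2.1)) = (volume : Measure (I × I))
  right : τ.map (fun θ => (θ.1, θ.2.2)) = (volume : Measure (I × I))

/-- The lower cut that matters is the one on the side of `s`; whichever it is, it is uniform and
independent of the first cut. -/
lemma IsSplitLaw.lintegral {τ : Measure (I × I × I)} (hτ : IsSplitLaw τ) {F : I × I → ℝ≥0∞}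
    (hF : Measurable F) (s : I) :
    ∫⁻ θ, (if s < θ.1 then F (θ.1, θ.2.1) else F (θ.1, θ.2.2)) ∂τ = ∫⁻ q, F q := by
  set A : Set (I × I) := {q | s < q.1}
  have hA : MeasurableSet A := measurableSet_lt measurable_const measurable_fst
  have e : ∀ θ : I × I × I, (if s < θ.1 then F (θ.1, θ.2.1) else F (θ.1, θ.2.2))
      = A.indicator F (θ.1, θ.2.1) + Aᶜ.indicator F (θ.1, θ.2.2) := fun θ => by
    by_cases hs : s < θ.1 <;> simp [A, hs]
  simp_rw [e]
  have hm : Measurable fun θ : I × I × I => A.indicator F (θ.1, θ.2.1) :=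
    (hF.indicator hA).comp (by fun_prop)
  rw [lintegral_add_left hm,
    ← lintegral_map (hF.indicator hA) (g := fun θ : I × I × I => (θ.1, θ.2.1)) (by fun_prop),
    ← lintegral_map (hF.indicator hA.compl) (g := fun θ : I × I × I => (θ.1, θ.2.2))
      (by fun_prop), hτ.left, hτ.right, ← lintegral_add_left (hF.indicator hA)]
  exact lintegral_congr fun q => congrFun (Set.indicator_self_add_compl A F) q

/-- The value at `s` of the parallel recursion, as a function of the two cuts that matter and of
the two copies that are used. -/
noncomputable def onePoint (F : Ω → I → ℝ) (s : I) (q : (I × I) × (Ω × Ω)) : ℝ :=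
  (segLen q.1.1 s * q.1.2) ^ bexp * F q.2.1 (segPos q.1.1 s)
    + (segLen q.1.1 s * (1 - q.1.2)) ^ bexp * F q.2.2 (segPos q.1.1 s)

lemma measurable_onePoint {F : Ω → I → ℝ} (hF : Measurable (Function.uncurry F)) (s : I) :
    Measurable (onePoint F s) := by
  have m1 : Measurable fun q : (I × I) × (Ω × Ω) => segLen q.1.1 s :=
    (measurable_fix_segLen s).comp (by fun_prop)
  have m2 : Measurable fun q : (I × I) × (Ω × Ω) => segPos q.1.1 s :=
    (measurable_fix_segPos s).comp (by fun_prop)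
  have m3 : Measurable fun q : (I × I) × (Ω × Ω) => F q.2.1 (segPos q.1.1 s) :=
    hF.comp (f := fun q : (I × I) × (Ω × Ω) => (q.2.1, segPos q.1.1 s)) (by fun_prop)
  have m4 : Measurable fun q : (I × I) × (Ω × Ω) => F q.2.2 (segPos q.1.1 s) :=
    hF.comp (f := fun q : (I × I) × (Ω × Ω) => (q.2.2, segPos q.1.1 s)) (by fun_prop)
  exact (((m1.mul (by fun_prop)).pow_const _).mul m3).add
    (((m1.mul (by fun_prop)).pow_const _).mul m4)

lemma measurable_fix {F : Ω → I → ℝ} (hF : Measurable (Function.uncurry F)) {Ω' : Type*}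
    [MeasurableSpace Ω'] {a : Ω' → Ω} {b : Ω' → I} (ha : Measurable a) (hb : Measurable b) :
    Measurable fun q => F (a q) (b q) :=
  hF.comp (ha.prodMk hb)

lemma measurable_parOp {Ω' : Type*} [MeasurableSpace Ω'] {f : Ω' → Fin 4 → I → ℝ}
    (hf : ∀ i, Measurable fun q : Ω' × I => f q.1 i q.2) {x y z s : Ω' → I} (hx : Measurable x)
    (hy : Measurable y) (hz : Measurable z) (hs : Measurable s) :
    Measurable fun q => parOp (x q) (y q) (z q) (f q) (s q) := by
  have mL : Measurable fun q => relLeft (x q) (s q) := measurable_relLeft.comp (hx.prodMk hs)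
  have mR : Measurable fun q => relRight (x q) (s q) := measurable_relRight.comp (hx.prodMk hs)
  have m : ∀ i, ∀ b : Ω' → I, Measurable b → Measurable fun q => f q i (b q) :=
    fun i b hb => (hf i).comp (measurable_id.prodMk hb)
  unfold parOp
  refine Measurable.ite (measurableSet_lt hs hx) ?_ ?_
  · exact (((by fun_prop : Measurable _).pow_const _).mul (m 0 _ mL)).add
      (((by fun_prop : Measurable _).pow_const _).mul (m 1 _ mL))
  · exact (((by fun_prop : Measurable _).pow_const _).mul (m 2 _ mR)).add
      (((by fun_prop : Measurable _).pow_const _).mul (m 3 _ mR))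

/-- At a single point, only one of the two lower cuts matters, so that the law of the value of the
parallel recursion does not depend on the joint law of these two cuts. -/
lemma IsSplitLaw.map_parOp {τ : Measure (I × I × I)} [IsProbabilityMeasure τ] (hτ : IsSplitLaw τ)
    {F : Ω → I → ℝ} (hF : Measurable (Function.uncurry F)) (s : I) :
    (τ.prod (Measure.pi fun _ : Fin 4 => P)).map
        (fun q => parOp q.1.1 q.1.2.1 q.1.2.2 (fun i => F (q.2 i)) s)
      = ((volume : Measure (I × I)).prod (P.prod P)).map (onePoint F s) := by
  have hm : Measurable fun q : (I × I × I) × (Fin 4 → Ω) =>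
      parOp q.1.1 q.1.2.1 q.1.2.2 (fun i => F (q.2 i)) s :=
    measurable_parOp (f := fun (q : (I × I × I) × (Fin 4 → Ω)) i => F (q.2 i))
      (fun i => measurable_fix hF (by fun_prop) (by fun_prop)) (by fun_prop) (by fun_prop)
      (by fun_prop) (by fun_prop)
  ext A hA
  have ho := measurable_onePoint hF s hA
  rw [Measure.map_apply hm hA, Measure.map_apply (measurable_onePoint hF s) hA,
    Measure.prod_apply (hm hA), Measure.prod_apply ho,
    ← hτ.lintegral (measurable_measure_prodMk_left ho) s]
  refine lintegral_congr fun θ => ?_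
  split_ifs with hs
  · rw [← map_pi_pair (P := P) (show (0 : Fin 4) ≠ 1 by decide),
      Measure.map_apply (by fun_prop) (measurable_prodMk_left ho)]
    simp [Set.preimage, onePoint, parOp, hs, segLen, segPos]
  · rw [← map_pi_pair (P := P) (show (2 : Fin 4) ≠ 3 by decide),
      Measure.map_apply (by fun_prop) (measurable_prodMk_left ho)]
    simp [Set.preimage, onePoint, parOp, hs, segLen, segPos]

end Copies

/-! ### The quaternary tree -/

section Tree

variable {Θ : Type*} [MeasurableSpace Θ] {τ : Measure Θ} [IsProbabilityMeasure τ]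

/-- The family at the root and the four families of the subtrees glued to a family on the tree. -/
def joinTree (q : Θ × (Fin 4 → List (Fin 4) → Θ)) : List (Fin 4) → Θ
  | [] => q.1
  | i :: v => q.2 i v

lemma measurable_joinTree : Measurable (joinTree (Θ := Θ)) := by
  refine measurable_pi_lambda _ fun u => ?_
  cases u with
  | nil => exact measurable_fst
  | cons i v => exact (measurable_pi_apply v).comp ((measurable_pi_apply i).comp measurable_snd)

/-- Gluing independent families along an independent root gives the independent family on the whole
tree, as is checked on finite cylinders. -/
lemma map_joinTree : (τ.prod (Measure.pi fun _ : Fin 4 => Measure.infinitePi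
    fun _ : List (Fin 4) => τ)).map joinTree = Measure.infinitePi fun _ => τ := by
  classical
  refine Measure.eq_infinitePi _ fun s t ht => ?_
  have inj : ∀ i : Fin 4, Set.InjOn (List.cons i) (List.cons i ⁻¹' (s : Set (List (Fin 4)))) :=
    fun i a _ b _ hab => (List.cons.inj hab).2
  have e : joinTree ⁻¹' ((s : Set (List (Fin 4))).pi t)
      = (if [] ∈ s then t [] else Set.univ) ×ˢ (Set.univ.pi fun i =>
        ((s.preimage (List.cons i) (inj i) : Finset _) : Set (List (Fin 4))).pi
          fun v => t (i :: v)) := by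
    ext q
    simp only [Set.mem_preimage, Set.mem_pi, SetLike.mem_coe, Set.mem_prod, Set.mem_univ,
      true_imp_iff, Finset.mem_preimage]
    constructor
    · intro hq
      refine ⟨?_, fun i v hv => hq _ hv⟩
      split_ifs with hn
      exacts [hq _ hn, trivial]
    · rintro ⟨h0, h1⟩ u hu
      cases u with
      | nil => rwa [if_pos hu] at h0
      | cons i v => exact h1 i v hu
  rw [Measure.map_apply measurable_joinTree (MeasurableSet.pi s.countable_toSet fun _ _ => ht _),
    e, Measure.prod_prod, Measure.pi_pi]
  simp_rw [Measure.infinitePi_pi (fun _ : List (Fin 4) => τ) fun v _ => ht _]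
  rw [Finset.prod_sigma' Finset.univ (fun i => s.preimage (List.cons i) (inj i))
    (fun i v => τ (t (i :: v)))]
  have e2 : ∏ x ∈ Finset.univ.sigma fun i => s.preimage (List.cons i) (inj i),
      τ (t (x.1 :: x.2)) = ∏ u ∈ s.erase [], τ (t u) := by
    refine Finset.prod_nbij (fun x => x.1 :: x.2) ?_ ?_ ?_ fun _ _ => rfl
    · rintro ⟨i, v⟩ hx
      simpa using hx
    · rintro ⟨i, v⟩ _ ⟨j, v'⟩ _ hx
      obtain ⟨rfl, rfl⟩ := List.cons.inj hx
      rfl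
    · intro u hu
      cases u with
      | nil => simp at hu
      | cons i v => exact ⟨⟨i, v⟩, by simpa using hu, rfl⟩
  rw [e2]
  split_ifs with hn
  · exact Finset.mul_prod_erase s (fun u => τ (t u)) hn
  · rw [measure_univ, one_mul, Finset.erase_eq_of_notMem hn]

/-- The root variable and the four subtrees are independent, and each subtree is distributed as
the whole tree. -/
lemma measurePreserving_splitTree :
    MeasurePreserving (fun w : List (Fin 4) → Θ => (w [], fun (i : Fin 4) v => w (i :: v)))
      (Measure.infinitePi fun _ => τ)
      (τ.prod (Measure.pi fun _ : Fin 4 => Measure.infinitePi fun _ : List (Fin 4) => τ)) := by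
  have hm : Measurable fun w : List (Fin 4) → Θ => (w [], fun (i : Fin 4) v => w (i :: v)) := by
    fun_prop
  refine ⟨hm, ?_⟩
  conv_lhs => rw [← map_joinTree (τ := τ), Measure.map_map hm measurable_joinTree]
  exact Measure.map_id

end Tree

/-- Independent cuts with law `τ` attached to the nodes of the quaternary tree. -/
noncomputable abbrev treeMeasure (τ : Measure (I × I × I)) : Measure (List (Fin 4) → I × I × I) :=
  Measure.infinitePi fun _ => τ

/-- The iterates of the parallel recursion started from `h`, with independent lower cuts allowed
on the two sides of the root cut. -/
noncomputable def parApprox : ℕ → (List (Fin 4) → I × I × I) → I → ℝ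
  | 0, _ => h
  | n + 1, w =>
      parOp (w []).1 (w []).2.1 (w []).2.2 (fun i => parApprox n (fun v => w (i :: v)))

lemma holderVanish_parApprox (n : ℕ) (w : List (Fin 4) → I × I × I) :
    HolderVanish (4 ^ n) (parApprox n w) := by
  induction n generalizing w with
  | zero => simpa [parApprox] using holderVanish_h
  | succ n ih =>
    rw [pow_succ']
    exact HolderVanish.parOp (fun i => ih _) _ _ _

lemma measurable_parApprox (n : ℕ) : Measurable (Function.uncurry (parApprox n)) := by
  induction n with
  | zero => exact continuous_h.measurable.comp measurable_snd
  | succ n ih =>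
    refine measurable_parOp (f := fun (q : (List (Fin 4) → I × I × I) × I) i =>
      parApprox n fun v => q.1 (i :: v)) (fun i => ?_) ?_ ?_ ?_ measurable_snd
    · exact measurable_fix ih (by fun_prop) (by fun_prop)
    all_goals fun_prop

/-- The increments of the approximations. -/
noncomputable def parDiff (n : ℕ) (w : List (Fin 4) → I × I × I) (s : I) : ℝ :=
  parApprox (n + 1) w s - parApprox n w s

lemma parOp_sub (x y z : I) (f g : Fin 4 → I → ℝ) (s : I) :
    parOp x y z f s - parOp x y z g s = parOp x y z (fun i s => f i s - g i s) s := by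
  unfold parOp
  split_ifs <;> ring

lemma parDiff_succ (n : ℕ) (w : List (Fin 4) → I × I × I) (s : I) :
    parDiff (n + 1) w s = parOp (w []).1 (w []).2.1 (w []).2.2
      (fun i => parDiff n (fun v => w (i :: v))) s :=
  parOp_sub _ _ _ _ _ _

lemma holderVanish_parDiff (n : ℕ) (w : List (Fin 4) → I × I × I) :
    HolderVanish (5 * 4 ^ n) (parDiff n w) := by
  have := (holderVanish_parApprox (n + 1) w).sub (holderVanish_parApprox n w)
  rwa [pow_succ, show (4 : ℝ) ^ n * 4 + 4 ^ n = 5 * 4 ^ n by ring] at this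

lemma measurable_parDiff (n : ℕ) : Measurable (Function.uncurry (parDiff n)) :=
  (measurable_parApprox (n + 1)).sub (measurable_parApprox n)

section Moments

/-! ### One-point moments under the recursion -/

variable {Ω : Type*} [MeasurableSpace Ω] {P : Measure Ω} [IsProbabilityMeasure P]

lemma integral_prod_linear {X : Ω → ℝ} (hX : Integrable X P) (c c' : ℝ) :
    ∫ q : Ω × Ω, (c * X q.1 + c' * X q.2) ∂(P.prod P) = (c + c') * ∫ ω, X ω ∂P := by
  rw [integral_add ((hX.comp_fst P).const_mul c) ((hX.comp_snd P).const_mul c'),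
    integral_const_mul, integral_const_mul, integral_fun_fst X, integral_fun_snd X]
  simp; ring

lemma integral_prod_linear_sq {X : Ω → ℝ} (hX : MemLp X 2 P) (c c' : ℝ) :
    ∫ q : Ω × Ω, (c * X q.1 + c' * X q.2) ^ 2 ∂(P.prod P)
      = (c ^ 2 + c' ^ 2) * ∫ ω, X ω ^ 2 ∂P + 2 * c * c' * (∫ ω, X ω ∂P) ^ 2 := by
  have h1 := hX.integrable (by norm_num)
  have h2 := hX.integrable_sq
  have i1 : Integrable (fun q : Ω × Ω => c ^ 2 * X q.1 ^ 2) (P.prod P) :=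
    (h2.comp_fst P).const_mul _
  have i2 : Integrable (fun q : Ω × Ω => c' ^ 2 * X q.2 ^ 2) (P.prod P) :=
    (h2.comp_snd P).const_mul _
  have i3 : Integrable (fun q : Ω × Ω => 2 * c * c' * (X q.1 * X q.2)) (P.prod P) :=
    (h1.mul_prod h1).const_mul _
  have e : ∀ q : Ω × Ω, (c * X q.1 + c' * X q.2) ^ 2
      = c ^ 2 * X q.1 ^ 2 + c' ^ 2 * X q.2 ^ 2 + 2 * c * c' * (X q.1 * X q.2) := fun q => by ring
  simp_rw [e]
  have i12 : Integrable (fun q : Ω × Ω => c ^ 2 * X q.1 ^ 2 + c' ^ 2 * X q.2 ^ 2) (P.prod P) :=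
    i1.add i2
  rw [integral_add i12 i3, integral_add i1 i2, integral_const_mul, integral_const_mul,
    integral_const_mul, integral_fun_fst fun ω => X ω ^ 2, integral_fun_snd fun ω => X ω ^ 2,
    integral_prod_mul]
  simp; ring

/-- A binomial estimate separating the pure powers from the mixed terms. -/
lemma add_pow_succ_le {a b : ℝ} (ha : 0 ≤ a) (hb : 0 ≤ b) (p : ℕ) :
    (a + b) ^ (p + 1) ≤ a ^ (p + 1) + b ^ (p + 1) + 2 ^ (p + 1) * (a ^ p * b + a * b ^ p) := by
  have key : ∀ {a b : ℝ}, 0 ≤ a → a ≤ b → (a + b) ^ (p + 1)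
      ≤ b ^ (p + 1) + (2 ^ (p + 1) - 1) * (a * b ^ p) := by
    intro a b ha hab
    have hb := ha.trans hab
    induction p with
    | zero => norm_num; linarith
    | succ p ih =>
      have hp : 0 ≤ a * b ^ p := by positivity
      have m := mul_le_mul_of_nonneg_right ih (add_nonneg ha hb)
      have m2 : a * b ^ p * a ≤ a * b ^ p * b := mul_le_mul_of_nonneg_left hab hp
      have h2 : (1 : ℝ) ≤ 2 ^ (p + 1) := one_le_pow₀ one_le_two
      have m3 := mul_le_mul_of_nonneg_left m2 (sub_nonneg.2 h2)
      calc (a + b) ^ (p + 1 + 1) = (a + b) ^ (p + 1) * (a + b) := pow_succ _ _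
        _ ≤ _ := m
        _ = b ^ (p + 1 + 1) + 2 ^ (p + 1) * (a * b ^ (p + 1))
            + (2 ^ (p + 1) - 1) * (a * b ^ p * a) := by ring
        _ ≤ b ^ (p + 1 + 1) + 2 ^ (p + 1) * (a * b ^ (p + 1))
            + (2 ^ (p + 1) - 1) * (a * b ^ p * b) := by gcongr
        _ = _ := by ring
  have h1 : 0 ≤ a ^ p * b := by positivity
  have h2 : 0 ≤ a * b ^ p := by positivity
  have h3 : 0 ≤ a ^ (p + 1) := by positivity
  have h4 : 0 ≤ b ^ (p + 1) := by positivity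
  have h5 : (0 : ℝ) ≤ 2 ^ (p + 1) := by positivity
  rcases le_total a b with hab | hab
  · nlinarith [key ha hab, mul_nonneg h5 h1]
  · have := key hb hab
    rw [add_comm b a] at this
    nlinarith [mul_nonneg h5 h2]

/-- In the moment of order `p + 1` of a sum of two independent copies, the pure powers keep their
coefficients, while the mixed terms involve only moments of lower order. -/
lemma integral_prod_abs_pow_le {X : Ω → ℝ} {p : ℕ} (hX : ∀ k, Integrable (fun ω => |X ω| ^ k) P)
    {c c' : ℝ} (hc : 0 ≤ c) (hc1 : c ≤ 1) (hc' : 0 ≤ c') (hc1' : c' ≤ 1) :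
    ∫ q : Ω × Ω, (c * |X q.1| + c' * |X q.2|) ^ (p + 1) ∂(P.prod P)
      ≤ (c ^ (p + 1) + c' ^ (p + 1)) * ∫ ω, |X ω| ^ (p + 1) ∂P
        + 2 ^ (p + 2) * ((∫ ω, |X ω| ^ p ∂P) * ∫ ω, |X ω| ^ 1 ∂P) := by
  have j1 : Integrable (fun q : Ω × Ω => c ^ (p + 1) * |X q.1| ^ (p + 1)) (P.prod P) :=
    ((hX (p + 1)).comp_fst P).const_mul _
  have j2 : Integrable (fun q : Ω × Ω => c' ^ (p + 1) * |X q.2| ^ (p + 1)) (P.prod P) :=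
    ((hX (p + 1)).comp_snd P).const_mul _
  have j3 : Integrable (fun q : Ω × Ω => |X q.1| ^ p * |X q.2| ^ 1) (P.prod P) :=
    (hX p).mul_prod (hX 1)
  have j4 : Integrable (fun q : Ω × Ω => |X q.1| ^ 1 * |X q.2| ^ p) (P.prod P) :=
    (hX 1).mul_prod (hX p)
  have j12 : Integrable (fun q : Ω × Ω => c ^ (p + 1) * |X q.1| ^ (p + 1)
      + c' ^ (p + 1) * |X q.2| ^ (p + 1)) (P.prod P) := j1.add j2
  have j34 : Integrable (fun q : Ω × Ω => 2 ^ (p + 1) * (|X q.1| ^ p * |X q.2| ^ 1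
      + |X q.1| ^ 1 * |X q.2| ^ p)) (P.prod P) := (j3.add j4).const_mul _
  calc _ ≤ ∫ q : Ω × Ω, (c ^ (p + 1) * |X q.1| ^ (p + 1) + c' ^ (p + 1) * |X q.2| ^ (p + 1)
        + 2 ^ (p + 1) * (|X q.1| ^ p * |X q.2| ^ 1 + |X q.1| ^ 1 * |X q.2| ^ p)) ∂(P.prod P) := by
        refine integral_mono_of_nonneg (ae_of_all _ fun q => by positivity) (j12.add j34)
          (ae_of_all _ fun q => ?_)
        set a := |X q.1|
        set b := |X q.2|
        have ha : 0 ≤ a := abs_nonneg _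
        have hb : 0 ≤ b := abs_nonneg _
        refine (add_pow_succ_le (mul_nonneg hc ha) (mul_nonneg hc' hb) p).trans ?_
        simp only [mul_pow, pow_one]
        have k1 : c ^ p * a ^ p * (c' * b) ≤ a ^ p * b := by
          have : c ^ p * c' ≤ 1 := mul_le_one₀ (pow_le_one₀ hc hc1) hc' hc1'
          calc c ^ p * a ^ p * (c' * b) = c ^ p * c' * (a ^ p * b) := by ring
            _ ≤ _ := mul_le_of_le_one_left (by positivity) this
        have k2 : c * a * (c' ^ p * b ^ p) ≤ a * b ^ p := by
          have : c * c' ^ p ≤ 1 := mul_le_one₀ hc1 (by positivity) (pow_le_one₀ hc' hc1')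
          calc c * a * (c' ^ p * b ^ p) = c * c' ^ p * (a * b ^ p) := by ring
            _ ≤ _ := mul_le_of_le_one_left (by positivity) this
        gcongr
    _ = _ := by
        rw [integral_add j12 j34, integral_add j1 j2, integral_const_mul, integral_const_mul,
          integral_const_mul, integral_add j3 j4,
          integral_fun_fst (fun ω => |X ω| ^ (p + 1)), integral_fun_snd fun ω => |X ω| ^ (p + 1),
          integral_prod_mul (fun ω => |X ω| ^ p) fun ω => |X ω| ^ 1,
          integral_prod_mul (fun ω => |X ω| ^ 1) fun ω => |X ω| ^ p]
        simp; ring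

variable {F : Ω → I → ℝ} {K : ℝ}

lemma mul_rpow_bexp_nonneg (u s y : I) : 0 ≤ (segLen u s * y) ^ bexp :=
  Real.rpow_nonneg (mul_nonneg (segLen_nonneg _ _) y.2.1) _

lemma mul_rpow_bexp_le_one (u s y : I) : (segLen u s * y) ^ bexp ≤ 1 :=
  Real.rpow_le_one (mul_nonneg (segLen_nonneg _ _) y.2.1)
    (mul_le_one₀ (segLen_le_one _ _) y.2.1 y.2.2) bexp_pos.le

lemma mul_one_sub_rpow_bexp_nonneg (u s y : I) : 0 ≤ (segLen u s * (1 - y)) ^ bexp :=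
  mul_rpow_bexp_nonneg u s (unitInterval.symm y)

lemma mul_one_sub_rpow_bexp_le_one (u s y : I) : (segLen u s * (1 - y)) ^ bexp ≤ 1 :=
  mul_rpow_bexp_le_one u s (unitInterval.symm y)

lemma abs_onePoint_le {Ω : Type*} {F : Ω → I → ℝ} {K : ℝ} (hb : ∀ ω s, |F ω s| ≤ K) (s : I)
    (q : (I × I) × (Ω × Ω)) :
    |onePoint F s q| ≤ 2 * K := by
  have h0 := mul_rpow_bexp_nonneg q.1.1 s q.1.2
  have h1 := mul_one_sub_rpow_bexp_nonneg q.1.1 s q.1.2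
  unfold onePoint
  refine (abs_add_le _ _).trans ?_
  rw [abs_mul, abs_mul, abs_of_nonneg h0, abs_of_nonneg h1]
  have a0 := mul_le_of_le_one_left (abs_nonneg (F q.2.1 (segPos q.1.1 s)))
    (mul_rpow_bexp_le_one q.1.1 s q.1.2)
  have a1 := mul_le_of_le_one_left (abs_nonneg (F q.2.2 (segPos q.1.1 s)))
    (mul_one_sub_rpow_bexp_le_one q.1.1 s q.1.2)
  linarith [hb q.2.1 (segPos q.1.1 s), hb q.2.2 (segPos q.1.1 s)]

lemma measurable_slice (hF : Measurable (Function.uncurry F)) (s : I) :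
    Measurable fun ω => F ω s := measurable_fix hF measurable_id measurable_const

lemma memLp_slice (hF : Measurable (Function.uncurry F)) (hb : ∀ ω s, |F ω s| ≤ K) (s : I)
    (p : ℝ≥0∞) : MemLp (fun ω => F ω s) p P :=
  MemLp.of_bound (measurable_slice hF s).aestronglyMeasurable K (ae_of_all _ fun ω => hb ω s)

lemma integrable_slice (hF : Measurable (Function.uncurry F)) (hb : ∀ ω s, |F ω s| ≤ K) (s : I) :
    Integrable (fun ω => F ω s) P :=
  integrable_of_bound (measurable_slice hF s) K fun ω => hb ω s

lemma integrable_slice_abs_pow (hF : Measurable (Function.uncurry F)) (hb : ∀ ω s, |F ω s| ≤ K)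
    (s : I) (k : ℕ) : Integrable (fun ω => |F ω s| ^ k) P :=
  integrable_of_bound ((measurable_slice hF s).abs.pow_const k) (K ^ k) fun ω => by
    rw [abs_pow, abs_abs]; exact pow_le_pow_left₀ (abs_nonneg _) (hb ω s) k

lemma integrable_rpow_unitInterval {c : ℝ} (hc : 0 ≤ c) :
    Integrable fun y : I => (y : ℝ) ^ c :=
  integrable_of_bound (by fun_prop) 1 fun x => abs_rpow_le_one x.2.1 x.2.2 hc

lemma integrable_one_sub_rpow_unitInterval {c : ℝ} (hc : 0 ≤ c) :
    Integrable fun y : I => (1 - y : ℝ) ^ c :=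
  integrable_of_bound (by fun_prop) 1 fun x =>
    abs_rpow_le_one (by linarith [x.2.2]) (by linarith [x.2.1]) hc

lemma integral_onePoint (hF : Measurable (Function.uncurry F)) (hb : ∀ ω s, |F ω s| ≤ K) (s : I) :
    ∫ q, onePoint F s q ∂((volume : Measure (I × I)).prod (P.prod P))
      = ∫ x : I, segLen x s ^ bexp * (2 / (bexp + 1) * ∫ ω, F ω (segPos x s) ∂P) := by
  have hi : Integrable (onePoint F s) ((volume : Measure (I × I)).prod (P.prod P)) :=
    integrable_of_bound (measurable_onePoint hF s) _ (abs_onePoint_le hb s)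
  have hi2 := hi.integral_prod_left
  rw [integral_prod _ hi]
  rw [Measure.volume_eq_prod] at hi2 ⊢
  rw [integral_prod _ hi2]
  refine integral_congr_ae (ae_of_all _ fun x => ?_)
  simp only [onePoint]
  simp_rw [integral_prod_linear (integrable_slice hF hb (segPos x s)),
    Real.mul_rpow (segLen_nonneg x s) (Subtype.prop _ : _ ∈ I).1,
    fun y : I => Real.mul_rpow (z := bexp) (segLen_nonneg x s)
      (show 0 ≤ 1 - (y : ℝ) by linarith [y.2.2]), ← mul_add]
  rw [integral_mul_const, integral_const_mul, integral_add
    (integrable_rpow_unitInterval bexp_pos.le) (integrable_one_sub_rpow_unitInterval bexp_pos.le),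
    integral_rpow_unitInterval bexp_pos.le, integral_one_sub_rpow_unitInterval bexp_pos.le]
  ring

lemma sq_rpow_bexp {a : ℝ} (ha : 0 ≤ a) : (a ^ bexp) ^ 2 = a ^ (2 * bexp) := by
  rw [← Real.rpow_natCast, ← Real.rpow_mul ha, mul_comm]; norm_num

/-- The second moment of the recursion: a contracting term, and a term from the product of the
means of the two subprocesses on the side of `s`. -/
lemma integral_onePoint_sq (hF : Measurable (Function.uncurry F)) (hb : ∀ ω s, |F ω s| ≤ K)
    (s : I) :
    ∫ q, onePoint F s q ^ 2 ∂((volume : Measure (I × I)).prod (P.prod P))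
      = ∫ x : I, segLen x s ^ (2 * bexp) * (2 / (2 * bexp + 1) * ∫ ω, F ω (segPos x s) ^ 2 ∂P
          + 2 * beta (bexp + 1) (bexp + 1) * (∫ ω, F ω (segPos x s) ∂P) ^ 2) := by
  have h2b : 0 ≤ 2 * bexp := by linarith [bexp_pos]
  have hi : Integrable (fun q => onePoint F s q ^ 2)
      ((volume : Measure (I × I)).prod (P.prod P)) :=
    integrable_of_bound ((measurable_onePoint hF s).pow_const 2) ((2 * K) ^ 2) fun q => by
      rw [abs_pow]; exact pow_le_pow_left₀ (abs_nonneg _) (abs_onePoint_le hb s q) 2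
  have hi2 := hi.integral_prod_left
  rw [integral_prod _ hi]
  rw [Measure.volume_eq_prod] at hi2 ⊢
  rw [integral_prod _ hi2]
  refine integral_congr_ae (ae_of_all _ fun x => ?_)
  have hL := segLen_nonneg x s
  simp only [onePoint]
  simp_rw [integral_prod_linear_sq (memLp_slice hF hb (segPos x s) 2),
    Real.mul_rpow hL (Subtype.prop _ : _ ∈ I).1,
    fun y : I => Real.mul_rpow (z := bexp) hL (show 0 ≤ 1 - (y : ℝ) by linarith [y.2.2])]
  set m1 := ∫ ω, F ω (segPos x s) ∂P
  set m2 := ∫ ω, F ω (segPos x s) ^ 2 ∂P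
  have e : ∀ y : I, ((segLen x s ^ bexp * (y : ℝ) ^ bexp) ^ 2
      + (segLen x s ^ bexp * (1 - y : ℝ) ^ bexp) ^ 2) * m2
      + 2 * (segLen x s ^ bexp * (y : ℝ) ^ bexp) * (segLen x s ^ bexp * (1 - y : ℝ) ^ bexp) * m1 ^ 2
      = (y : ℝ) ^ (2 * bexp) * (segLen x s ^ (2 * bexp) * m2)
        + (1 - y : ℝ) ^ (2 * bexp) * (segLen x s ^ (2 * bexp) * m2)
        + (y : ℝ) ^ bexp * (1 - y : ℝ) ^ bexp * (2 * segLen x s ^ (2 * bexp) * m1 ^ 2) := fun y => by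
    rw [← sq_rpow_bexp hL, ← sq_rpow_bexp y.2.1,
      ← sq_rpow_bexp (show 0 ≤ 1 - (y : ℝ) by linarith [y.2.2])]
    ring
  simp_rw [e]
  have i1 : Integrable fun y : I => (y : ℝ) ^ (2 * bexp) * (segLen x s ^ (2 * bexp) * m2) :=
    (integrable_rpow_unitInterval h2b).mul_const _
  have i2 : Integrable fun y : I => (1 - y : ℝ) ^ (2 * bexp) * (segLen x s ^ (2 * bexp) * m2) :=
    (integrable_one_sub_rpow_unitInterval h2b).mul_const _
  have i12 : Integrable fun y : I => (y : ℝ) ^ (2 * bexp) * (segLen x s ^ (2 * bexp) * m2)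
      + (1 - y : ℝ) ^ (2 * bexp) * (segLen x s ^ (2 * bexp) * m2) := i1.add i2
  have i3 : Integrable fun y : I => (y : ℝ) ^ bexp * (1 - y : ℝ) ^ bexp
      * (2 * segLen x s ^ (2 * bexp) * m1 ^ 2) := by
    refine Integrable.mul_const (integrable_of_bound (by fun_prop) 1 fun y => ?_) _
    rw [abs_mul]
    exact mul_le_one₀ (abs_rpow_le_one y.2.1 y.2.2 bexp_pos.le) (abs_nonneg _)
      (abs_rpow_le_one (by linarith [y.2.2]) (by linarith [y.2.1]) bexp_pos.le)
  rw [integral_add i12 i3, integral_add i1 i2, integral_mul_const, integral_mul_const,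
    integral_mul_const, integral_rpow_unitInterval h2b, integral_one_sub_rpow_unitInterval h2b,
    integral_rpow_mul_one_sub_rpow]
  ring

/-- One step of the recursion multiplies the moment of order `p + 1` by at most
`4 / ((p + 1) β + 1) ^ 2`, up to products of moments of lower order. -/
lemma integral_abs_onePoint_pow_le (hF : Measurable (Function.uncurry F))
    (hb : ∀ ω s, |F ω s| ≤ K) {p : ℕ} {M M' M1 : ℝ} (hM : ∀ s, ∫ ω, |F ω s| ^ (p + 1) ∂P ≤ M)
    (hM' : ∀ s, ∫ ω, |F ω s| ^ p ∂P ≤ M') (hM1 : ∀ s, ∫ ω, |F ω s| ^ 1 ∂P ≤ M1) (s : I) :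
    ∫ q, |onePoint F s q| ^ (p + 1) ∂((volume : Measure (I × I)).prod (P.prod P))
      ≤ 4 / ((p + 1 : ℕ) * bexp + 1) ^ 2 * M + 2 ^ (p + 2) * (M' * M1) := by
  set c : ℝ := (p + 1 : ℕ) * bexp with hc_def
  have hc : 0 ≤ c := by have := bexp_pos; positivity
  have hM0 : 0 ≤ M := (integral_nonneg fun ω => by positivity).trans (hM 0)
  have hM0' : 0 ≤ M' := (integral_nonneg fun ω => by positivity).trans (hM' 0)
  have hi : Integrable (fun q => |onePoint F s q| ^ (p + 1))
      ((volume : Measure (I × I)).prod (P.prod P)) :=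
    integrable_of_bound ((measurable_onePoint hF s).abs.pow_const _) ((2 * K) ^ (p + 1))
      fun q => by
        rw [abs_pow, abs_abs]; exact pow_le_pow_left₀ (abs_nonneg _) (abs_onePoint_le hb s q) _
  have epow : ∀ {a : ℝ}, 0 ≤ a → (a ^ bexp) ^ (p + 1) = a ^ c := fun ha => by
    rw [← Real.rpow_natCast, ← Real.rpow_mul ha, mul_comm]
  have iL : Integrable fun x : I => segLen x s ^ c :=
    integrable_of_bound ((measurable_fix_segLen s).pow_const c) 1
      fun x => abs_rpow_le_one (segLen_nonneg _ _) (segLen_le_one _ _) hc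
  have iy : Integrable fun y : I => (y : ℝ) ^ c + (1 - y : ℝ) ^ c :=
    (integrable_rpow_unitInterval hc).add (integrable_one_sub_rpow_unitInterval hc)
  have iLy : Integrable (fun q : I × I => segLen q.1 s ^ c
      * ((q.2 : ℝ) ^ c + (1 - q.2 : ℝ) ^ c)) (volume : Measure (I × I)) := iL.mul_prod iy
  rw [integral_prod _ hi]
  calc _ ≤ ∫ q : I × I, (segLen q.1 s ^ c * ((q.2 : ℝ) ^ c + (1 - q.2 : ℝ) ^ c) * M
        + 2 ^ (p + 2) * (M' * M1)) := by
        refine integral_mono_of_nonneg (ae_of_all _ fun q => integral_nonneg fun _ => by positivity)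
          ((iLy.mul_const M).add (integrable_const _)) (ae_of_all _ fun q => ?_)
        have h0 := mul_rpow_bexp_nonneg q.1 s q.2
        have h1 := mul_one_sub_rpow_bexp_nonneg q.1 s q.2
        have hL := segLen_nonneg q.1 s
        have hy : 0 ≤ 1 - (q.2 : ℝ) := by linarith [q.2.2.2]
        have b1 : ∫ p' : Ω × Ω, |onePoint F s (q, p')| ^ (p + 1) ∂(P.prod P)
            ≤ ∫ p' : Ω × Ω, ((segLen q.1 s * q.2) ^ bexp * |F p'.1 (segPos q.1 s)|
              + (segLen q.1 s * (1 - q.2)) ^ bexp * |F p'.2 (segPos q.1 s)|) ^ (p + 1)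
                ∂(P.prod P) := by
          refine integral_mono_of_nonneg (ae_of_all _ fun _ => by positivity) ?_
            (ae_of_all _ fun p' => ?_)
          · refine integrable_of_bound ?_ ((2 * K) ^ (p + 1)) fun p' => ?_
            · have a1 : Measurable fun p' : Ω × Ω => F p'.1 (segPos q.1 s) :=
                measurable_fix hF measurable_fst measurable_const
              have a2 : Measurable fun p' : Ω × Ω => F p'.2 (segPos q.1 s) :=
                measurable_fix hF measurable_snd measurable_const
              exact ((a1.abs.const_mul _).add (a2.abs.const_mul _)).pow_const _
            · have := abs_onePoint_le (F := fun ω s => |F ω s|) (K := K)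
                (fun ω s => by rw [abs_abs]; exact hb ω s) s (q, p')
              rw [abs_pow]
              exact pow_le_pow_left₀ (abs_nonneg _) this _
          · refine pow_le_pow_left₀ (abs_nonneg _) ?_ _
            refine (abs_add_le _ _).trans ?_
            rw [abs_mul, abs_mul, abs_of_nonneg h0, abs_of_nonneg h1]
        refine b1.trans ((integral_prod_abs_pow_le
          (integrable_slice_abs_pow hF hb (segPos q.1 s)) h0 (mul_rpow_bexp_le_one _ _ _) h1
          (mul_one_sub_rpow_bexp_le_one _ _ _)).trans ?_)
        have e : ((segLen q.1 s * q.2) ^ bexp) ^ (p + 1)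
            + ((segLen q.1 s * (1 - q.2)) ^ bexp) ^ (p + 1)
            = segLen q.1 s ^ c * ((q.2 : ℝ) ^ c + (1 - q.2 : ℝ) ^ c) := by
          rw [epow (mul_nonneg hL q.2.2.1), epow (mul_nonneg hL hy), Real.mul_rpow hL q.2.2.1,
            Real.mul_rpow hL hy, mul_add]
        rw [e]
        have n1 : 0 ≤ segLen q.1 s ^ c * ((q.2 : ℝ) ^ c + (1 - q.2 : ℝ) ^ c) :=
          mul_nonneg (Real.rpow_nonneg hL _)
            (add_nonneg (Real.rpow_nonneg q.2.2.1 _) (Real.rpow_nonneg hy _))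
        exact add_le_add (mul_le_mul_of_nonneg_left (hM _) n1) (mul_le_mul_of_nonneg_left
          (mul_le_mul (hM' _) (hM1 _) (integral_nonneg fun _ => by positivity) hM0')
          (by positivity))
    _ = (∫ x : I, segLen x s ^ c) * (2 / (c + 1)) * M + 2 ^ (p + 2) * (M' * M1) := by
        rw [integral_add (iLy.mul_const M) (integrable_const _), integral_mul_const,
          Measure.volume_eq_prod, integral_prod_mul (fun x : I => segLen x s ^ c)
            fun y : I => (y : ℝ) ^ c + (1 - y : ℝ) ^ c,
          integral_add (integrable_rpow_unitInterval hc) (integrable_one_sub_rpow_unitInterval hc),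
          integral_rpow_unitInterval hc, integral_one_sub_rpow_unitInterval hc]
        simp only [integral_const, probReal_univ, one_smul]
        ring
    _ ≤ _ := by
        have l := integral_segLen_rpow_le s hc
        have c1 : 0 ≤ 2 / (c + 1) := by positivity
        have := mul_le_mul_of_nonneg_right (mul_le_mul_of_nonneg_right l c1) hM0
        rw [show 4 / (c + 1) ^ 2 = 2 / (c + 1) * (2 / (c + 1)) by
          rw [div_mul_div_comm]; norm_num; rw [sq]]
        linarith

end Moments

/-! ### Moments of the approximations -/

section TreeMoments

variable {τ : Measure (I × I × I)} [IsProbabilityMeasure τ]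

lemma IsSplitLaw.map_tree (hτ : IsSplitLaw τ) {F G : (List (Fin 4) → I × I × I) → I → ℝ}
    (hF : Measurable (Function.uncurry F))
    (hG : ∀ w s, G w s = parOp (w []).1 (w []).2.1 (w []).2.2
      (fun i => F (fun v => w (i :: v))) s) (s : I) :
    (treeMeasure τ).map (fun w => G w s)
      = ((volume : Measure (I × I)).prod ((treeMeasure τ).prod (treeMeasure τ))).map
          (onePoint F s) := by
  rw [← hτ.map_parOp hF s, ← (measurePreserving_splitTree (τ := τ)).map_eq,
    Measure.map_map _ (measurePreserving_splitTree (τ := τ)).measurable]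
  · congr 1
    funext w
    exact hG w s
  · exact measurable_parOp
      (f := fun (q : (I × I × I) × (Fin 4 → List (Fin 4) → I × I × I)) i => F (q.2 i))
      (fun i => measurable_fix hF (by fun_prop) (by fun_prop)) (by fun_prop) (by fun_prop)
      (by fun_prop) (by fun_prop)

lemma IsSplitLaw.integral_tree (hτ : IsSplitLaw τ) {F G : (List (Fin 4) → I × I × I) → I → ℝ}
    (hF : Measurable (Function.uncurry F)) (hG' : Measurable (Function.uncurry G))
    (hG : ∀ w s, G w s = parOp (w []).1 (w []).2.1 (w []).2.2
      (fun i => F (fun v => w (i :: v))) s) (s : I) {E : Type*} [NormedAddCommGroup E]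
    [NormedSpace ℝ E] {φ : ℝ → E} (hφ : StronglyMeasurable φ) :
    ∫ w, φ (G w s) ∂(treeMeasure τ)
      = ∫ q, φ (onePoint F s q)
          ∂((volume : Measure (I × I)).prod ((treeMeasure τ).prod (treeMeasure τ))) := by
  rw [← integral_map (measurable_slice hG' s).aemeasurable hφ.aestronglyMeasurable,
    ← integral_map (measurable_onePoint hF s).aemeasurable hφ.aestronglyMeasurable,
    hτ.map_tree hF hG]

lemma abs_parApprox_le (n : ℕ) (w : List (Fin 4) → I × I × I) (s : I) :
    |parApprox n w s| ≤ 4 ^ n := (holderVanish_parApprox n w).abs_le s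

lemma abs_parDiff_le (n : ℕ) (w : List (Fin 4) → I × I × I) (s : I) :
    |parDiff n w s| ≤ 5 * 4 ^ n := (holderVanish_parDiff n w).abs_le s

/-- The function `h` is the fixed point of the mean of the recursion, by the choice of `β`. -/
lemma integral_parApprox (hτ : IsSplitLaw τ) (n : ℕ) (s : I) :
    ∫ w, parApprox n w s ∂(treeMeasure τ) = h s := by
  induction n generalizing s with
  | zero => simp [parApprox]
  | succ n ih =>
    rw [hτ.integral_tree (measurable_parApprox n) (measurable_parApprox (n + 1))
      (fun w s => rfl) s (φ := fun x => x) stronglyMeasurable_id,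
      integral_onePoint (measurable_parApprox n) (abs_parApprox_le n)]
    simp_rw [ih, mul_left_comm _ (2 / (bexp + 1))]
    rw [integral_const_mul, integral_segLen_mul_h]
    have := bexp_quadratic
    have := bexp_pos
    field_simp
    linear_combination (-h s) * bexp_quadratic

/-- The ratio of the second moment of the `n`-th approximation to `h ^ 2`. -/
noncomputable def sqRatio : ℕ → ℝ
  | 0 => 1
  | n + 1 => (2 / (2 * bexp + 1) * sqRatio n + 2 * beta (bexp + 1) (bexp + 1)) / (bexp + 1)

lemma integral_parApprox_sq (hτ : IsSplitLaw τ) (n : ℕ) (s : I) :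
    ∫ w, parApprox n w s ^ 2 ∂(treeMeasure τ) = sqRatio n * h s ^ 2 := by
  induction n generalizing s with
  | zero => simp [parApprox, sqRatio]
  | succ n ih =>
    rw [hτ.integral_tree (measurable_parApprox n) (measurable_parApprox (n + 1))
      (fun w s => rfl) s (φ := fun x => x ^ 2) (by fun_prop),
      integral_onePoint_sq (measurable_parApprox n) (abs_parApprox_le n)]
    simp_rw [ih, integral_parApprox hτ]
    have e : ∀ x : I, segLen x s ^ (2 * bexp) * (2 / (2 * bexp + 1) * (sqRatio n
        * h (segPos x s) ^ 2) + 2 * beta (bexp + 1) (bexp + 1) * h (segPos x s) ^ 2)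
        = (2 / (2 * bexp + 1) * sqRatio n + 2 * beta (bexp + 1) (bexp + 1))
          * (segLen x s ^ (2 * bexp) * h (segPos x s) ^ 2) := fun x => by ring
    simp_rw [e]
    rw [integral_const_mul, integral_segLen_mul_h_sq, sqRatio]
    ring

/-- The affine recursion of the ratios is contracting and has fixed point `c₂`. -/
lemma tendsto_sqRatio : Tendsto sqRatio atTop (𝓝 c2) := by
  have hb := bexp_pos
  have hb1 := bexp_lt_one
  have hq := bexp_quadratic
  set r : ℝ := 2 / ((2 * bexp + 1) * (bexp + 1)) with hr
  have fix : c2 = (2 / (2 * bexp + 1) * c2 + 2 * beta (bexp + 1) (bexp + 1)) / (bexp + 1) := by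
    have h1 : 1 - bexp ≠ 0 := by linarith
    -- reduce modulo the quadratic equation satisfied by `β`
    have h2 : bexp ^ 2 = 2 - 3 * bexp := by linarith
    rw [c2]
    field_simp
    ring_nf
    simp only [h2]
    ring
  have e : ∀ n, sqRatio n = c2 + r ^ n * (1 - c2) := by
    intro n
    induction n with
    | zero => simp [sqRatio]
    | succ n ih =>
      have : 2 / (2 * bexp + 1) / (bexp + 1) = r := div_div _ _ _
      rw [sqRatio, ih, pow_succ]
      linear_combination (r ^ n * (1 - c2)) * this - fix
  have hr1 : r < 1 := by
    rw [hr, div_lt_one (by positivity)]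
    nlinarith [half_lt_bexp]
  have := (tendsto_pow_atTop_nhds_zero_of_lt_one (by positivity) hr1).mul_const (1 - c2)
  simp_rw [funext e]
  simpa using this.const_add c2

lemma integral_parDiff (hτ : IsSplitLaw τ) (n : ℕ) (s : I) :
    ∫ w, parDiff n w s ∂(treeMeasure τ) = 0 := by
  unfold parDiff
  rw [integral_sub (integrable_slice (measurable_parApprox _) (abs_parApprox_le _) s)
    (integrable_slice (measurable_parApprox _) (abs_parApprox_le _) s), integral_parApprox hτ,
    integral_parApprox hτ, sub_self]

/-- Geometric decay, uniformly over the points of `[0, 1]`, of the absolute moments of order `p`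
of the increments. -/
def MomentDecay (τ : Measure (I × I × I)) (p : ℕ) (r : ℝ) : Prop :=
  ∃ C, 0 ≤ C ∧ ∀ n s, ∫ w, |parDiff n w s| ^ p ∂(treeMeasure τ) ≤ C * r ^ n

/-- The contraction factor of the moment of order `p`. -/
noncomputable def momentRate (p : ℕ) : ℝ := 4 / (p * bexp + 1) ^ 2

lemma momentRate_pos (p : ℕ) : 0 < momentRate p := by
  have := bexp_pos
  unfold momentRate; positivity

lemma momentRate_anti {p p' : ℕ} (hp : p ≤ p') : momentRate p' ≤ momentRate p := by
  have := bexp_pos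
  unfold momentRate; gcongr

lemma momentRate_two_lt_one : momentRate 2 < 1 := by
  have := half_lt_bexp
  unfold momentRate
  rw [div_lt_one (by positivity)]
  push_cast
  nlinarith

/-- In mean square the increments contract because they are centred: independent copies are
orthogonal. -/
lemma momentDecay_two (hτ : IsSplitLaw τ) : MomentDecay τ 2 (momentRate 2) := by
  refine ⟨25, by norm_num, fun n => ?_⟩
  have h2b : 0 ≤ 2 * bexp := by linarith [bexp_pos]
  induction n with
  | zero =>
    intro s
    refine (integral_mono (integrable_slice_abs_pow (measurable_parDiff 0) (abs_parDiff_le 0) s 2)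
      (integrable_const 25) fun w => ?_).trans (by simp)
    have := pow_le_pow_left₀ (abs_nonneg _) (abs_parDiff_le 0 w s) 2
    norm_num at this ⊢
    linarith
  | succ n ih =>
    intro s
    simp only [sq_abs] at ih ⊢
    rw [hτ.integral_tree (measurable_parDiff n) (measurable_parDiff (n + 1))
      (parDiff_succ n) s (φ := fun x => x ^ 2) (by fun_prop),
      integral_onePoint_sq (measurable_parDiff n) (abs_parDiff_le n)]
    simp_rw [integral_parDiff hτ]
    have hc : 0 ≤ 25 * momentRate 2 ^ n := by have := (momentRate_pos 2).le; positivity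
    have hk : 0 ≤ 2 / (2 * bexp + 1) := by positivity
    calc _ ≤ ∫ x : I, segLen x s ^ (2 * bexp)
          * (2 / (2 * bexp + 1) * (25 * momentRate 2 ^ n)) := by
          refine integral_mono_of_nonneg (ae_of_all _ fun x => ?_) ?_ (ae_of_all _ fun x => ?_)
          · have := Real.rpow_nonneg (segLen_nonneg x s) (2 * bexp)
            have : 0 ≤ ∫ w, parDiff n w (segPos x s) ^ 2 ∂(treeMeasure τ) :=
              integral_nonneg fun _ => sq_nonneg _
            have hB := (beta_pos (by linarith : 0 < bexp + 1) (by linarith : 0 < bexp + 1)).le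
            exact mul_nonneg ‹_› (add_nonneg (mul_nonneg hk this) (by positivity))
          · exact (integrable_of_bound ((measurable_fix_segLen s).pow_const _) 1 fun x =>
              abs_rpow_le_one (segLen_nonneg _ _) (segLen_le_one _ _) h2b).mul_const _
          · refine mul_le_mul_of_nonneg_left ?_ (Real.rpow_nonneg (segLen_nonneg x s) _)
            simpa using mul_le_mul_of_nonneg_left (ih (segPos x s)) hk
      _ ≤ 2 / (2 * bexp + 1) * (2 / (2 * bexp + 1) * (25 * momentRate 2 ^ n)) := by
          rw [integral_mul_const]
          exact mul_le_mul_of_nonneg_right (integral_segLen_rpow_le s h2b) (by positivity)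
      _ = 25 * momentRate 2 ^ (n + 1) := by
          have : momentRate 2 = 2 / (2 * bexp + 1) * (2 / (2 * bexp + 1)) := by
            rw [momentRate, div_mul_div_comm, sq]
            norm_num
          linear_combination (-(25 * momentRate 2 ^ n)) * this

/-- By the Cauchy–Schwarz inequality, from the second moment. -/
lemma momentDecay_one (hτ : IsSplitLaw τ) : MomentDecay τ 1 (Real.sqrt (momentRate 2)) := by
  obtain ⟨C, hC, hd⟩ := momentDecay_two hτ
  refine ⟨Real.sqrt C, Real.sqrt_nonneg _, fun n s => ?_⟩
  have hb := abs_parDiff_le n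
  have hv := variance_nonneg (fun w => |parDiff n w s|) (treeMeasure τ)
  rw [variance_eq_sub (memLp_slice (F := fun w s => |parDiff n w s|) (measurable_parDiff n).abs
    (K := 5 * 4 ^ n) (fun w s => by rw [abs_abs]; exact hb w s) s 2)] at hv
  simp only [Pi.pow_apply] at hv
  have : Real.sqrt C * Real.sqrt (momentRate 2) ^ n = Real.sqrt (C * momentRate 2 ^ n) := by
    rw [Real.sqrt_mul hC]
    congr 1
    exact (Real.sqrt_eq_iff_mul_self_eq (pow_nonneg (momentRate_pos 2).le _)
      (pow_nonneg (Real.sqrt_nonneg _) _)).2 (by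
        rw [← mul_pow, Real.mul_self_sqrt (momentRate_pos 2).le]) |>.symm
  rw [this]
  simp only [pow_one]
  exact Real.le_sqrt_of_sq_le (by linarith [hd n s])

/-- The decay of the moment of order `p` gives that of order `p + 1`, at any rate above both the
contraction factor of the pure powers and the rate of the mixed terms. -/
lemma MomentDecay.succ (hτ : IsSplitLaw τ) {p : ℕ} {r r' : ℝ} (hr : 0 ≤ r)
    (hp : MomentDecay τ p r) (h1 : momentRate (p + 1) < r')
    (h2 : r * Real.sqrt (momentRate 2) ≤ r') : MomentDecay τ (p + 1) r' := by
  obtain ⟨C, hC, hd⟩ := hp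
  obtain ⟨C1, hC1, hd1⟩ := momentDecay_one hτ
  have hr' : 0 < r' := (momentRate_pos _).trans h1
  set C2 := 2 ^ (p + 2) * (C * C1)
  -- `M` covers the initial step and absorbs the mixed terms into the gap below `r'`
  set M := max (5 ^ (p + 1)) (C2 / (r' - momentRate (p + 1)))
  have hM : 0 ≤ M := le_max_of_le_left (by positivity)
  refine ⟨M, hM, fun n => ?_⟩
  induction n with
  | zero =>
    intro s
    refine (integral_mono (integrable_slice_abs_pow (measurable_parDiff 0) (abs_parDiff_le 0) s
      (p + 1)) (integrable_const (5 ^ (p + 1))) fun w => ?_).trans ?_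
    · have := pow_le_pow_left₀ (abs_nonneg _) (abs_parDiff_le 0 w s) (p + 1)
      simpa using this
    · simp [M]
  | succ n ih =>
    intro s
    rw [hτ.integral_tree (measurable_parDiff n) (measurable_parDiff (n + 1))
      (parDiff_succ n) s (φ := fun x => |x| ^ (p + 1)) (by fun_prop)]
    refine (integral_abs_onePoint_pow_le (measurable_parDiff n) (abs_parDiff_le n) ih (hd n)
      (hd1 n) s).trans ?_
    have k1 : C2 ≤ M * (r' - momentRate (p + 1)) := by
      rw [← div_le_iff₀ (by linarith)]
      exact le_max_right _ _
    have k2 : (r * Real.sqrt (momentRate 2)) ^ n ≤ r' ^ n :=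
      pow_le_pow_left₀ (mul_nonneg hr (Real.sqrt_nonneg _)) h2 n
    calc _ = momentRate (p + 1) * (M * r' ^ n)
          + C2 * (r * Real.sqrt (momentRate 2)) ^ n := by
          rw [show momentRate (p + 1) = 4 / ((p + 1 : ℕ) * bexp + 1) ^ 2 from rfl,
            show C2 = 2 ^ (p + 2) * (C * C1) from rfl, mul_pow]
          ring
      _ ≤ momentRate (p + 1) * (M * r' ^ n) + M * (r' - momentRate (p + 1)) * r' ^ n := by
          refine add_le_add le_rfl (mul_le_mul k1 k2
            (pow_nonneg (mul_nonneg hr (Real.sqrt_nonneg _)) n)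
            (mul_nonneg hM (by linarith)))
      _ = M * r' ^ (n + 1) := by ring

lemma sqrt_momentRate_two_lt_one : Real.sqrt (momentRate 2) < 1 :=
  (Real.sqrt_lt' one_pos).2 (by simpa using momentRate_two_lt_one)

lemma momentDecay_rate_one (hτ : IsSplitLaw τ) (k : ℕ) : MomentDecay τ (k + 2) 1 := by
  induction k with
  | zero =>
    obtain ⟨C, hC, hd⟩ := momentDecay_two hτ
    refine ⟨C, hC, fun n s => (hd n s).trans (mul_le_mul_of_nonneg_left ?_ hC)⟩
    rw [one_pow]
    exact pow_le_one₀ (momentRate_pos 2).le momentRate_two_lt_one.le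
  | succ k ih =>
    exact MomentDecay.succ hτ zero_le_one ih
      ((momentRate_anti (by omega)).trans_lt momentRate_two_lt_one)
      (by rw [one_mul]; exact sqrt_momentRate_two_lt_one.le)

lemma tendsto_momentRate : Tendsto momentRate atTop (𝓝 0) := by
  have h1 : Tendsto (fun p : ℕ => (p : ℝ) * bexp + 1) atTop atTop :=
    tendsto_atTop_add_const_right _ _ (tendsto_natCast_atTop_atTop.atTop_mul_const bexp_pos)
  exact ((tendsto_pow_atTop two_ne_zero).comp h1).const_div_atTop 4

/-- The moments of high order decay faster than any prescribed geometric rate. -/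
lemma exists_momentDecay (hτ : IsSplitLaw τ) {r : ℝ} (hr : 0 < r) :
    ∃ p₀, ∀ p, p₀ ≤ p → MomentDecay τ p r := by
  obtain ⟨p₁, hp₁⟩ := eventually_atTop.1 (tendsto_momentRate.eventually (gt_mem_nhds hr))
  set g := Real.sqrt (momentRate 2)
  have hg0 : 0 ≤ g := Real.sqrt_nonneg _
  have hg1 : g < 1 := sqrt_momentRate_two_lt_one
  -- beyond order `p₁` each further order gains a factor `g`, until the rate `r` is reached
  have step : ∀ k, MomentDecay τ (p₁ + 2 + k) (max r (g ^ k)) := by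
    intro k
    induction k with
    | zero =>
      obtain ⟨C, hC, hd⟩ := momentDecay_rate_one hτ p₁
      refine ⟨C, hC, fun n s => (hd n s).trans (mul_le_mul_of_nonneg_left ?_ hC)⟩
      exact pow_le_pow_left₀ zero_le_one (by simp) n
    | succ k ih =>
      refine MomentDecay.succ hτ (le_max_of_le_left hr.le) ih
        ((hp₁ (p₁ + 2 + k + 1) (by omega)).trans_le (le_max_left _ _)) ?_
      rw [max_mul_of_nonneg _ _ hg0, ← pow_succ]
      exact max_le_max (mul_le_of_le_one_right hr.le hg1.le) le_rfl
  obtain ⟨k, hk⟩ := exists_pow_lt_of_lt_one hr hg1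
  refine ⟨p₁ + 2 + k, fun p hp => ?_⟩
  obtain ⟨j, rfl⟩ := Nat.exists_eq_add_of_le hp
  have := step (k + j)
  rwa [max_eq_left, ← add_assoc] at this
  rw [pow_add]
  exact (mul_le_of_le_one_right (by positivity) (pow_le_one₀ hg0 hg1.le)).trans hk.le

end TreeMoments

/-! ### Uniform convergence of the approximations -/

/-- The approximations as elements of `C[0,1]`. -/
noncomputable def parApproxC (n : ℕ) (w : List (Fin 4) → I × I × I) : C(I, ℝ) :=
  ⟨parApprox n w, (holderVanish_parApprox n w).continuous⟩

lemma measurable_parApproxC (n : ℕ) : Measurable (parApproxC n) :=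
  measurable_of_eval fun s => measurable_slice (measurable_parApprox n) s

/-- A Hölder function is controlled by its values on a grid. -/
lemma HolderVanish.norm_pow_le {K : ℝ} {f : C(I, ℝ)} (hf : HolderVanish K f) {N p : ℕ}
    (hN : 0 < N) (hp : p ≠ 0) :
    ‖f‖ ^ p ≤ 2 ^ p * (∑ j ∈ Finset.range (N + 1),
      |f (Set.projIcc 0 1 zero_le_one (j / N : ℝ))| ^ p
      + (K * (1 / N : ℝ) ^ (bexp / 2)) ^ p) := by
  set S := ∑ j ∈ Finset.range (N + 1), |f (Set.projIcc 0 1 zero_le_one (j / N : ℝ))| ^ p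
  set e := K * (1 / N : ℝ) ^ (bexp / 2)
  have hN' : (0 : ℝ) < N := by exact_mod_cast hN
  have hS : 0 ≤ S := Finset.sum_nonneg fun _ _ => by positivity
  have he : 0 ≤ e := mul_nonneg hf.nonneg (by positivity)
  have hM : 0 ≤ S ^ ((p : ℝ)⁻¹) := by positivity
  have key : ‖f‖ ≤ S ^ ((p : ℝ)⁻¹) + e := by
    rw [ContinuousMap.norm_le _ (add_nonneg hM he)]
    intro s
    set j := ⌊(s : ℝ) * N⌋₊
    have hsN : 0 ≤ (s : ℝ) * N := mul_nonneg s.2.1 hN'.le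
    have j1 : (j : ℝ) ≤ s * N := Nat.floor_le hsN
    have j2 : (s : ℝ) * N < j + 1 := Nat.lt_floor_add_one _
    have j3 : (j : ℝ) ≤ N := j1.trans (mul_le_of_le_one_left hN'.le s.2.2)
    set t : I := Set.projIcc 0 1 zero_le_one (j / N : ℝ)
    have ht : (t : ℝ) = j / N := by
      have := Set.projIcc_of_mem (zero_le_one (α := ℝ)) (x := (j / N : ℝ))
        ⟨by positivity, div_le_one_of_le₀ j3 hN'.le⟩
      exact congrArg Subtype.val this
    have d : |(s : ℝ) - t| ≤ 1 / N := by
      rw [ht, show (s : ℝ) - j / N = (s * N - j) / N by field_simp, abs_div, abs_of_pos hN',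
        abs_of_nonneg (by linarith)]
      gcongr
      linarith
    have b1 : |f t| ≤ S ^ ((p : ℝ)⁻¹) := by
      rw [← Real.pow_rpow_inv_natCast (abs_nonneg (f t)) hp]
      refine Real.rpow_le_rpow (by positivity) ?_ (by positivity)
      exact Finset.single_le_sum (f := fun j : ℕ =>
        |f (Set.projIcc 0 1 zero_le_one (j / N : ℝ))| ^ p) (fun _ _ => by positivity)
        (Finset.mem_range.2 (Nat.lt_succ_of_le (by exact_mod_cast j3)))
    have b2 : |f s - f t| ≤ e := (hf.holder s t).trans (mul_le_mul_of_nonneg_left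
      (Real.rpow_le_rpow (abs_nonneg _) d (by linarith [bexp_pos])) hf.nonneg)
    rw [Real.norm_eq_abs]
    have := abs_add_le (f t) (f s - f t)
    rw [add_sub_cancel] at this
    linarith
  calc ‖f‖ ^ p ≤ (S ^ ((p : ℝ)⁻¹) + e) ^ p := pow_le_pow_left₀ (norm_nonneg _) key p
    _ ≤ 2 ^ (p - 1) * ((S ^ ((p : ℝ)⁻¹)) ^ p + e ^ p) := add_pow_le hM he p
    _ = 2 ^ (p - 1) * (S + e ^ p) := by rw [Real.rpow_inv_natCast_pow hS hp]
    _ ≤ _ := by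
        refine mul_le_mul_of_nonneg_right ?_ (by positivity)
        exact pow_le_pow_right₀ one_le_two (Nat.sub_le p 1)

/-- A sequence with geometrically decaying increments in `L^p` has summable Cauchy bounds. -/
lemma exists_cauchy_bound {Ω E : Type*} [MeasurableSpace Ω] [NormedAddCommGroup E]
    {μ : Measure Ω} {f : ℕ → Ω → E} (hf : ∀ n, AEStronglyMeasurable (f n) μ) {p : ℝ≥0∞}
    (hp : 1 ≤ p) {K r : ℝ} (hK : 0 ≤ K) (hr0 : 0 < r) (hr1 : r < 1)
    (step : ∀ n, eLpNorm (f (n + 1) - f n) p μ ≤ ENNReal.ofReal (K * r ^ n)) :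
    ∃ B : ℕ → ℝ≥0∞, ∑' i, B i ≠ ∞ ∧ ∀ N n m : ℕ, N ≤ n → N ≤ m →
      eLpNorm (f n - f m) p μ < B N := by
  set c := K / (1 - r)
  have hc : 0 ≤ c := div_nonneg hK (by linarith)
  have hcK : c * (1 - r) = K := div_mul_cancel₀ _ (by linarith)
  have tele : ∀ n k, eLpNorm (f (n + k) - f n) p μ
      ≤ ENNReal.ofReal (c * (r ^ n - r ^ (n + k))) := by
    intro n k
    induction k with
    | zero => simp
    | succ k ih =>
      have e : f (n + (k + 1)) - f n = (f (n + k + 1) - f (n + k)) + (f (n + k) - f n) := by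
        rw [← add_assoc]; abel
      have hle : r ^ (n + k) ≤ r ^ n := pow_le_pow_of_le_one hr0.le hr1.le (by omega)
      rw [e]
      refine (eLpNorm_add_le ((hf _).sub (hf _)) ((hf _).sub (hf _)) hp).trans
        ((add_le_add (step (n + k)) ih).trans_eq ?_)
      rw [← ENNReal.ofReal_add (by positivity) (mul_nonneg hc (by linarith)), ← hcK]
      congr 1
      rw [← add_assoc, pow_succ]; ring
  refine ⟨fun N => ENNReal.ofReal ((2 * c + 1) * r ^ N), ?_, fun N n m hn hm => ?_⟩
  · rw [← ENNReal.ofReal_tsum_of_nonneg (fun n => by positivity)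
      ((summable_geometric_of_lt_one hr0.le hr1).mul_left _)]
    exact ENNReal.ofReal_ne_top
  · have t : ∀ n, N ≤ n → eLpNorm (f n - f N) p μ ≤ ENNReal.ofReal (c * r ^ N) := fun n hn => by
      obtain ⟨k, rfl⟩ := Nat.exists_eq_add_of_le hn
      refine (tele N k).trans (ENNReal.ofReal_le_ofReal ?_)
      have : 0 ≤ r ^ (N + k) := by positivity
      exact mul_le_mul_of_nonneg_left (by linarith) hc
    have e : f n - f m = (f n - f N) - (f m - f N) := by abel
    rw [e]
    refine (eLpNorm_sub_le ((hf _).sub (hf _)) ((hf _).sub (hf _)) hp).trans_lt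
      ((add_le_add (t n hn) (t m hm)).trans_lt ?_)
    have : 0 < r ^ N := by positivity
    rw [← ENNReal.ofReal_add (by positivity) (by positivity)]
    exact (ENNReal.ofReal_lt_ofReal_iff (by positivity)).2 (by nlinarith)

section Limit

variable {τ : Measure (I × I × I)} [IsProbabilityMeasure τ]

/-- Geometric decay in `L^p`, for the supremum norm, of the increments: a union bound over a grid
of `4096 ^ n` points, fine enough for the Hölder constant `5 * 4 ^ n` of the increment. -/
lemma exists_integral_norm_pow_le (hτ : IsSplitLaw τ) :
    ∃ p₀, ∀ p, p₀ ≤ p → ∃ A, 0 ≤ A ∧ ∀ n,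
      ∫ w, ‖parApproxC (n + 1) w - parApproxC n w‖ ^ p ∂(treeMeasure τ) ≤ A * (1 / 2) ^ n := by
  -- `1 / 8192` is half of `1 / 4096`, so that the sum over the grid still decays like `2 ^ (-n)`
  obtain ⟨p₀, hp₀⟩ := exists_momentDecay hτ (r := 1 / 8192) (by norm_num)
  refine ⟨max p₀ 1, fun p hp => ?_⟩
  obtain ⟨C, hC, hd⟩ := hp₀ p ((le_max_left _ _).trans hp)
  have hp1 : 1 ≤ p := (le_max_right _ _).trans hp
  refine ⟨2 ^ p * (2 * C + 5 ^ p), by positivity, fun n => ?_⟩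
  have hH : ∀ w, HolderVanish (5 * 4 ^ n) (parApproxC (n + 1) w - parApproxC n w : C(I, ℝ)) :=
    holderVanish_parDiff n
  set N : ℕ := 4096 ^ n
  have hN : 0 < N := by positivity
  -- as `β / 2 > 1 / 4`, the oscillation between grid points is at most `5 * 4 ^ n / 8 ^ n`
  have err : (5 * 4 ^ n * (1 / N : ℝ) ^ (bexp / 2)) ^ p ≤ 5 ^ p * (1 / 2) ^ n := by
    have hN1 : (1 / N : ℝ) ≤ 1 := by
      rw [div_le_one (by positivity)]
      exact_mod_cast hN
    have r1 : (1 / N : ℝ) ^ (bexp / 2) ≤ (1 / N : ℝ) ^ (1 / 4 : ℝ) :=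
      Real.rpow_le_rpow_of_exponent_ge (by positivity) hN1 (by linarith [half_lt_bexp])
    have r2 : (1 / N : ℝ) ^ (1 / 4 : ℝ) = (1 / 8) ^ n := by
      rw [show (1 / N : ℝ) = ((1 / 8) ^ n) ^ 4 by
        rw [← pow_mul, mul_comm, pow_mul, show N = 4096 ^ n from rfl]; push_cast
        rw [← one_div_pow]; norm_num, show (1 / 4 : ℝ) = ((4 : ℕ) : ℝ)⁻¹ by norm_num]
      exact Real.pow_rpow_inv_natCast (by positivity) (by norm_num)
    have r3 : 5 * 4 ^ n * (1 / N : ℝ) ^ (bexp / 2) ≤ 5 * (1 / 2) ^ n := by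
      calc 5 * 4 ^ n * (1 / N : ℝ) ^ (bexp / 2) ≤ 5 * 4 ^ n * (1 / 8) ^ n := by
            rw [← r2]; gcongr
        _ = 5 * (1 / 2) ^ n := by rw [mul_assoc, ← mul_pow]; norm_num
    calc _ ≤ (5 * (1 / 2) ^ n : ℝ) ^ p := pow_le_pow_left₀ (by positivity) r3 p
      _ = 5 ^ p * ((1 / 2) ^ n) ^ p := mul_pow _ _ _
      _ ≤ 5 ^ p * ((1 / 2) ^ n) ^ 1 := by
          refine mul_le_mul_of_nonneg_left ?_ (by positivity)
          exact pow_le_pow_of_le_one (by positivity)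
            (pow_le_one₀ (by norm_num) (by norm_num)) hp1
      _ = _ := by rw [pow_one]
  have ig : ∀ j : ℕ, Integrable
      (fun w => |parDiff n w (Set.projIcc 0 1 zero_le_one (j / N : ℝ))| ^ p) (treeMeasure τ) :=
    fun j => integrable_slice_abs_pow (measurable_parDiff n) (abs_parDiff_le n) _ p
  have isum : Integrable (fun w => ∑ j ∈ Finset.range (N + 1),
      |parDiff n w (Set.projIcc 0 1 zero_le_one (j / N : ℝ))| ^ p) (treeMeasure τ) :=
    integrable_finsetSum _ fun j _ => ig j
  calc _ ≤ ∫ w, 2 ^ p * (∑ j ∈ Finset.range (N + 1),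
          |parDiff n w (Set.projIcc 0 1 zero_le_one (j / N : ℝ))| ^ p
          + (5 * 4 ^ n * (1 / N : ℝ) ^ (bexp / 2)) ^ p) ∂(treeMeasure τ) :=
        integral_mono_of_nonneg (ae_of_all _ fun _ => by positivity)
          ((isum.add (integrable_const _)).const_mul _)
          (ae_of_all _ fun w => (hH w).norm_pow_le hN (by omega))
    _ = 2 ^ p * (∑ j ∈ Finset.range (N + 1), ∫ w,
          |parDiff n w (Set.projIcc 0 1 zero_le_one (j / N : ℝ))| ^ p ∂(treeMeasure τ)
          + (5 * 4 ^ n * (1 / N : ℝ) ^ (bexp / 2)) ^ p) := by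
        rw [integral_const_mul, integral_add isum (integrable_const _),
          integral_finsetSum _ fun j _ => ig j]
        simp
    _ ≤ 2 ^ p * (∑ j ∈ Finset.range (N + 1), C * (1 / 8192) ^ n + 5 ^ p * (1 / 2) ^ n) := by
        gcongr with j _
        exact hd n _
    _ ≤ 2 ^ p * (2 * C * (1 / 2) ^ n + 5 ^ p * (1 / 2) ^ n) := by
        gcongr
        rw [Finset.sum_const, Finset.card_range, nsmul_eq_mul]
        have : ((N + 1 : ℕ) : ℝ) ≤ 2 * 4096 ^ n := by
          have : (1 : ℝ) ≤ 4096 ^ n := one_le_pow₀ (by norm_num)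
          simp only [N]; push_cast; linarith
        calc ((N + 1 : ℕ) : ℝ) * (C * (1 / 8192) ^ n)
            ≤ (2 * 4096 ^ n) * (C * (1 / 8192) ^ n) := by gcongr
          _ = 2 * C * (4096 ^ n * (1 / 8192) ^ n) := by ring
          _ = _ := by rw [← mul_pow]; norm_num
    _ = _ := by ring

lemma norm_parApproxC_le (n : ℕ) (w : List (Fin 4) → I × I × I) : ‖parApproxC n w‖ ≤ 4 ^ n :=
  (ContinuousMap.norm_le _ (by positivity)).2 fun s => abs_parApprox_le n w s

lemma memLp_parApproxC (n : ℕ) (p : ℝ≥0∞) : MemLp (parApproxC n) p (treeMeasure τ) :=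
  MemLp.of_bound (measurable_parApproxC n).aestronglyMeasurable (4 ^ n)
    (ae_of_all _ (norm_parApproxC_le n))

/-- Almost sure uniform convergence of the approximations, and convergence in every `L^p`. -/
theorem exists_limit (hτ : IsSplitLaw τ) :
    ∃ Z : (List (Fin 4) → I × I × I) → C(I, ℝ), Measurable Z ∧
      (∀ᵐ w ∂(treeMeasure τ), Tendsto (fun n => parApproxC n w) atTop (𝓝 (Z w))) ∧
      ∀ p : ℝ≥0, MemLp Z p (treeMeasure τ) ∧
        Tendsto (fun n => eLpNorm (parApproxC n - Z) p (treeMeasure τ)) atTop (𝓝 0) := by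
  obtain ⟨p₀, hp₀⟩ := exists_integral_norm_pow_le hτ
  have geo : ∀ p : ℕ, max p₀ 1 ≤ p → ∃ B : ℕ → ℝ≥0∞, ∑' i, B i ≠ ∞ ∧ ∀ N n m : ℕ, N ≤ n → N ≤ m →
      eLpNorm (parApproxC n - parApproxC m) p (treeMeasure τ) < B N := by
    intro p hp
    obtain ⟨A, hA, hd⟩ := hp₀ p ((le_max_left _ _).trans hp)
    have hp1 : 1 ≤ p := (le_max_right _ _).trans hp
    have hpR : (0 : ℝ) < p := by exact_mod_cast hp1
    set r : ℝ := (1 / 2) ^ ((p : ℝ)⁻¹)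
    have hr0 : 0 < r := by positivity
    have hr1 : r < 1 := Real.rpow_lt_one (by norm_num) (by norm_num) (by positivity)
    set K : ℝ := A ^ ((p : ℝ)⁻¹)
    have hK : 0 ≤ K := by positivity
    have step : ∀ n, eLpNorm (parApproxC (n + 1) - parApproxC n) p (treeMeasure τ)
        ≤ ENNReal.ofReal (K * r ^ n) := fun n => by
      have ml : MemLp (parApproxC (n + 1) - parApproxC n) p (treeMeasure τ) :=
        (memLp_parApproxC _ _).sub (memLp_parApproxC _ _)
      rw [ml.eLpNorm_eq_integral_rpow_norm (by exact_mod_cast (show p ≠ 0 by omega)) (by simp)]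
      refine ENNReal.ofReal_le_ofReal ?_
      simp only [ENNReal.toReal_natCast, Real.rpow_natCast]
      calc _ ≤ (A * (1 / 2) ^ n) ^ ((p : ℝ)⁻¹) :=
            Real.rpow_le_rpow (integral_nonneg fun _ => by positivity) (hd n) (by positivity)
        _ = K * r ^ n := by
            rw [Real.mul_rpow hA (by positivity), ← Real.rpow_natCast, ← Real.rpow_natCast,
              ← Real.rpow_mul (by norm_num), ← Real.rpow_mul (by norm_num), mul_comm (n : ℝ)]
    exact exists_cauchy_bound (fun n => (measurable_parApproxC n).aestronglyMeasurable)
      (by exact_mod_cast hp1) hK hr0 hr1 step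
  have hm : ∀ n, AEStronglyMeasurable (parApproxC n) (treeMeasure τ) := fun n =>
    (measurable_parApproxC n).aestronglyMeasurable
  obtain ⟨Z, hZ, hlim⟩ : ∃ Z : (List (Fin 4) → I × I × I) → C(I, ℝ), Measurable Z ∧
      ∀ᵐ w ∂(treeMeasure τ), Tendsto (fun n => parApproxC n w) atTop (𝓝 (Z w)) := by
    obtain ⟨B, hB, hcau⟩ := geo _ le_rfl
    exact measurable_limit_of_tendsto_metrizable_ae (fun n => (measurable_parApproxC n).aemeasurable)
      (Lp.ae_tendsto_of_cauchy_eLpNorm hm (by exact_mod_cast le_max_right p₀ 1) hB hcau)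
  refine ⟨Z, hZ, hlim, fun p => ?_⟩
  obtain ⟨k, hk⟩ := exists_nat_ge p
  set P := max k (max p₀ 1)
  have hpP : (p : ℝ≥0∞) ≤ (P : ℕ) := by
    have : p ≤ ((P : ℕ) : ℝ≥0) := hk.trans (by exact_mod_cast le_max_left _ _)
    exact_mod_cast ENNReal.coe_le_coe.2 this
  obtain ⟨B, hB, hcau⟩ := geo P (le_max_right _ _)
  have hconv := Lp.cauchy_tendsto_of_tendsto hm Z hB hcau hlim
  have hconvp : Tendsto (fun n => eLpNorm (parApproxC n - Z) p (treeMeasure τ)) atTop (𝓝 0) :=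
    tendsto_of_tendsto_of_tendsto_of_le_of_le tendsto_const_nhds hconv (fun _ => zero_le)
      fun n => eLpNorm_le_eLpNorm_of_exponent_le hpP
        ((measurable_parApproxC n).sub hZ).aestronglyMeasurable
  refine ⟨?_, hconvp⟩
  obtain ⟨n, hn⟩ := (hconvp.eventually (gt_mem_nhds ENNReal.zero_lt_top)).exists
  have : MemLp (parApproxC n - Z) p (treeMeasure τ) :=
    ⟨((measurable_parApproxC n).sub hZ).aestronglyMeasurable, hn⟩
  have h2 := (memLp_parApproxC (τ := τ) n p).sub this
  rwa [sub_sub_cancel] at h2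

end Limit

/-! ### The limit process -/

section LpConvergence

variable {Ω : Type*} [MeasurableSpace Ω] {μ : Measure Ω} {f : ℕ → Ω → ℝ} {g : Ω → ℝ}

lemma norm_toLp_two_sq {f : Ω → ℝ} (hf : MemLp f 2 μ) :
    ‖hf.toLp f‖ ^ 2 = ∫ ω, f ω ^ 2 ∂μ := by
  rw [Lp.norm_toLp, hf.eLpNorm_eq_integral_rpow_norm (by norm_num) (by norm_num),
    ENNReal.toReal_ofReal (by positivity)]
  simp only [ENNReal.toReal_ofNat, Real.rpow_ofNat, Real.norm_eq_abs, sq_abs]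
  have := Real.rpow_inv_natCast_pow (n := 2)
    (integral_nonneg fun ω => sq_nonneg (f ω) : 0 ≤ ∫ ω, f ω ^ 2 ∂μ) two_ne_zero
  exact_mod_cast this

lemma tendsto_integral_sq (hf : ∀ n, MemLp (f n) 2 μ) (hg : MemLp g 2 μ)
    (hlim : Tendsto (fun n => eLpNorm (f n - g) 2 μ) atTop (𝓝 0)) :
    Tendsto (fun n => ∫ ω, f n ω ^ 2 ∂μ) atTop (𝓝 (∫ ω, g ω ^ 2 ∂μ)) := by
  have := ((Lp.tendsto_Lp_iff_tendsto_eLpNorm'' f hf g hg).2 hlim).norm.pow 2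
  simpa only [norm_toLp_two_sq] using this

end LpConvergence

section OnePointLaw

variable {Ω Ω' : Type*} [MeasurableSpace Ω] [MeasurableSpace Ω'] {P : Measure Ω}
  [IsProbabilityMeasure P] {P' : Measure Ω'} [IsProbabilityMeasure P']

/-- The law of the recursion at one point depends on the one-dimensional marginals only. -/
lemma map_onePoint_congr {F : Ω → I → ℝ} {F' : Ω' → I → ℝ}
    (hF : Measurable (Function.uncurry F)) (hF' : Measurable (Function.uncurry F'))
    (hlaw : ∀ s, P.map (fun ω => F ω s) = P'.map (fun ω => F' ω s)) (s : I) :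
    ((volume : Measure (I × I)).prod (P.prod P)).map (onePoint F s)
      = ((volume : Measure (I × I)).prod (P'.prod P')).map (onePoint F' s) := by
  ext A hA
  have h1 := measurable_onePoint hF s
  have h2 := measurable_onePoint hF' s
  rw [Measure.map_apply h1 hA, Measure.map_apply h2 hA, Measure.prod_apply (h1 hA),
    Measure.prod_apply (h2 hA)]
  refine lintegral_congr fun q => ?_
  set B : Set (ℝ × ℝ) := {p | (segLen q.1 s * q.2) ^ bexp * p.1
    + (segLen q.1 s * (1 - q.2)) ^ bexp * p.2 ∈ A}
  have hB : MeasurableSet B := hA.preimage (by fun_prop)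
  have m1 := measurable_slice hF (segPos q.1 s)
  have m2 := measurable_slice hF' (segPos q.1 s)
  have e := Measure.map_prod_map P P m1 m1
  have e' := Measure.map_prod_map P' P' m2 m2
  rw [hlaw, e'] at e
  have := congrArg (fun κ => κ B) e
  rw [Measure.map_apply (m1.prodMap m1) hB, Measure.map_apply (m2.prodMap m2) hB] at this
  exact this.symm

end OnePointLaw

/-- The one-dimensional marginals of the approximations do not depend on the joint law of the two
lower cuts. -/
lemma map_parApprox_eq {τ τ' : Measure (I × I × I)} [IsProbabilityMeasure τ]
    [IsProbabilityMeasure τ'] (hτ : IsSplitLaw τ) (hτ' : IsSplitLaw τ') (n : ℕ) (s : I) :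
    (treeMeasure τ).map (fun w => parApprox n w s)
      = (treeMeasure τ').map (fun w => parApprox n w s) := by
  induction n generalizing s with
  | zero => simp [parApprox]
  | succ n ih =>
    rw [hτ.map_tree (G := parApprox (n + 1)) (measurable_parApprox n) (fun w s => rfl),
      hτ'.map_tree (G := parApprox (n + 1)) (measurable_parApprox n) (fun w s => rfl)]
    exact map_onePoint_congr (measurable_parApprox n) (measurable_parApprox n) ih s

/-- `Z` is a version of the limit of the approximations, with convergence in every `L^p`. -/
structure IsParLimit (τ : Measure (I × I × I)) (Z : (List (Fin 4) → I × I × I) → C(I, ℝ)) :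
    Prop where
  measurable : Measurable Z
  tendsto : ∀ᵐ w ∂(treeMeasure τ), Tendsto (fun n => parApproxC n w) atTop (𝓝 (Z w))
  memLp : ∀ p : ℝ≥0, MemLp Z p (treeMeasure τ)
  tendsto_eLpNorm : ∀ p : ℝ≥0,
    Tendsto (fun n => eLpNorm (parApproxC n - Z) p (treeMeasure τ)) atTop (𝓝 0)

lemma memLp_eval {Ω : Type*} [MeasurableSpace Ω] {P : Measure Ω} {Z : Ω → C(I, ℝ)} {p : ℝ≥0∞}
    (hZ : MemLp Z p P) (s : I) : MemLp (fun ω => Z ω s) p P :=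
  hZ.mono ((continuous_eval_const s).comp_aestronglyMeasurable hZ.1)
    (ae_of_all _ fun ω => (Z ω).norm_coe_le_norm s)

namespace IsParLimit

variable {τ : Measure (I × I × I)} {Z : (List (Fin 4) → I × I × I) → C(I, ℝ)}

lemma tendsto_eLpNorm_eval (hZ : IsParLimit τ Z) (p : ℝ≥0) (s : I) :
    Tendsto (fun n => eLpNorm ((fun w => parApprox n w s) - fun w => Z w s) p (treeMeasure τ))
      atTop (𝓝 0) :=
  tendsto_of_tendsto_of_tendsto_of_le_of_le tendsto_const_nhds (hZ.tendsto_eLpNorm p)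
    (fun _ => zero_le) fun n => eLpNorm_mono fun w =>
      (parApproxC n w - Z w).norm_coe_le_norm s

variable [IsProbabilityMeasure τ]

lemma memLp_parApprox (n : ℕ) (s : I) (p : ℝ≥0∞) :
    MemLp (fun w => parApprox n w s) p (treeMeasure τ) :=
  memLp_slice (measurable_parApprox n) (abs_parApprox_le n) s p

lemma integral_eval (hZ : IsParLimit τ Z) (hτ : IsSplitLaw τ) (s : I) :
    ∫ w, Z w s ∂(treeMeasure τ) = h s := by
  have h1 := tendsto_integral_of_L1' (fun w => Z w s)
    (memLp_eval (hZ.memLp 1) s).1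
    (F := fun n w => parApprox n w s) (l := atTop)
    (Eventually.of_forall fun n => memLp_one_iff_integrable.1 (memLp_parApprox n s 1))
    (by simpa using hZ.tendsto_eLpNorm_eval 1 s)
  simp_rw [integral_parApprox hτ] at h1
  exact tendsto_nhds_unique h1 tendsto_const_nhds |>.trans rfl

lemma integral_eval_sq (hZ : IsParLimit τ Z) (hτ : IsSplitLaw τ) (s : I) :
    ∫ w, Z w s ^ 2 ∂(treeMeasure τ) = c2 * h s ^ 2 := by
  have h1 := tendsto_integral_sq (fun n => memLp_parApprox (τ := τ) n s 2)
    (by simpa using memLp_eval (hZ.memLp 2) s) (by simpa using hZ.tendsto_eLpNorm_eval 2 s)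
  simp_rw [integral_parApprox_sq hτ] at h1
  exact tendsto_nhds_unique h1 (tendsto_sqRatio.mul_const _)

lemma measurePreserving_subtree (i : Fin 4) :
    MeasurePreserving (fun (w : List (Fin 4) → I × I × I) v => w (i :: v)) (treeMeasure τ)
      (treeMeasure τ) :=
  (measurePreserving_eval (fun _ : Fin 4 => treeMeasure τ) i).comp
    ((measurePreserving_snd (μ := τ)).comp (measurePreserving_splitTree (τ := τ)))

lemma tendsto_parOp {x y z : I} {f : ℕ → Fin 4 → I → ℝ} {g : Fin 4 → I → ℝ}
    (hfg : ∀ i s, Tendsto (fun n => f n i s) atTop (𝓝 (g i s))) (s : I) :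
    Tendsto (fun n => parOp x y z (f n) s) atTop (𝓝 (parOp x y z g s)) := by
  unfold parOp
  split_ifs
  · exact ((hfg 0 _).const_mul _).add ((hfg 1 _).const_mul _)
  · exact ((hfg 2 _).const_mul _).add ((hfg 3 _).const_mul _)

lemma tendsto_apply {w : List (Fin 4) → I × I × I} {f : C(I, ℝ)}
    (hw : Tendsto (fun n => parApproxC n w) atTop (𝓝 f)) (s : I) :
    Tendsto (fun n => parApprox n w s) atTop (𝓝 (f s)) :=
  ((continuous_eval_const s).tendsto f).comp hw

/-- The limit process inherits the recursion from the approximations. -/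
lemma ae_eq_parOp (hZ : IsParLimit τ Z) :
    ∀ᵐ w ∂(treeMeasure τ), (Z w : I → ℝ) = parOp (w []).1 (w []).2.1 (w []).2.2
      (fun i => Z (fun v => w (i :: v))) := by
  have hs : ∀ᵐ w ∂(treeMeasure τ), ∀ i : Fin 4,
      Tendsto (fun n => parApproxC n fun v => w (i :: v)) atTop (𝓝 (Z fun v => w (i :: v))) :=
    ae_all_iff.2 fun i => (measurePreserving_subtree i).quasiMeasurePreserving.ae hZ.tendsto
  filter_upwards [hZ.tendsto, hs] with w h1 h2
  funext s
  exact tendsto_nhds_unique ((tendsto_add_atTop_iff_nat 1).2 (tendsto_apply h1 s))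
    (tendsto_parOp (f := fun n i => parApprox n fun v => w (i :: v))
      (fun i s => tendsto_apply (h2 i) s) s)

/-- The one-dimensional marginals of the limit are the same for all joint laws of the two lower
cuts. -/
lemma map_eval_eq {τ' : Measure (I × I × I)} [IsProbabilityMeasure τ']
    {Z' : (List (Fin 4) → I × I × I) → C(I, ℝ)} (hZ : IsParLimit τ Z) (hZ' : IsParLimit τ' Z')
    (hτ : IsSplitLaw τ) (hτ' : IsSplitLaw τ') (s : I) :
    (treeMeasure τ).map (fun w => Z w s) = (treeMeasure τ').map (fun w => Z' w s) := by
  have m : Measurable fun w => Z w s := (continuous_eval_const s).measurable.comp hZ.measurable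
  have m' : Measurable fun w => Z' w s := (continuous_eval_const s).measurable.comp hZ'.measurable
  have := Measure.isProbabilityMeasure_map (μ := treeMeasure τ) m.aemeasurable
  have := Measure.isProbabilityMeasure_map (μ := treeMeasure τ') m'.aemeasurable
  refine ext_of_forall_integral_eq_of_IsFiniteMeasure fun g => ?_
  have lim : ∀ {τ : Measure (I × I × I)} [IsProbabilityMeasure τ]
      {Z : (List (Fin 4) → I × I × I) → C(I, ℝ)}, IsParLimit τ Z →
      Tendsto (fun n => ∫ x, g x ∂((treeMeasure τ).map fun w => parApprox n w s)) atTop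
        (𝓝 (∫ x, g x ∂((treeMeasure τ).map fun w => Z w s))) := by
    intro τ _ Z hZ
    have m : Measurable fun w => Z w s := (continuous_eval_const s).measurable.comp hZ.measurable
    rw [integral_map m.aemeasurable g.continuous.aestronglyMeasurable]
    simp_rw [fun n => integral_map (μ := treeMeasure τ)
      (measurable_slice (measurable_parApprox n) s).aemeasurable
      g.continuous.aestronglyMeasurable]
    refine tendsto_integral_of_dominated_convergence (fun _ => ‖g‖)
      (fun n => (g.continuous.measurable.comp
        (measurable_slice (measurable_parApprox n) s)).aestronglyMeasurable)
      (integrable_const _) (fun n => ae_of_all _ fun w => g.norm_coe_le_norm _) ?_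
    filter_upwards [hZ.tendsto] with w hw
    exact (g.continuous.tendsto _).comp (tendsto_apply hw s)
  have l := lim hZ
  simp_rw [map_parApprox_eq hτ hτ'] at l
  exact tendsto_nhds_unique l (lim hZ')

end IsParLimit

lemma exists_isParLimit {τ : Measure (I × I × I)} [IsProbabilityMeasure τ] (hτ : IsSplitLaw τ) :
    ∃ Z, IsParLimit τ Z := by
  obtain ⟨Z, h1, h2, h3⟩ := exists_limit hτ
  exact ⟨Z, h1, h2, fun p => (h3 p).1, fun p => (h3 p).2⟩

lemma isSplitLaw_volume : IsSplitLaw (volume : Measure (I × I × I)) where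
  left := ((MeasurePreserving.id volume).prod (measurePreserving_fst (μ := (volume : Measure I))
    (ν := (volume : Measure I)))).map_eq
  right := ((MeasurePreserving.id volume).prod (measurePreserving_snd (μ := (volume : Measure I))
    (ν := (volume : Measure I)))).map_eq

/-- The same lower cut on both sides, as in quadtrees. -/
def dupCut (q : I × I) : I × I × I := (q.1, q.2, q.2)

lemma measurable_dupCut : Measurable dupCut := by unfold dupCut; fun_prop

instance : IsProbabilityMeasure ((volume : Measure (I × I)).map dupCut) :=
  Measure.isProbabilityMeasure_map measurable_dupCut.aemeasurable

lemma isSplitLaw_dupCut : IsSplitLaw ((volume : Measure (I × I)).map dupCut) where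
  left := by
    rw [Measure.map_map (by fun_prop) measurable_dupCut]
    exact Measure.map_id
  right := by
    rw [Measure.map_map (by fun_prop) measurable_dupCut]
    exact Measure.map_id

lemma map_dupCut_tree : quadMeasure.map (fun w u => dupCut (w u))
    = treeMeasure ((volume : Measure (I × I)).map dupCut) :=
  Measure.infinitePi_map_pi _ fun _ => measurable_dupCut

lemma quadApprox_eq_parApprox (n : ℕ) (w : List (Fin 4) → I × I) :
    quadApprox n w = parApprox n (fun u => dupCut (w u)) := by
  induction n generalizing w with
  | zero => rfl
  | succ n ih =>
    simp only [quadApprox, parApprox, ih]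
    rfl

lemma measurable_parOp_comp {Ω : Type*} [MeasurableSpace Ω] {Z : Ω → C(I, ℝ)} (hZ : Measurable Z) :
    Measurable fun q : (I × I × I) × (Fin 4 → Ω) =>
      parOp q.1.1 q.1.2.1 q.1.2.2 (fun i => (Z (q.2 i) : I → ℝ)) := by
  refine measurable_pi_lambda _ fun s => ?_
  refine measurable_parOp (f := fun (q : (I × I × I) × (Fin 4 → Ω)) i => (Z (q.2 i) : I → ℝ))
    (fun i => ?_) (by fun_prop) (by fun_prop) (by fun_prop) measurable_const
  have : Measurable fun q : ((I × I × I) × (Fin 4 → Ω)) × I => (Z (q.1.2 i), q.2) := by fun_prop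
  exact measurable_evalPair.comp this

lemma IsParLimit.solvesPar {Z : (List (Fin 4) → I × I × I) → C(I, ℝ)}
    (hZ : IsParLimit (volume : Measure (I × I × I)) Z) :
    SolvesPar Z (treeMeasure (volume : Measure (I × I × I))) where
  aemeasurable_fst := (measurable_coeFn.comp hZ.measurable).aemeasurable
  aemeasurable_snd := (measurable_parOp_comp hZ.measurable).aemeasurable
  map_eq := by
    have hm := measurable_parOp_comp hZ.measurable
    rw [Measure.map_congr hZ.ae_eq_parOp,
      ← (measurePreserving_splitTree (τ := (volume : Measure (I × I × I)))).map_eq,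
      Measure.map_map hm (measurePreserving_splitTree
        (τ := (volume : Measure (I × I × I)))).measurable]
    rfl

/-! ### The averaging operator on second moments -/

lemma lintegral_unitInterval {g : ℝ → ℝ≥0∞} (hg : Measurable g) :
    ∫⁻ x : I, g x = ∫⁻ t in Set.Icc (0 : ℝ) 1, g t :=
  unitInterval.measurePreserving_coe.lintegral_comp hg

lemma lintegral_eq_mul_left (g : ℝ → ℝ≥0∞) (hg : Measurable g) {a : ℝ} (ha : 0 < a) :
    ∫⁻ t, g t = ENNReal.ofReal a * ∫⁻ t, g (a * t) := by
  conv_lhs => rw [← Real.smul_map_volume_mul_left ha.ne']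
  rw [lintegral_smul_measure, lintegral_map hg (by fun_prop), abs_of_pos ha, smul_eq_mul]

lemma ae_ne_unitInterval (a : I) : ∀ᵐ x : I, x ≠ a :=
  Measure.ae_ne volume a

/-- Rescaling the left piece `[0, x]` to `[0, 1]`. -/
lemma lintegral_relLeft {D : I → ℝ≥0∞} (hD : Measurable D) (x : I) :
    ∫⁻ s, (if s ≤ x then D (relLeft x s) else 0) = ENNReal.ofReal x * ∫⁻ s, D s := by
  rcases eq_or_ne x 0 with rfl | hx
  · rw [lintegral_congr_ae (g := fun _ => 0)]
    · simp
    · filter_upwards [ae_ne_unitInterval 0] with s hs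
      rw [if_neg]
      exact fun hle => hs (le_antisymm hle bot_le)
  have hx0 : 0 < (x : ℝ) := lt_of_le_of_ne x.2.1 fun h0 => hx (Subtype.ext h0.symm)
  have mP : Measurable (Set.projIcc (0 : ℝ) 1 zero_le_one) := continuous_projIcc.measurable
  have hDp : Measurable fun t : ℝ => D (Set.projIcc 0 1 zero_le_one t) := hD.comp mP
  have e1 : ∫⁻ s : I, (if s ≤ x then D (relLeft x s) else 0)
      = ∫⁻ t : ℝ, (Set.Icc 0 (x : ℝ)).indicator
          (fun t => D (Set.projIcc 0 1 zero_le_one (t / x))) t := by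
    have hm : Measurable fun t : ℝ =>
        if t ≤ x then D (Set.projIcc 0 1 zero_le_one (t / x)) else 0 :=
      Measurable.ite measurableSet_Iic (hDp.comp (by fun_prop)) measurable_const
    refine (lintegral_unitInterval hm).trans ?_
    rw [← lintegral_indicator measurableSet_Icc]
    refine lintegral_congr fun t => ?_
    simp only [Set.indicator_apply, Set.mem_Icc]
    by_cases h0 : 0 ≤ t <;> by_cases h1 : t ≤ x
    · simp [h0, h1, h1.trans x.2.2]
    · simp [h1]
    · simp [h0]
    · simp [h0]
  have e2 : ∫⁻ s : I, D s = ∫⁻ t : ℝ, (Set.Icc 0 1).indicator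
      (fun t => D (Set.projIcc 0 1 zero_le_one t)) t := by
    rw [lintegral_indicator measurableSet_Icc, ← lintegral_unitInterval hDp]
    simp
  have hm : Measurable fun t : ℝ => (Set.Icc 0 (x : ℝ)).indicator
      (fun t => D (Set.projIcc 0 1 zero_le_one (t / x))) t :=
    Measurable.indicator (hDp.comp (measurable_id.div_const (x : ℝ))) measurableSet_Icc
  rw [e1, e2, lintegral_eq_mul_left _ hm hx0]
  congr 1
  refine lintegral_congr fun t => ?_
  simp only [Set.indicator_apply, Set.mem_Icc]
  have : (0 ≤ (x : ℝ) * t ∧ (x : ℝ) * t ≤ x) ↔ (0 ≤ t ∧ t ≤ 1) := by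
    constructor
    · rintro ⟨h0, h1⟩
      exact ⟨nonneg_of_mul_nonneg_right h0 hx0, by nlinarith⟩
    · rintro ⟨h0, h1⟩
      exact ⟨by positivity, by nlinarith⟩
  simp only [this]
  congr 2
  field_simp

/-- The right piece is the left one, seen in the mirror. -/
lemma relRight_eq_symm {x s : I} (hx : x ≠ 1) (hs : x ≤ s) :
    relRight x s = unitInterval.symm (relLeft (unitInterval.symm x) (unitInterval.symm s)) := by
  have h1 : 1 - (x : ℝ) ≠ 0 := fun h0 => hx (Subtype.ext (by
    have : (x : ℝ) = 1 := by linarith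
    exact this))
  have hs' : unitInterval.symm s ≤ unitInterval.symm x := unitInterval.symm_le_symm.2 hs
  ext
  rw [coe_relRight hs, unitInterval.coe_symm_eq, coe_relLeft hs', unitInterval.coe_symm_eq,
    unitInterval.coe_symm_eq]
  field_simp
  ring

/-- The averaged splitting operator, acting on functions of the location. -/
noncomputable def avgSplit (D : I → ℝ≥0∞) (s : I) : ℝ≥0∞ :=
  ∫⁻ x : I, ENNReal.ofReal (segLen x s ^ (2 * bexp)) * D (segPos x s)

lemma measurable_avgSplit_integrand {D : I → ℝ≥0∞} (hD : Measurable D) :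
    Measurable fun q : I × I =>
      ENNReal.ofReal (segLen q.1 q.2 ^ (2 * bexp)) * D (segPos q.1 q.2) :=
  (measurable_segLen.pow_const _).ennreal_ofReal.mul (hD.comp measurable_segPos)

lemma measurable_avgSplit_fix {D : I → ℝ≥0∞} (hD : Measurable D) (s : I) :
    Measurable fun x : I => ENNReal.ofReal (segLen x s ^ (2 * bexp)) * D (segPos x s) :=
  ((measurable_fix_segLen s).pow_const _).ennreal_ofReal.mul (hD.comp (measurable_fix_segPos s))

lemma lintegral_ofReal_rpow {c : ℝ} (hc : 0 ≤ c) :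
    ∫⁻ y : I, ENNReal.ofReal ((y : ℝ) ^ c) = ENNReal.ofReal (1 / (c + 1)) := by
  rw [← ofReal_integral_eq_lintegral_ofReal (integrable_rpow_unitInterval hc)
    (ae_of_all _ fun y => Real.rpow_nonneg y.2.1 _), integral_rpow_unitInterval hc]

lemma lintegral_ofReal_one_sub_rpow {c : ℝ} (hc : 0 ≤ c) :
    ∫⁻ y : I, ENNReal.ofReal ((1 - y : ℝ) ^ c) = ENNReal.ofReal (1 / (c + 1)) := by
  rw [← ofReal_integral_eq_lintegral_ofReal (integrable_one_sub_rpow_unitInterval hc)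
    (ae_of_all _ fun y => Real.rpow_nonneg (by linarith [y.2.2]) _),
    integral_one_sub_rpow_unitInterval hc]

lemma lintegral_segment_le {D : I → ℝ≥0∞} (hD : Measurable D) {x : I} (hx : x ≠ 1) :
    ∫⁻ s : I, ENNReal.ofReal (segLen x s ^ (2 * bexp)) * D (segPos x s)
      ≤ (ENNReal.ofReal ((x : ℝ) ^ (2 * bexp + 1))
        + ENNReal.ofReal ((1 - x : ℝ) ^ (2 * bexp + 1))) * ∫⁻ s, D s := by
  have hb := bexp_pos
  have hx1 : 0 ≤ 1 - (x : ℝ) := by linarith [x.2.2]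
  set D' : I → ℝ≥0∞ := fun s => D (unitInterval.symm s)
  have hD' : Measurable D' := hD.comp unitInterval.measurable_symm
  have mL : ∀ {D : I → ℝ≥0∞}, Measurable D → ∀ x : I,
      Measurable fun s : I => if s ≤ x then D (relLeft x s) else 0 := fun hD x =>
    Measurable.ite measurableSet_Iic
      (hD.comp (measurable_relLeft.comp (measurable_const.prodMk measurable_id))) measurable_const
  set A : I → ℝ≥0∞ := fun s => if s ≤ x then D (relLeft x s) else 0
  set B : I → ℝ≥0∞ := fun s => if s ≤ unitInterval.symm x then
    D' (relLeft (unitInterval.symm x) s) else 0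
  have hA : Measurable A := mL hD x
  have hB : Measurable B := mL hD' _
  have hBs : Measurable fun s => B (unitInterval.symm s) := hB.comp unitInterval.measurable_symm
  have pt : ∀ s : I, ENNReal.ofReal (segLen x s ^ (2 * bexp)) * D (segPos x s)
      ≤ ENNReal.ofReal ((x : ℝ) ^ (2 * bexp)) * A s
        + ENNReal.ofReal ((1 - x : ℝ) ^ (2 * bexp)) * B (unitInterval.symm s) := by
    intro s
    rcases lt_or_ge s x with hs | hs
    · refine le_add_right ?_
      simp [segLen, segPos, A, hs, hs.le]
    · refine le_add_left ?_
      have : unitInterval.symm s ≤ unitInterval.symm x := unitInterval.symm_le_symm.2 hs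
      simp only [segLen, segPos, not_lt.2 hs, if_false, B, if_pos this, D']
      rw [relRight_eq_symm hx hs]
  have eI : ∫⁻ s, D' s = ∫⁻ s, D s := unitInterval.measurePreserving_symm.lintegral_comp hD
  calc _ ≤ ∫⁻ s, (ENNReal.ofReal ((x : ℝ) ^ (2 * bexp)) * A s
        + ENNReal.ofReal ((1 - x : ℝ) ^ (2 * bexp)) * B (unitInterval.symm s)) :=
        lintegral_mono pt
    _ = ENNReal.ofReal ((x : ℝ) ^ (2 * bexp)) * (ENNReal.ofReal x * ∫⁻ s, D s)
        + ENNReal.ofReal ((1 - x : ℝ) ^ (2 * bexp)) * (ENNReal.ofReal (1 - x) * ∫⁻ s, D s) := by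
        rw [lintegral_add_left (hA.const_mul _), lintegral_const_mul _ hA,
          lintegral_const_mul _ hBs, unitInterval.measurePreserving_symm.lintegral_comp hB,
          lintegral_relLeft hD, lintegral_relLeft hD', eI, unitInterval.coe_symm_eq]
    _ = _ := by
        rw [Real.rpow_add_one' x.2.1 (by positivity), Real.rpow_add_one' hx1 (by positivity),
          ENNReal.ofReal_mul (Real.rpow_nonneg x.2.1 _), ENNReal.ofReal_mul
          (Real.rpow_nonneg hx1 _)]
        ring

/-- The mean contraction factor of second moments, in the norm of `L¹[0,1]`. -/
noncomputable def avgRate : ℝ≥0∞ := ENNReal.ofReal (4 / ((2 * bexp + 1) * (2 * bexp + 2)))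

lemma avgRate_lt_one : avgRate < 1 := by
  have := half_lt_bexp
  unfold avgRate
  rw [← ENNReal.ofReal_one, ENNReal.ofReal_lt_ofReal_iff one_pos, div_lt_one (by positivity)]
  nlinarith

lemma lintegral_avgSplit_le {D : I → ℝ≥0∞} (hD : Measurable D) :
    ∫⁻ s, ENNReal.ofReal (2 / (2 * bexp + 1)) * avgSplit D s ≤ avgRate * ∫⁻ s, D s := by
  have hb := bexp_pos
  have hm := measurable_avgSplit_integrand hD
  have hm' : Measurable fun s : I => avgSplit D s := hm.lintegral_prod_left'
  rw [lintegral_const_mul _ hm']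
  unfold avgSplit
  have hs : Measurable (Function.uncurry fun s x : I =>
      ENNReal.ofReal (segLen x s ^ (2 * bexp)) * D (segPos x s)) := by
    have mL : Measurable fun q : I × I => segLen q.2 q.1 := measurable_segLen.comp measurable_swap
    have mP : Measurable fun q : I × I => segPos q.2 q.1 := measurable_segPos.comp measurable_swap
    exact (mL.pow_const _).ennreal_ofReal.mul (hD.comp mP)
  rw [lintegral_lintegral_swap hs.aemeasurable]
  calc _ ≤ ENNReal.ofReal (2 / (2 * bexp + 1)) * ∫⁻ x : I,
        (ENNReal.ofReal ((x : ℝ) ^ (2 * bexp + 1))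
          + ENNReal.ofReal ((1 - x : ℝ) ^ (2 * bexp + 1))) * ∫⁻ s, D s := by
        refine mul_le_mul_right (lintegral_mono_ae ?_) _
        filter_upwards [ae_ne_unitInterval 1] with x hx
        exact lintegral_segment_le hD hx
    _ = ENNReal.ofReal (2 / (2 * bexp + 1)) * ((ENNReal.ofReal (1 / (2 * bexp + 1 + 1))
          + ENNReal.ofReal (1 / (2 * bexp + 1 + 1))) * ∫⁻ s, D s) := by
        rw [lintegral_mul_const _ (by fun_prop), lintegral_add_left (by fun_prop),
          lintegral_ofReal_rpow (by positivity), lintegral_ofReal_one_sub_rpow (by positivity)]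
    _ = _ := by
        rw [← mul_assoc, avgRate, ← ENNReal.ofReal_add (by positivity) (by positivity),
          ← ENNReal.ofReal_mul (by positivity)]
        congr 2
        field_simp
        ring

/-- The midpoint of the unit interval. -/
noncomputable def half : I := ⟨1 / 2, by norm_num, by norm_num⟩

lemma coe_half : ((half : I) : ℝ) = 1 / 2 := rfl

/-- Finiteness of the averaging operator at the midpoint forces integrability on the right half:
the substitution `r = 1 / (2 x)`. -/
lemma setLIntegral_lt_top_of_relLeft {D : I → ℝ≥0∞} (hD : Measurable D)
    (hfin : ∫⁻ x : I, (if (1 / 2 : ℝ) < x then D (relLeft x half)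
      else 0) < ∞) :
    ∫⁻ r : I, (if (1 / 2 : ℝ) < r then D r else 0) < ∞ := by
  have mP : Measurable (Set.projIcc (0 : ℝ) 1 zero_le_one) := continuous_projIcc.measurable
  set Dp : ℝ → ℝ≥0∞ := fun t => D (Set.projIcc 0 1 zero_le_one t)
  have hDp : Measurable Dp := hD.comp mP
  set S : Set ℝ := Set.Ioo (1 / 2) 1
  have hfin' : ∫⁻ t in S, Dp (1 / 2 / t) < ∞ := by
    refine lt_of_le_of_lt ?_ hfin
    have hm : Measurable fun t : ℝ => if (1 / 2 : ℝ) < t then Dp (1 / 2 / t) else 0 :=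
      Measurable.ite measurableSet_Ioi (hDp.comp (by fun_prop)) measurable_const
    refine le_trans ?_ (lintegral_unitInterval hm).ge
    rw [← lintegral_indicator measurableSet_Ioo, ← lintegral_indicator measurableSet_Icc]
    refine lintegral_mono fun t => ?_
    by_cases ht : t ∈ S
    · have h1 : t ∈ Set.Icc (0 : ℝ) 1 := ⟨by linarith [ht.1], ht.2.le⟩
      rw [Set.indicator_of_mem ht, Set.indicator_of_mem h1, if_pos ht.1]
    · rw [Set.indicator_of_notMem ht]; exact zero_le
  have himg : (fun t : ℝ => 1 / 2 / t) '' S = S := by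
    ext r
    constructor
    · rintro ⟨t, ⟨h1, h2⟩, rfl⟩
      have : 0 < t := by linarith
      constructor
      · rw [lt_div_iff₀ this]; linarith
      · rw [div_lt_one this]; exact h1
    · rintro ⟨h1, h2⟩
      have : 0 < r := by linarith
      refine ⟨1 / 2 / r, ⟨?_, ?_⟩, by field_simp⟩
      · rw [lt_div_iff₀ this]; linarith
      · rw [div_lt_one this]; exact h1
  have hder : ∀ t ∈ S, HasDerivWithinAt (fun t : ℝ => 1 / 2 / t) (-(1 / 2) / t ^ 2) S t := by
    intro t ht
    have h0 : t ≠ 0 := by linarith [ht.1]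
    have h1 : HasDerivAt (fun t : ℝ => 1 / 2 * t⁻¹) (1 / 2 * -(t ^ 2)⁻¹) t :=
      (hasDerivAt_inv h0).const_mul _
    have h2 : (fun t : ℝ => 1 / 2 / t) = fun t : ℝ => 1 / 2 * t⁻¹ := by
      ext t; rw [div_eq_mul_inv]
    rw [h2]
    refine (h1.congr_deriv ?_).hasDerivWithinAt
    rw [div_eq_mul_inv]; ring
  have hinj : Set.InjOn (fun t : ℝ => 1 / 2 / t) S := by
    intro a ha b hb hab
    have ha0 : a ≠ 0 := by linarith [ha.1]
    have hb0 : b ≠ 0 := by linarith [hb.1]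
    simp only at hab
    field_simp at hab
    linarith
  have cov := lintegral_image_eq_lintegral_abs_deriv_mul (measurableSet_Ioo (a := (1 / 2 : ℝ))
    (b := 1)) hder hinj Dp
  rw [himg] at cov
  have hS : ∫⁻ t in S, Dp t < ∞ := by
    rw [cov]
    refine lt_of_le_of_lt (setLIntegral_mono' measurableSet_Ioo
      (g := fun t => 2 * Dp (1 / 2 / t)) fun t ht => ?_) ?_
    · gcongr
      rw [show (2 : ℝ≥0∞) = ENNReal.ofReal 2 by simp]
      refine ENNReal.ofReal_le_ofReal ?_
      rw [abs_div, abs_neg, abs_of_pos (by norm_num : (0 : ℝ) < 1 / 2), abs_of_nonneg (sq_nonneg t),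
        div_le_iff₀ (by have := ht.1; positivity)]
      nlinarith [ht.1]
    · have hm : Measurable fun t : ℝ => Dp (1 / 2 / t) :=
        hDp.comp (measurable_const.div measurable_id)
      rw [lintegral_const_mul _ hm]
      exact ENNReal.mul_lt_top (by simp) hfin'
  refine lt_of_le_of_lt ?_ hS
  have hm : Measurable fun t : ℝ => if (1 / 2 : ℝ) < t then Dp t else 0 :=
    Measurable.ite measurableSet_Ioi hDp measurable_const
  have e : ∀ r : I, (if (1 / 2 : ℝ) < r then D r else 0)
      = if (1 / 2 : ℝ) < r then Dp r else 0 := fun r => by simp [Dp]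
  simp_rw [e]
  refine (lintegral_unitInterval hm).trans_le ?_
  rw [← lintegral_indicator measurableSet_Icc, ← lintegral_indicator measurableSet_Ioo]
  refine lintegral_mono_ae ?_
  have : ∀ᵐ t : ℝ, t ≠ 1 := Measure.ae_ne volume 1
  filter_upwards [this] with t ht
  by_cases h1 : t ∈ Set.Icc (0 : ℝ) 1
  · rw [Set.indicator_of_mem h1]
    split_ifs with h2
    · rw [Set.indicator_of_mem (show t ∈ S from ⟨h2, lt_of_le_of_ne h1.2 ht⟩)]
    · exact zero_le
  · rw [Set.indicator_of_notMem h1]; exact zero_le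

/-- Finiteness of the averaging operator at the midpoint forces integrability: the relative position
of the midpoint in the left piece sweeps the right half of the interval, and conversely. -/
lemma lintegral_lt_top_of_avgSplit {D : I → ℝ≥0∞} (hD : Measurable D) (hfin : avgSplit D half < ∞) : ∫⁻ s, D s < ∞ := by
  set c : I := half with hc
  have hb := bexp_pos
  set k : ℝ≥0∞ := ENNReal.ofReal ((1 / 2 : ℝ) ^ (2 * bexp))
  have hk0 : k ≠ 0 := by
    simp only [k, ne_eq, ENNReal.ofReal_eq_zero, not_le]; positivity
  have hk : k ≠ ∞ := ENNReal.ofReal_ne_top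
  have cancel : ∀ {E : I → ℝ≥0∞}, Measurable E → (∫⁻ x : I, k * E x < ∞) → ∫⁻ x : I, E x < ∞ := by
    intro E hE hlt
    rw [lintegral_const_mul _ hE] at hlt
    exact ENNReal.lt_top_of_mul_ne_top_right hlt.ne hk0
  set D' : I → ℝ≥0∞ := fun s => D (unitInterval.symm s)
  have hD' : Measurable D' := hD.comp unitInterval.measurable_symm
  have mE : ∀ {D : I → ℝ≥0∞}, Measurable D →
      Measurable fun x : I => if (1 / 2 : ℝ) < x then D (relLeft x c) else 0 := fun hD =>
    Measurable.ite (measurableSet_lt measurable_const measurable_subtype_coe)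
      (hD.comp (measurable_relLeft.comp (measurable_id.prodMk measurable_const))) measurable_const
  have r1 : ∫⁻ r : I, (if (1 / 2 : ℝ) < r then D r else 0) < ∞ := by
    refine setLIntegral_lt_top_of_relLeft hD (cancel (mE hD) (lt_of_le_of_lt ?_ hfin))
    refine lintegral_mono fun x => ?_
    split_ifs with hx
    · have hx' : c < x := hx
      simp only [segLen, segPos, if_pos hx']
      gcongr
      exact ENNReal.ofReal_le_ofReal (Real.rpow_le_rpow (by norm_num) hx.le (by positivity))
    · simp
  have r2 : ∫⁻ r : I, (if (1 / 2 : ℝ) < r then D' r else 0) < ∞ := by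
    refine setLIntegral_lt_top_of_relLeft hD' (cancel (mE hD') (lt_of_le_of_lt ?_ hfin))
    have m : Measurable fun x : I => ENNReal.ofReal (segLen x c ^ (2 * bexp)) * D (segPos x c) :=
      measurable_avgSplit_fix hD c
    rw [avgSplit, ← unitInterval.measurePreserving_symm.lintegral_comp m]
    refine lintegral_mono fun x => ?_
    split_ifs with hx
    · have hx' : unitInterval.symm x ≤ c := by
        change 1 - (x : ℝ) ≤ 1 / 2
        linarith
      have hx1 : unitInterval.symm x ≠ 1 := fun h1 => by
        have := congrArg Subtype.val h1
        rw [unitInterval.coe_symm_eq] at this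
        simp at this
        rw [this] at hx
        norm_num at hx
      have hcs : unitInterval.symm c = c := by
        ext; rw [unitInterval.coe_symm_eq, hc, coe_half]; norm_num
      simp only [segLen, segPos, if_neg (not_lt.2 hx')]
      rw [relRight_eq_symm hx1 hx', unitInterval.symm_symm, hcs]
      gcongr
      refine ENNReal.ofReal_le_ofReal (Real.rpow_le_rpow (by norm_num) ?_ (by positivity))
      rw [unitInterval.coe_symm_eq]
      linarith
    · simp
  have hm : ∀ {D : I → ℝ≥0∞}, Measurable D →
      Measurable fun x : I => if (1 / 2 : ℝ) < x then D x else 0 := fun hD =>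
    Measurable.ite (measurableSet_lt measurable_const measurable_subtype_coe) hD measurable_const
  rw [← unitInterval.measurePreserving_symm.lintegral_comp (hm hD')] at r2
  calc ∫⁻ s, D s ≤ ∫⁻ s : I, ((if (1 / 2 : ℝ) < s then D s else 0)
        + if (1 / 2 : ℝ) < unitInterval.symm s then D' (unitInterval.symm s) else 0) := by
        refine lintegral_mono_ae ?_
        filter_upwards [ae_ne_unitInterval c] with s hs
        rcases lt_trichotomy (s : ℝ) (1 / 2) with h1 | h1 | h1
        · have : (1 / 2 : ℝ) < unitInterval.symm s := by
            rw [unitInterval.coe_symm_eq]; linarith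
          rw [if_pos this]
          simp [D']
        · exact absurd (Subtype.ext h1) hs
        · rw [if_pos h1]; exact le_add_right le_rfl
    _ < ∞ := by
        rw [lintegral_add_left (hm hD)]
        exact ENNReal.add_lt_top.2 ⟨r1, r2⟩

lemma enorm_rpow_bexp_sq {a : ℝ} (ha : 0 ≤ a) :
    ‖a ^ bexp‖ₑ ^ 2 = ENNReal.ofReal (a ^ (2 * bexp)) := by
  rw [Real.enorm_of_nonneg (Real.rpow_nonneg ha _), ← ENNReal.ofReal_pow (Real.rpow_nonneg ha _),
    sq_rpow_bexp ha]

lemma measurable_kernel_left {D : I → ℝ≥0∞} (hD : Measurable D) (s : I) : Measurable fun q : I × I =>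
    ‖(segLen q.1 s * q.2) ^ bexp‖ₑ ^ 2 * D (segPos q.1 s) := by
  have m1 : Measurable fun q : I × I => segLen q.1 s := (measurable_fix_segLen s).comp measurable_fst
  have m2 : Measurable fun q : I × I => segPos q.1 s := (measurable_fix_segPos s).comp measurable_fst
  exact (((m1.mul (by fun_prop)).pow_const _).enorm.pow_const 2).mul (hD.comp m2)

lemma measurable_kernel_right {D : I → ℝ≥0∞} (hD : Measurable D) (s : I) :
    Measurable fun q : I × I =>
      ‖(segLen q.1 s * (1 - q.2)) ^ bexp‖ₑ ^ 2 * D (segPos q.1 s) := by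
  have m1 : Measurable fun q : I × I => segLen q.1 s := (measurable_fix_segLen s).comp measurable_fst
  have m2 : Measurable fun q : I × I => segPos q.1 s := (measurable_fix_segPos s).comp measurable_fst
  exact (((m1.mul (by fun_prop)).pow_const _).enorm.pow_const 2).mul (hD.comp m2)

lemma lintegral_kernel_left {D : I → ℝ≥0∞} (hD : Measurable D) (s : I) :
    ∫⁻ q : I × I, ‖(segLen q.1 s * q.2) ^ bexp‖ₑ ^ 2 * D (segPos q.1 s)
      = ENNReal.ofReal (1 / (2 * bexp + 1)) * avgSplit D s := by
  have hb := bexp_pos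
  have e : ∀ q : I × I, ‖(segLen q.1 s * q.2) ^ bexp‖ₑ ^ 2 * D (segPos q.1 s)
      = (ENNReal.ofReal (segLen q.1 s ^ (2 * bexp)) * D (segPos q.1 s))
        * ENNReal.ofReal ((q.2 : ℝ) ^ (2 * bexp)) := fun q => by
    have hL := segLen_nonneg q.1 s
    rw [enorm_rpow_bexp_sq (mul_nonneg hL q.2.2.1), Real.mul_rpow hL q.2.2.1,
      ENNReal.ofReal_mul (Real.rpow_nonneg hL _)]
    ring
  have m : Measurable fun x : I => ENNReal.ofReal (segLen x s ^ (2 * bexp)) * D (segPos x s) :=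
    measurable_avgSplit_fix hD s
  have m2 : Measurable fun y : I => ENNReal.ofReal ((y : ℝ) ^ (2 * bexp)) := by fun_prop
  have := lintegral_prod_mul (μ := (volume : Measure I)) (ν := (volume : Measure I))
    m.aemeasurable m2.aemeasurable
  rw [lintegral_ofReal_rpow (by positivity)] at this
  rw [lintegral_congr e, Measure.volume_eq_prod, this, mul_comm, avgSplit]

lemma lintegral_kernel_right {D : I → ℝ≥0∞} (hD : Measurable D) (s : I) :
    ∫⁻ q : I × I, ‖(segLen q.1 s * (1 - q.2)) ^ bexp‖ₑ ^ 2 * D (segPos q.1 s)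
      = ENNReal.ofReal (1 / (2 * bexp + 1)) * avgSplit D s := by
  rw [← lintegral_kernel_left hD s]
  have mp : MeasurePreserving (fun q : I × I => (q.1, unitInterval.symm q.2)) volume volume :=
    (MeasurePreserving.id volume).prod unitInterval.measurePreserving_symm
  exact mp.lintegral_comp (measurable_kernel_left hD s)

/-! ### Uniqueness by coupling -/

lemma enorm_sq_eq (x : ℝ) : ‖x‖ₑ ^ 2 = ENNReal.ofReal (x ^ 2) := by
  rw [Real.enorm_eq_ofReal_abs, ← ENNReal.ofReal_pow (abs_nonneg x), sq_abs]

section Pi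

variable {Ω : Type*} [MeasurableSpace Ω] {P : Measure Ω}

lemma lintegral_enorm_sq {g : Ω → ℝ} (hg : MemLp g 2 P) :
    ∫⁻ ω, ‖g ω‖ₑ ^ 2 ∂P = ENNReal.ofReal (∫ ω, g ω ^ 2 ∂P) := by
  rw [ofReal_integral_eq_lintegral_ofReal hg.integrable_sq (ae_of_all _ fun _ => sq_nonneg _)]
  exact lintegral_congr fun ω => enorm_sq_eq _

/-- Second moment of a sum over independent copies: variances add up, and so do means. -/
lemma lintegral_enorm_sum_pi_sq [IsProbabilityMeasure P] {k : ℕ} {X : Fin k → Ω → ℝ}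
    (hX : ∀ i, MemLp (X i) 2 P) :
    ∫⁻ ω, ‖∑ i, X i (ω i)‖ₑ ^ 2 ∂(Measure.pi fun _ => P)
      = ∑ i, ∫⁻ ω, ‖X i ω - ∫ ω', X i ω' ∂P‖ₑ ^ 2 ∂P + ‖∑ i, ∫ ω, X i ω ∂P‖ₑ ^ 2 := by
  rw [lintegral_enorm_sq (memLp_sum_pi hX), integral_sum_pi_sq hX,
    ENNReal.ofReal_add (Finset.sum_nonneg fun i _ => variance_nonneg _ _) (sq_nonneg _),
    ENNReal.ofReal_sum_of_nonneg (fun i _ => variance_nonneg _ _), ← enorm_sq_eq]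
  congr 1
  exact Finset.sum_congr rfl fun i _ => (hX i).ofReal_variance_eq

end Pi

/-- A random linear recombination of four functions, driven by three uniform variables, whose
squared coefficients average to a multiple of `avgSplit`. Both right-hand sides of the recursions
are of this form. -/
structure IsTreeOp (op : I × I × I → (Fin 4 → I → ℝ) → I → ℝ) (c : Fin 4 → I × I × I → I → ℝ)
    (r : Fin 4 → I × I × I → I → I) : Prop where
  apply : ∀ θ f s, op θ f s = ∑ i, c i θ s * f i (r i θ s)
  measurable_coeff : ∀ i s, Measurable fun θ => c i θ s
  measurable_pos : ∀ i s, Measurable fun θ => r i θ s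
  continuous : ∀ θ f, (∀ i, Continuous (f i)) → (∀ i, f i 0 = 0) → (∀ i, f i 1 = 0) →
    Continuous (op θ f)
  lintegral : ∀ D : I → ℝ≥0∞, Measurable D → ∀ s,
    ∫⁻ θ, ∑ i, ‖c i θ s‖ₑ ^ 2 * D (r i θ s) = ENNReal.ofReal (2 / (2 * bexp + 1)) * avgSplit D s

/-- A law on `C[0,1]` with mean function `h` and finite second moments that is invariant under the
random operator `op`. -/
structure IsTreeLaw (op : I × I × I → (Fin 4 → I → ℝ) → I → ℝ) (μ : Measure C(I, ℝ)) : Prop where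
  memLp : ∀ s : I, MemLp (fun f : C(I, ℝ) => f s) 2 μ
  mean : ∀ s : I, ∫ f, f s ∂μ = h s
  invariant : μ.map (fun f : C(I, ℝ) => (f : I → ℝ))
    = ((volume : Measure (I × I × I)).prod (Measure.pi fun _ => μ)).map
      (fun q => op q.1 (fun i => (q.2 i : I → ℝ)))

/-- The variance of the value at `s` about `h s`. -/
noncomputable def varAt (μ : Measure C(I, ℝ)) (s : I) : ℝ≥0∞ := ∫⁻ f, ‖f s - h s‖ₑ ^ 2 ∂μ

lemma measurable_varAt (μ : Measure C(I, ℝ)) [SFinite μ] : Measurable (varAt μ) := by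
  have : Measurable fun q : C(I, ℝ) × I => ‖q.1 q.2 - h q.2‖ₑ ^ 2 :=
    ((measurable_evalPair.sub (continuous_h.measurable.comp measurable_snd)).enorm).pow_const 2
  exact this.lintegral_prod_left'

/-- The piece containing an endpoint of `[0, 1]` has it as the same endpoint. -/
lemma avgSplit_endpoint {D : I → ℝ≥0∞} {e : I} (he : e = 0 ∨ e = 1) :
    avgSplit D e = ENNReal.ofReal (1 / (2 * bexp + 1)) * D e := by
  have hb := bexp_pos
  rcases he with rfl | rfl
  · have key : avgSplit D 0 = ∫⁻ x : I, ENNReal.ofReal ((x : ℝ) ^ (2 * bexp)) * D 0 := by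
      refine lintegral_congr_ae ?_
      filter_upwards [ae_ne_unitInterval 0] with x hx
      have : (0 : I) < x := lt_of_le_of_ne bot_le hx.symm
      simp [segLen, segPos, this, relLeft]
    rw [key, lintegral_mul_const _ (by fun_prop), lintegral_ofReal_rpow (by positivity)]
  · have key : avgSplit D 1 = ∫⁻ x : I, ENNReal.ofReal ((1 - x : ℝ) ^ (2 * bexp)) * D 1 := by
      refine lintegral_congr_ae ?_
      filter_upwards [ae_ne_unitInterval 1] with x hx
      have h1 : ¬ (1 : I) < x := not_lt.2 le_top
      have h2 : (1 : ℝ) - x ≠ 0 := fun h0 => hx (Subtype.ext (by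
        rw [Set.Icc.coe_one]; linarith))
      have h3 : relRight x 1 = 1 := by
        ext
        rw [coe_relRight (show x ≤ 1 from le_top), Set.Icc.coe_one, div_self h2]
      simp [segLen, segPos, h1, h3]
    rw [key, lintegral_mul_const _ (by fun_prop), lintegral_ofReal_one_sub_rpow (by positivity)]

lemma measurable_sub_eval : Measurable fun q : (C(I, ℝ) × C(I, ℝ)) × I => q.1.1 q.2 - q.1.2 q.2 :=
  (measurable_evalPair.comp (by fun_prop : Measurable fun q : (C(I, ℝ) × C(I, ℝ)) × I =>
    (q.1.1, q.2))).sub (measurable_evalPair.comp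
    (by fun_prop : Measurable fun q : (C(I, ℝ) × C(I, ℝ)) × I => (q.1.2, q.2)))

/-- The mean squared distance at `s` of the two components of a random pair of functions. -/
noncomputable def distAt (ρ : Measure (C(I, ℝ) × C(I, ℝ))) (s : I) : ℝ≥0∞ :=
  ∫⁻ p, ‖p.1 s - p.2 s‖ₑ ^ 2 ∂ρ

lemma measurable_distAt (ρ : Measure (C(I, ℝ) × C(I, ℝ))) [SFinite ρ] : Measurable (distAt ρ) := by
  have : Measurable fun q : (C(I, ℝ) × C(I, ℝ)) × I => ‖q.1.1 q.2 - q.1.2 q.2‖ₑ ^ 2 :=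
    measurable_sub_eval.enorm.pow_const 2
  exact this.lintegral_prod_left'

lemma lintegral_le_distAt_rpow {ρ : Measure (C(I, ℝ) × C(I, ℝ))} [IsProbabilityMeasure ρ] (s : I) :
    ∫⁻ p, ‖p.1 s - p.2 s‖ₑ ∂ρ ≤ distAt ρ s ^ (1 / 2 : ℝ) := by
  have m : Measurable fun p : C(I, ℝ) × C(I, ℝ) => p.1 s - p.2 s :=
    measurable_sub_eval.comp (measurable_id.prodMk measurable_const)
  have := eLpNorm_le_eLpNorm_of_exponent_le (μ := ρ) (p := 1) (q := 2) (by norm_num)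
    m.aestronglyMeasurable
  rw [eLpNorm_one_eq_lintegral_enorm,
    eLpNorm_eq_lintegral_rpow_enorm_toReal (by norm_num) (by norm_num)] at this
  simpa [distAt] using this

lemma distAt_prod_le {μ ν : Measure C(I, ℝ)} [IsProbabilityMeasure μ] [IsProbabilityMeasure ν]
    (s : I) : distAt (μ.prod ν) s ≤ 2 * (varAt μ s + varAt ν s) := by
  have mE : Measurable fun f : C(I, ℝ) => ‖f s - h s‖ₑ ^ 2 :=
    (((continuous_eval_const s).measurable).sub measurable_const).enorm.pow_const 2
  have e1 : varAt μ s = ∫⁻ p, ‖p.1 s - h s‖ₑ ^ 2 ∂(μ.prod ν) :=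
    ((measurePreserving_fst (μ := μ) (ν := ν)).lintegral_comp mE).symm
  have e2 : varAt ν s = ∫⁻ p, ‖p.2 s - h s‖ₑ ^ 2 ∂(μ.prod ν) :=
    ((measurePreserving_snd (μ := μ) (ν := ν)).lintegral_comp mE).symm
  have m1 : Measurable fun p : C(I, ℝ) × C(I, ℝ) => ‖p.1 s - h s‖ₑ ^ 2 := mE.comp measurable_fst
  have m2 : Measurable fun p : C(I, ℝ) × C(I, ℝ) => ‖p.2 s - h s‖ₑ ^ 2 := mE.comp measurable_snd
  rw [e1, e2, ← lintegral_add_left m1, ← lintegral_const_mul _ (Measurable.fun_add m1 m2)]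
  refine lintegral_mono fun p => ?_
  simp only [enorm_sq_eq]
  rw [← ENNReal.ofReal_add (sq_nonneg _) (sq_nonneg _), show (2 : ℝ≥0∞) = ENNReal.ofReal 2 by simp,
    ← ENNReal.ofReal_mul (by norm_num)]
  refine ENNReal.ofReal_le_ofReal ?_
  nlinarith [sq_nonneg (p.1 s - h s + (p.2 s - h s))]

lemma ae_prod_pi {Θ Ω : Type*} [MeasurableSpace Θ] [MeasurableSpace Ω] {τ : Measure Θ}
    [SFinite τ] {P : Measure Ω} [IsProbabilityMeasure P] {k : ℕ} {p : Ω → Prop}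
    (hp : ∀ᵐ ω ∂P, p ω) : ∀ᵐ q ∂(τ.prod (Measure.pi fun _ : Fin k => P)), ∀ i, p (q.2 i) := by
  rw [ae_all_iff]
  intro i
  exact Measure.quasiMeasurePreserving_snd.ae
    ((measurePreserving_eval (fun _ : Fin k => P) i).quasiMeasurePreserving.ae hp)

lemma dense_of_ae_unitInterval {p : I → Prop} (hp : ∀ᵐ s : I, p s) : Dense {s | p s} := by
  have : (volume : Measure I).IsOpenPosMeasure := by
    refine ⟨fun U hU hne h0 => ?_⟩
    obtain ⟨a, b, hab, hsub⟩ := hU.exists_Ioo_subset hne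
    have h1 := measure_mono_null hsub h0
    rw [unitInterval.volume_Ioo, ENNReal.ofReal_eq_zero] at h1
    have h2 : (a : ℝ) < b := hab
    linarith
  exact Measure.dense_of_ae hp

namespace IsTreeOp

variable {op : I × I × I → (Fin 4 → I → ℝ) → I → ℝ} {c : Fin 4 → I × I × I → I → ℝ}
  {r : Fin 4 → I × I × I → I → I}

lemma measurable_apply (hop : IsTreeOp op c r) {Ω E : Type*} [MeasurableSpace Ω]
    [MeasurableSpace E] {X : E → I → ℝ} (hX : Measurable (Function.uncurry X)) {θ : Ω → I × I × I}
    (hθ : Measurable θ) {Y : Ω → Fin 4 → E} (hY : ∀ i, Measurable fun ω => Y ω i) (s : I) :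
    Measurable fun ω => op (θ ω) (fun i => X (Y ω i)) s := by
  simp_rw [hop.apply]
  refine Finset.measurable_sum _ fun i _ => ?_
  have h1 : Measurable fun ω => c i (θ ω) s := (hop.measurable_coeff i s).comp hθ
  have h2 : Measurable fun ω => r i (θ ω) s := (hop.measurable_pos i s).comp hθ
  exact h1.mul (hX.comp ((hY i).prodMk h2))

/-- Second moments after recombination: independence makes variances add up. -/
lemma lintegral_sq (hop : IsTreeOp op c r) {E : Type*} [MeasurableSpace E] {P : Measure E}
    [IsProbabilityMeasure P] {X : E → I → ℝ} (hX : Measurable (Function.uncurry X))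
    (hX2 : ∀ s, MemLp (fun ω => X ω s) 2 P) {m : I → ℝ} (hm : Measurable m)
    (hmean : ∀ s, ∫ ω, X ω s ∂P = m s) (s : I) :
    ∫⁻ q, ‖op q.1 (fun i => X (q.2 i)) s‖ₑ ^ 2
        ∂((volume : Measure (I × I × I)).prod (Measure.pi fun _ => P))
      = ENNReal.ofReal (2 / (2 * bexp + 1))
          * avgSplit (fun t => ∫⁻ ω, ‖X ω t - m t‖ₑ ^ 2 ∂P) s
        + ∫⁻ θ, ‖op θ (fun _ => m) s‖ₑ ^ 2 := by
  have hmeas : Measurable fun q : (I × I × I) × (Fin 4 → E) =>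
      ‖op q.1 (fun i => X (q.2 i)) s‖ₑ ^ 2 :=
    (hop.measurable_apply hX measurable_fst (fun i => by fun_prop) s).enorm.pow_const 2
  have hD : Measurable fun t => ∫⁻ ω, ‖X ω t - m t‖ₑ ^ 2 ∂P := by
    have : Measurable fun q : E × I => ‖X q.1 q.2 - m q.2‖ₑ ^ 2 :=
      (hX.sub (hm.comp measurable_snd)).enorm.pow_const 2
    exact this.lintegral_prod_left'
  rw [lintegral_prod _ hmeas.aemeasurable, ← hop.lintegral _ hD, ← lintegral_add_left]
  · refine lintegral_congr fun θ => ?_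
    have hXi : ∀ i, MemLp (fun ω => c i θ s * X ω (r i θ s)) 2 P := fun i => (hX2 _).const_mul _
    have := lintegral_enorm_sum_pi_sq hXi
    simp_rw [integral_const_mul, hmean] at this
    simp_rw [hop.apply, this]
    congr 1
    refine Finset.sum_congr rfl fun i _ => ?_
    have hd : Measurable fun ω => ‖X ω (r i θ s) - m (r i θ s)‖ₑ ^ 2 :=
      (((hX.comp (measurable_id.prodMk measurable_const)).sub measurable_const).enorm).pow_const 2
    rw [← lintegral_const_mul _ hd]
    refine lintegral_congr fun ω => ?_
    rw [← mul_sub, enorm_mul, mul_pow]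
  · exact Finset.measurable_sum _ fun i _ => ((hop.measurable_coeff i s).enorm.pow_const 2).mul
      (hD.comp (hop.measurable_pos i s))

variable {μ ν : Measure C(I, ℝ)} [IsProbabilityMeasure μ] [IsProbabilityMeasure ν]

lemma measurable_eval_apply (hop : IsTreeOp op c r) (s : I) :
    Measurable fun q : (I × I × I) × (Fin 4 → C(I, ℝ)) => op q.1 (fun i => (q.2 i : I → ℝ)) s :=
  hop.measurable_apply (X := fun f : C(I, ℝ) => (f : I → ℝ)) measurable_evalPair measurable_fst
    (fun i => by fun_prop) s

/-- The recursion for the second moment at `s` of an invariant law. -/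
lemma sq_eq (hop : IsTreeOp op c r) (hμ : IsTreeLaw op μ) (s : I) :
    ∫⁻ f, ‖f s‖ₑ ^ 2 ∂μ = ENNReal.ofReal (2 / (2 * bexp + 1)) * avgSplit (varAt μ) s
      + ∫⁻ θ, ‖op θ (fun _ => h) s‖ₑ ^ 2 := by
  have m1 : Measurable fun g : I → ℝ => ‖g s‖ₑ ^ 2 := (measurable_pi_apply s).enorm.pow_const 2
  have m2 : Measurable fun q : (I × I × I) × (Fin 4 → C(I, ℝ)) =>
      op q.1 (fun i => (q.2 i : I → ℝ)) := measurable_pi_iff.2 hop.measurable_eval_apply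
  have e := hop.lintegral_sq (P := μ) (X := fun f : C(I, ℝ) => (f : I → ℝ)) measurable_evalPair
    hμ.memLp continuous_h.measurable hμ.mean s
  refine Eq.trans ?_ e
  rw [← lintegral_map m1 measurable_coeFn, hμ.invariant, lintegral_map m1 m2]

/-- The variance of an invariant law is integrable in the location, although no bound uniform in
the location is assumed. -/
lemma lintegral_varAt_lt_top (hop : IsTreeOp op c r) (hμ : IsTreeLaw op μ) :
    ∫⁻ s, varAt μ s < ∞ := by
  have hb := bexp_pos
  refine lintegral_lt_top_of_avgSplit (measurable_varAt μ) ?_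
  have h1 : ∫⁻ f, ‖f half‖ₑ ^ 2 ∂μ < ∞ := by
    rw [lintegral_enorm_sq (hμ.memLp half)]; exact ENNReal.ofReal_lt_top
  rw [hop.sq_eq hμ] at h1
  have h2 := (ENNReal.add_lt_top.1 h1).1
  refine ENNReal.lt_top_of_mul_ne_top_right h2.ne ?_
  rw [ne_eq, ENNReal.ofReal_eq_zero, not_le]
  positivity

/-- At the endpoints the recursion contracts second moments, hence the process vanishes there. -/
lemma ae_endpoint (hop : IsTreeOp op c r) (hμ : IsTreeLaw op μ) {e : I} (he : e = 0 ∨ e = 1) :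
    ∀ᵐ f ∂μ, f e = 0 := by
  have hb := bexp_pos
  have hb2 := half_lt_bexp
  have hhe : h e = 0 := by rcases he with rfl | rfl <;> simp [h_zero, h_one]
  -- `h` vanishes at the endpoints, hence so does the image of `h`, almost surely
  have hz : ∫⁻ θ, ‖op θ (fun _ => h) e‖ₑ ^ 2 = 0 := by
    have hk := hop.lintegral (fun s => ‖h s‖ₑ ^ 2) (continuous_h.measurable.enorm.pow_const 2) e
    rw [avgSplit_endpoint he, hhe, enorm_zero, zero_pow two_ne_zero, mul_zero, mul_zero,
      lintegral_eq_zero_iff] at hk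
    · rw [lintegral_congr_ae (g := fun _ => 0), lintegral_zero]
      filter_upwards [hk] with θ hθ
      have hθ' := Finset.sum_eq_zero_iff.1 hθ
      rw [hop.apply, Finset.sum_eq_zero, enorm_zero, zero_pow two_ne_zero]
      intro i hi
      simpa using hθ' i hi
    · exact Finset.measurable_sum _ fun i _ => ((hop.measurable_coeff i e).enorm.pow_const 2).mul
        ((continuous_h.measurable.enorm.pow_const 2).comp (hop.measurable_pos i e))
  have hv : varAt μ e = ∫⁻ f, ‖f e‖ₑ ^ 2 ∂μ := by simp [varAt, hhe]
  have hfin : ∫⁻ f, ‖f e‖ₑ ^ 2 ∂μ ≠ ∞ := by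
    rw [lintegral_enorm_sq (hμ.memLp e)]; exact ENNReal.ofReal_ne_top
  have key := hop.sq_eq hμ e
  rw [avgSplit_endpoint he, hz, add_zero, hv, ← mul_assoc,
    ← ENNReal.ofReal_mul (by positivity)] at key
  have h0 : ∫⁻ f, ‖f e‖ₑ ^ 2 ∂μ = 0 := by
    by_contra hne
    have hlt : ENNReal.ofReal (2 / (2 * bexp + 1) * (1 / (2 * bexp + 1))) < 1 := by
      rw [← ENNReal.ofReal_one, ENNReal.ofReal_lt_ofReal_iff one_pos, div_mul_div_comm,
        div_lt_one (by positivity)]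
      nlinarith
    have := ENNReal.mul_lt_mul_left hne hfin hlt
    rw [one_mul, ← key] at this
    exact lt_irrefl _ this
  have hm : Measurable fun f : C(I, ℝ) => ‖f e‖ₑ ^ 2 :=
    ((continuous_eval_const e).measurable.enorm).pow_const 2
  filter_upwards [(lintegral_eq_zero_iff hm).1 h0] with f hf
  simpa using hf

/-- The random operator as a map on `C[0,1]`, set to `0` off the event that its arguments vanish at
the endpoints, where continuity could fail. -/
noncomputable def onC (hop : IsTreeOp op c r) (q : (I × I × I) × (Fin 4 → C(I, ℝ))) : C(I, ℝ) :=
  open Classical in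
  if hq : ∀ i, q.2 i 0 = 0 ∧ q.2 i 1 = 0 then
    ⟨op q.1 fun i => q.2 i, hop.continuous _ _ (fun i => (q.2 i).continuous)
      (fun i => (hq i).1) fun i => (hq i).2⟩
  else 0

lemma onC_apply (hop : IsTreeOp op c r) {q : (I × I × I) × (Fin 4 → C(I, ℝ))}
    (hq : ∀ i, q.2 i 0 = 0 ∧ q.2 i 1 = 0) (s : I) :
    hop.onC q s = op q.1 (fun i => (q.2 i : I → ℝ)) s := by
  simp [onC, hq]

lemma measurable_onC (hop : IsTreeOp op c r) : Measurable hop.onC := by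
  classical
  refine measurable_of_eval fun s => ?_
  have hE : ∀ e : I, Measurable fun f : C(I, ℝ) => f e := fun e =>
    (continuous_eval_const e).measurable
  have hs : MeasurableSet {q : (I × I × I) × (Fin 4 → C(I, ℝ)) |
      ∀ i, q.2 i 0 = 0 ∧ q.2 i 1 = 0} := by
    simp only [Set.ofPred_forall]
    refine MeasurableSet.iInter fun i => MeasurableSet.inter ?_ ?_
    · exact measurableSet_eq_fun ((hE 0).comp (by fun_prop)) measurable_const
    · exact measurableSet_eq_fun ((hE 1).comp (by fun_prop)) measurable_const
  have e : (fun q => hop.onC q s) = Set.indicator {q | ∀ i, q.2 i 0 = 0 ∧ q.2 i 1 = 0}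
      (fun q => op q.1 (fun i => (q.2 i : I → ℝ)) s) := by
    funext q
    by_cases hq : ∀ i, q.2 i 0 = 0 ∧ q.2 i 1 = 0
    · rw [Set.indicator_of_mem (by exact hq), hop.onC_apply hq]
    · rw [Set.indicator_of_notMem (by exact hq), onC, dif_neg hq]; rfl
  rw [e]
  exact (hop.measurable_eval_apply s).indicator hs

lemma ae_endpoints (hop : IsTreeOp op c r) (hμ : IsTreeLaw op μ) :
    ∀ᵐ f ∂μ, f 0 = 0 ∧ f 1 = 0 := by
  filter_upwards [hop.ae_endpoint hμ (Or.inl rfl), hop.ae_endpoint hμ (Or.inr rfl)] with f h0 h1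
  exact ⟨h0, h1⟩

lemma map_onC (hop : IsTreeOp op c r) (hμ : IsTreeLaw op μ) :
    ((volume : Measure (I × I × I)).prod (Measure.pi fun _ => μ)).map hop.onC = μ := by
  refine ext_of_map_coeFn ?_
  rw [Measure.map_map measurable_coeFn hop.measurable_onC, hμ.invariant]
  refine Measure.map_congr ?_
  filter_upwards [ae_prod_pi (hop.ae_endpoints hμ)] with q hq
  exact funext fun s => hop.onC_apply hq s

/-- One step of the coupling: both components are recombined with the same uniform variables. -/
noncomputable def couple (hop : IsTreeOp op c r) (ρ : Measure (C(I, ℝ) × C(I, ℝ))) :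
    Measure (C(I, ℝ) × C(I, ℝ)) :=
  ((volume : Measure (I × I × I)).prod (Measure.pi fun _ => ρ)).map
    (fun q => (hop.onC (q.1, fun i => (q.2 i).1), hop.onC (q.1, fun i => (q.2 i).2)))

lemma measurable_couple (hop : IsTreeOp op c r) :
    Measurable fun q : (I × I × I) × (Fin 4 → C(I, ℝ) × C(I, ℝ)) =>
      (hop.onC (q.1, fun i => (q.2 i).1), hop.onC (q.1, fun i => (q.2 i).2)) := by
  have h1 : Measurable fun q : (I × I × I) × (Fin 4 → C(I, ℝ) × C(I, ℝ)) =>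
      (q.1, fun i => (q.2 i).1) := by fun_prop
  have h2 : Measurable fun q : (I × I × I) × (Fin 4 → C(I, ℝ) × C(I, ℝ)) =>
      (q.1, fun i => (q.2 i).2) := by fun_prop
  exact (hop.measurable_onC.comp h1).prodMk (hop.measurable_onC.comp h2)

variable {ρ : Measure (C(I, ℝ) × C(I, ℝ))} [IsProbabilityMeasure ρ]

lemma isProbabilityMeasure_couple (hop : IsTreeOp op c r) :
    IsProbabilityMeasure (hop.couple ρ) :=
  Measure.isProbabilityMeasure_map hop.measurable_couple.aemeasurable

lemma map_fst_couple (hop : IsTreeOp op c r) (hμ : IsTreeLaw op μ) (h1 : ρ.map Prod.fst = μ) :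
    (hop.couple ρ).map Prod.fst = μ := by
  rw [couple, Measure.map_map measurable_fst hop.measurable_couple]
  have := map_prod_pi_comp (τ := (volume : Measure (I × I × I))) (P := ρ) (k := 4) measurable_fst
    hop.measurable_onC
  rw [h1, hop.map_onC hμ] at this
  exact this

lemma map_snd_couple (hop : IsTreeOp op c r) (hν : IsTreeLaw op ν) (h2 : ρ.map Prod.snd = ν) :
    (hop.couple ρ).map Prod.snd = ν := by
  rw [couple, Measure.map_map measurable_snd hop.measurable_couple]
  have := map_prod_pi_comp (τ := (volume : Measure (I × I × I))) (P := ρ) (k := 4) measurable_snd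
    hop.measurable_onC
  rw [h2, hop.map_onC hν] at this
  exact this

/-- The mean function of the difference being zero, the coupling contracts the mean squared
distance through `avgSplit`. -/
lemma distAt_couple (hop : IsTreeOp op c r) (hμ : IsTreeLaw op μ) (hν : IsTreeLaw op ν)
    (h1 : ρ.map Prod.fst = μ) (h2 : ρ.map Prod.snd = ν) (s : I) :
    distAt (hop.couple ρ) s = ENNReal.ofReal (2 / (2 * bexp + 1)) * avgSplit (distAt ρ) s := by
  have mp1 : MeasurePreserving Prod.fst ρ μ := ⟨measurable_fst, h1⟩
  have mp2 : MeasurePreserving Prod.snd ρ ν := ⟨measurable_snd, h2⟩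
  have L1 : ∀ s : I, MemLp (fun p : C(I, ℝ) × C(I, ℝ) => p.1 s) 2 ρ := fun s =>
    (hμ.memLp s).comp_measurePreserving mp1
  have L2 : ∀ s : I, MemLp (fun p : C(I, ℝ) × C(I, ℝ) => p.2 s) 2 ρ := fun s =>
    (hν.memLp s).comp_measurePreserving mp2
  have hX : Measurable (Function.uncurry fun (p : C(I, ℝ) × C(I, ℝ)) (s : I) => p.1 s - p.2 s) :=
    measurable_sub_eval
  have i1 : ∀ s : I, ∫ p, p.1 s ∂ρ = h s := fun s => by
    rw [← hμ.mean s, ← h1, integral_map measurable_fst.aemeasurable]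
    exact (continuous_eval_const s).measurable.aestronglyMeasurable
  have i2 : ∀ s : I, ∫ p, p.2 s ∂ρ = h s := fun s => by
    rw [← hν.mean s, ← h2, integral_map measurable_snd.aemeasurable]
    exact (continuous_eval_const s).measurable.aestronglyMeasurable
  have hmean : ∀ s : I, ∫ p, (p.1 s - p.2 s) ∂ρ = (fun _ : I => (0 : ℝ)) s := fun s => by
    rw [integral_sub ((L1 s).integrable (by norm_num)) ((L2 s).integrable (by norm_num)), i1, i2,
      sub_self]
  have e := hop.lintegral_sq hX (fun s => (L1 s).sub (L2 s)) measurable_const hmean s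
  simp only [sub_zero] at e
  have hz : ∀ θ, op θ (fun _ _ => (0 : ℝ)) s = 0 := fun θ => by rw [hop.apply]; simp
  simp only [hz, enorm_zero, ne_eq, OfNat.ofNat_ne_zero, not_false_eq_true, zero_pow,
    lintegral_zero, add_zero] at e
  have m : Measurable fun p : C(I, ℝ) × C(I, ℝ) => ‖p.1 s - p.2 s‖ₑ ^ 2 :=
    (((continuous_eval_const s).measurable.comp measurable_fst).sub
      ((continuous_eval_const s).measurable.comp measurable_snd)).enorm.pow_const 2
  have a1 : ∀ᵐ p ∂ρ, p.1 0 = 0 ∧ p.1 1 = 0 := mp1.quasiMeasurePreserving.ae (hop.ae_endpoints hμ)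
  have a2 : ∀ᵐ p ∂ρ, p.2 0 = 0 ∧ p.2 1 = 0 := mp2.quasiMeasurePreserving.ae (hop.ae_endpoints hν)
  rw [distAt, couple, lintegral_map m hop.measurable_couple]
  refine Eq.trans (lintegral_congr_ae ?_) e
  filter_upwards [ae_prod_pi a1, ae_prod_pi a2] with q hq1 hq2
  rw [hop.onC_apply hq1, hop.onC_apply hq2, hop.apply, hop.apply, hop.apply,
    ← Finset.sum_sub_distrib]
  simp only [mul_sub]

/-- Invariant laws are unique: iterating the coupling from the independent one, the mean squared
distance, integrated over the location, decays geometrically. -/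
theorem unique (hop : IsTreeOp op c r) (hμ : IsTreeLaw op μ) (hν : IsTreeLaw op ν) : μ = ν := by
  set ρ : ℕ → Measure (C(I, ℝ) × C(I, ℝ)) := fun n => hop.couple^[n] (μ.prod ν)
  have hsucc : ∀ n, ρ (n + 1) = hop.couple (ρ n) := fun n =>
    Function.iterate_succ_apply' _ _ _
  have hρ : ∀ n, IsProbabilityMeasure (ρ n) ∧ (ρ n).map Prod.fst = μ ∧ (ρ n).map Prod.snd = ν := by
    intro n
    induction n with
    | zero => exact ⟨inferInstanceAs (IsProbabilityMeasure (μ.prod ν)),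
        (measurePreserving_fst (μ := μ) (ν := ν)).map_eq,
        (measurePreserving_snd (μ := μ) (ν := ν)).map_eq⟩
    | succ n ih =>
      have := ih.1
      rw [hsucc]
      exact ⟨hop.isProbabilityMeasure_couple, hop.map_fst_couple hμ ih.2.1,
        hop.map_snd_couple hν ih.2.2⟩
  have hp : ∀ n, IsProbabilityMeasure (ρ n) := fun n => (hρ n).1
  have mD : ∀ n, Measurable (distAt (ρ n)) := fun n => measurable_distAt _
  have step : ∀ n, ∫⁻ s, distAt (ρ (n + 1)) s ≤ avgRate * ∫⁻ s, distAt (ρ n) s := by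
    intro n
    simp_rw [hsucc, hop.distAt_couple hμ hν (hρ n).2.1 (hρ n).2.2]
    exact lintegral_avgSplit_le (mD n)
  have geom : ∀ n, ∫⁻ s, distAt (ρ n) s ≤ avgRate ^ n * ∫⁻ s, distAt (ρ 0) s := by
    intro n
    induction n with
    | zero => simp
    | succ n ih =>
      refine (step n).trans ?_
      rw [pow_succ', mul_assoc]
      gcongr
  have init : ∫⁻ s, distAt (ρ 0) s < ∞ := by
    have hle : ∀ s, distAt (ρ 0) s ≤ 2 * (varAt μ s + varAt ν s) := distAt_prod_le
    refine (lintegral_mono hle).trans_lt ?_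
    rw [lintegral_const_mul _ ((measurable_varAt μ).fun_add (measurable_varAt ν)),
      lintegral_add_left (measurable_varAt μ)]
    exact ENNReal.mul_lt_top (by simp) (ENNReal.add_lt_top.2
      ⟨hop.lintegral_varAt_lt_top hμ, hop.lintegral_varAt_lt_top hν⟩)
  have hsum : ∫⁻ s, ∑' n, distAt (ρ n) s ≠ ∞ := by
    rw [lintegral_tsum fun n => (mD n).aemeasurable]
    refine ((ENNReal.tsum_le_tsum geom).trans_lt ?_).ne
    rw [ENNReal.tsum_mul_right, ENNReal.tsum_geometric]
    exact ENNReal.mul_lt_top (ENNReal.inv_lt_top.2 (tsub_pos_of_lt avgRate_lt_one)) init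
  have hae := ae_lt_top (Measurable.tsum mD) hsum
  refine eq_of_tendsto_coupling (fun n => (hρ n).2.1) (fun n => (hρ n).2.2)
    (dense_of_ae_unitInterval hae) fun s hs => ?_
  have hlim := ENNReal.tendsto_atTop_zero_of_tsum_ne_top (LT.lt.ne hs)
  have hsqrt : Tendsto (fun n => distAt (ρ n) s ^ (1 / 2 : ℝ)) atTop (𝓝 0) := by
    have := hlim.ennrpow_const (1 / 2 : ℝ)
    rwa [ENNReal.zero_rpow_of_pos (by norm_num)] at this
  refine tendsto_of_tendsto_of_tendsto_of_le_of_le tendsto_const_nhds hsqrt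
    (fun _ => zero_le) fun n => lintegral_le_distAt_rpow s

end IsTreeOp

/-! ### The two recursions -/

lemma ofReal_kernel_add :
    ENNReal.ofReal (1 / (2 * bexp + 1)) + ENNReal.ofReal (1 / (2 * bexp + 1))
      = ENNReal.ofReal (2 / (2 * bexp + 1)) := by
  have hb := bexp_pos
  rw [← ENNReal.ofReal_add (by positivity) (by positivity)]
  congr 1
  ring

/-- The coefficients of the four subprocesses in `parOp`. -/
noncomputable def parCoeff (i : Fin 4) (θ : I × I × I) (s : I) : ℝ :=
  if s < θ.1 then ![(segLen θ.1 s * θ.2.1) ^ bexp, (segLen θ.1 s * (1 - θ.2.1)) ^ bexp, 0, 0] i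
  else ![0, 0, (segLen θ.1 s * θ.2.2) ^ bexp, (segLen θ.1 s * (1 - θ.2.2)) ^ bexp] i

lemma isTreeOp_parOp : IsTreeOp (fun θ => parOp θ.1 θ.2.1 θ.2.2) parCoeff
    (fun _ θ s => segPos θ.1 s) where
  apply θ f s := by
    by_cases hs : s < θ.1 <;> simp [parOp, parCoeff, Fin.sum_univ_four, segLen, segPos, hs]
  measurable_coeff i s := by
    have m0 : Measurable fun θ : I × I × I => segLen θ.1 s :=
      (measurable_fix_segLen s).comp measurable_fst
    have m1 : MeasurableSet {θ : I × I × I | s < θ.1} :=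
      measurableSet_lt measurable_const measurable_fst
    unfold parCoeff
    refine Measurable.ite m1 ?_ ?_ <;> fin_cases i <;> simp <;> fun_prop
  measurable_pos i s := (measurable_fix_segPos s).comp measurable_fst
  continuous θ f hf h0 h1 := by
    rw [parOp_eq_splitOp_mixOp]
    refine continuous_splitOp _ (fun i => ?_) ?_ ?_
    · fin_cases i <;>
      · simp only [Fin.zero_eta, Fin.mk_one, Matrix.cons_val_zero, Matrix.cons_val_one]
        unfold mixOp
        exact ((hf _).const_mul _).add ((hf _).const_mul _)
    · exact mixOp_congr_zero _ _ fun i => by fin_cases i <;> simp [h0]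
    · exact mixOp_congr_zero _ _ fun i => by fin_cases i <;> simp [h1]
  lintegral D hD s := by
    set F : I × I → ℝ≥0∞ := fun q => ‖(segLen q.1 s * q.2) ^ bexp‖ₑ ^ 2 * D (segPos q.1 s)
      + ‖(segLen q.1 s * (1 - q.2)) ^ bexp‖ₑ ^ 2 * D (segPos q.1 s)
    have hF : Measurable F := (measurable_kernel_left hD s).add (measurable_kernel_right hD s)
    have e : ∀ θ : I × I × I, ∑ i, ‖parCoeff i θ s‖ₑ ^ 2 * D (segPos θ.1 s)
        = if s < θ.1 then F (θ.1, θ.2.1) else F (θ.1, θ.2.2) := fun θ => by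
      by_cases hs : s < θ.1 <;> simp [parCoeff, Fin.sum_univ_four, hs, F]
    simp_rw [e]
    rw [isSplitLaw_volume.lintegral hF s, lintegral_add_left (measurable_kernel_left hD s),
      lintegral_kernel_left hD, lintegral_kernel_right hD, ← add_mul, ofReal_kernel_add]

/-- The coefficients of the four subprocesses in `perpOp`. -/
noncomputable def perpCoeff (i : Fin 4) (θ : I × I × I) (s : I) : ℝ :=
  ![if s < θ.1 then (segLen θ.1 s * θ.2.2) ^ bexp else 0,
    if s < θ.2.1 then (segLen θ.2.1 s * (1 - θ.2.2)) ^ bexp else 0,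
    if s < θ.1 then 0 else (segLen θ.1 s * θ.2.2) ^ bexp,
    if s < θ.2.1 then 0 else (segLen θ.2.1 s * (1 - θ.2.2)) ^ bexp] i

/-- The relative positions at which `perpOp` evaluates the four subprocesses. -/
noncomputable def perpPos (i : Fin 4) (θ : I × I × I) (s : I) : I :=
  ![segPos θ.1 s, segPos θ.2.1 s, segPos θ.1 s, segPos θ.2.1 s] i

lemma measurePreserving_perp_left :
    MeasurePreserving (fun θ : I × I × I => (θ.1, θ.2.2)) volume volume :=
  ⟨by fun_prop, isSplitLaw_volume.right⟩

lemma measurePreserving_perp_right :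
    MeasurePreserving (fun θ : I × I × I => (θ.2.1, θ.2.2)) volume volume :=
  measurePreserving_snd

lemma isTreeOp_perpOp : IsTreeOp (fun θ => perpOp θ.1 θ.2.1 θ.2.2) perpCoeff perpPos where
  apply θ f s := by
    by_cases hs : s < θ.1 <;> by_cases hs' : s < θ.2.1 <;>
      simp [perpOp, perpCoeff, perpPos, Fin.sum_univ_four, segLen, segPos, hs, hs', not_le.2,
        not_lt.1]
  measurable_coeff i s := by
    have m0 : Measurable fun θ : I × I × I => segLen θ.1 s :=
      (measurable_fix_segLen s).comp measurable_fst
    have m0' : Measurable fun θ : I × I × I => segLen θ.2.1 s :=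
      (measurable_fix_segLen s).comp (by fun_prop)
    have m1 : MeasurableSet {θ : I × I × I | s < θ.1} :=
      measurableSet_lt measurable_const measurable_fst
    have m2 : MeasurableSet {θ : I × I × I | s < θ.2.1} :=
      measurableSet_lt measurable_const (by fun_prop)
    unfold perpCoeff
    fin_cases i <;> simp
    · exact Measurable.ite m1 (by fun_prop) (by fun_prop)
    · exact Measurable.ite m2 (by fun_prop) (by fun_prop)
    · exact Measurable.ite m1 (by fun_prop) (by fun_prop)
    · exact Measurable.ite m2 (by fun_prop) (by fun_prop)
  measurable_pos i s := by
    have m0 : Measurable fun θ : I × I × I => segPos θ.1 s :=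
      (measurable_fix_segPos s).comp measurable_fst
    have m0' : Measurable fun θ : I × I × I => segPos θ.2.1 s :=
      (measurable_fix_segPos s).comp (by fun_prop)
    fin_cases i <;> assumption
  continuous θ f hf h0 h1 := by
    rw [perpOp_eq_mixOp_splitOp]
    have hs : ∀ i : Fin 2, Continuous
        (![splitOp θ.1 ![f 0, f 2], splitOp θ.2.1 ![f 1, f 3]] i) := fun i => by
      fin_cases i <;>
      · refine continuous_splitOp _ (fun i => ?_) ?_ ?_
        · fin_cases i <;> exact hf _
        · exact h0 _
        · exact h1 _
    unfold mixOp
    exact ((hs 0).const_mul _).add ((hs 1).const_mul _)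
  lintegral D hD s := by
    set F : I × I → ℝ≥0∞ := fun q => ‖(segLen q.1 s * q.2) ^ bexp‖ₑ ^ 2 * D (segPos q.1 s)
    set G : I × I → ℝ≥0∞ := fun q => ‖(segLen q.1 s * (1 - q.2)) ^ bexp‖ₑ ^ 2 * D (segPos q.1 s)
    have hF : Measurable F := measurable_kernel_left hD s
    have hG : Measurable G := measurable_kernel_right hD s
    have e : ∀ θ : I × I × I, ∑ i, ‖perpCoeff i θ s‖ₑ ^ 2 * D (perpPos i θ s)
        = F (θ.1, θ.2.2) + G (θ.2.1, θ.2.2) := fun θ => by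
      by_cases hs : s < θ.1 <;> by_cases hs' : s < θ.2.1 <;>
        simp [perpCoeff, perpPos, Fin.sum_univ_four, hs, hs', F, G, add_comm]
    have hFm : Measurable fun θ : I × I × I => F (θ.1, θ.2.2) :=
      hF.comp measurePreserving_perp_left.measurable
    simp_rw [e]
    rw [lintegral_add_left hFm,
      measurePreserving_perp_left.lintegral_comp hF, measurePreserving_perp_right.lintegral_comp hG,
      lintegral_kernel_left hD, lintegral_kernel_right hD, ← add_mul, ofReal_kernel_add]

section Transfer

variable {Ω : Type*} [MeasurableSpace Ω] {P : Measure Ω} [IsProbabilityMeasure P]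
  {Z : Ω → C(I, ℝ)} {op : I × I × I → (Fin 4 → I → ℝ) → I → ℝ} {c : Fin 4 → I × I × I → I → ℝ}
  {r : Fin 4 → I × I × I → I → I}

/-- The law of an admissible solution of a recursion is an invariant law. -/
lemma IsTreeOp.isTreeLaw_map (hop : IsTreeOp op c r) (hZ : IsAdmissible Z P)
    (hs : IdentDistrib (fun ω => (Z ω : I → ℝ))
      (fun q : (I × I × I) × (Fin 4 → Ω) => op q.1 (fun i => (Z (q.2 i) : I → ℝ)))
      P ((volume : Measure (I × I × I)).prod (Measure.pi fun _ => P))) :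
    IsTreeLaw op (P.map Z) where
  memLp s := by
    rw [memLp_map_measure_iff (continuous_eval_const s).measurable.aestronglyMeasurable
      hZ.measurable.aemeasurable]
    exact hZ.memLp s 2
  mean s := by
    rw [integral_map hZ.measurable.aemeasurable
      (continuous_eval_const s).measurable.aestronglyMeasurable]
    exact hZ.mean s
  invariant := by
    rw [Measure.map_map measurable_coeFn hZ.measurable]
    refine hs.map_eq.trans ?_
    exact map_prod_pi_comp hZ.measurable (measurable_pi_iff.2 hop.measurable_eval_apply)

/-- Two admissible solutions of the same recursion have the same law. -/
lemma IsTreeOp.identDistrib (hop : IsTreeOp op c r) (hZ : IsAdmissible Z P)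
    (hs : IdentDistrib (fun ω => (Z ω : I → ℝ))
      (fun q : (I × I × I) × (Fin 4 → Ω) => op q.1 (fun i => (Z (q.2 i) : I → ℝ)))
      P ((volume : Measure (I × I × I)).prod (Measure.pi fun _ => P)))
    {Ω' : Type*} [MeasurableSpace Ω'] {P' : Measure Ω'} [IsProbabilityMeasure P']
    {Z' : Ω' → C(I, ℝ)} (hZ' : IsAdmissible Z' P')
    (hs' : IdentDistrib (fun ω => (Z' ω : I → ℝ))
      (fun q : (I × I × I) × (Fin 4 → Ω') => op q.1 (fun i => (Z' (q.2 i) : I → ℝ)))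
      P' ((volume : Measure (I × I × I)).prod (Measure.pi fun _ => P'))) :
    IdentDistrib Z' Z P' P := by
  have := Measure.isProbabilityMeasure_map (μ := P) hZ.measurable.aemeasurable
  have := Measure.isProbabilityMeasure_map (μ := P') hZ'.measurable.aemeasurable
  exact ⟨hZ'.measurable.aemeasurable, hZ.measurable.aemeasurable,
    hop.unique (hop.isTreeLaw_map hZ' hs') (hop.isTreeLaw_map hZ hs)⟩

end Transfer

/-! ### The process of the perpendicular recursion -/

section Regroup

variable {E : Type*} [MeasurableSpace E] {P : Measure E} [IsProbabilityMeasure P]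
  {e : Fin 4 → Fin 2 × Fin 2}

/-- Four independent copies are two independent pairs of independent copies. -/
lemma map_pi_pi (he : Function.Bijective e) :
    (Measure.pi fun _ : Fin 2 => Measure.pi fun _ : Fin 2 => P).map
      (fun g i => g (e i).1 (e i).2) = Measure.pi fun _ : Fin 4 => P := by
  have hm : Measurable fun (g : Fin 2 → Fin 2 → E) (i : Fin 4) => g (e i).1 (e i).2 := by fun_prop
  refine (Measure.pi_eq fun s hs => ?_).symm
  set e' := Equiv.ofBijective e he
  rw [Measure.map_apply hm (MeasurableSet.univ_pi hs)]
  have hpre : (fun (g : Fin 2 → Fin 2 → E) (i : Fin 4) => g (e i).1 (e i).2) ⁻¹' Set.univ.pi s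
      = Set.univ.pi fun a => Set.univ.pi fun b => s (e'.symm (a, b)) := by
    ext g
    simp only [Set.mem_preimage, Set.mem_univ_pi]
    constructor
    · intro hg a b
      have h1 : e (e'.symm (a, b)) = (a, b) := e'.apply_symm_apply (a, b)
      have := hg (e'.symm (a, b))
      rwa [h1] at this
    · intro hg i
      have h1 : e'.symm ((e i).1, (e i).2) = i := e'.symm_apply_apply i
      have := hg (e i).1 (e i).2
      rwa [h1] at this
  rw [hpre, Measure.pi_pi]
  simp_rw [Measure.pi_pi]
  rw [← Fintype.prod_prod_type' fun a b => P (s (e'.symm (a, b)))]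
  exact Equiv.prod_comp e'.symm fun i => P (s i)

lemma measurePreserving_pair_regroup (he : Function.Bijective e) :
    MeasurePreserving (fun g : Fin 2 → I × (Fin 2 → E) =>
        (((g 0).1, (g 1).1), fun i => (g (e i).1).2 (e i).2))
      (Measure.pi fun _ => (volume : Measure I).prod (Measure.pi fun _ => P))
      (((volume : Measure I).prod volume).prod (Measure.pi fun _ => P)) := by
  have h1 := measurePreserving_arrowProdEquivProdArrow I (Fin 2 → E) (Fin 2)
    (fun _ => (volume : Measure I)) (fun _ => Measure.pi fun _ => P)
  have h2 := measurePreserving_finTwoArrow (volume : Measure I)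
  have h3 : MeasurePreserving (fun (g : Fin 2 → Fin 2 → E) (i : Fin 4) => g (e i).1 (e i).2)
      (Measure.pi fun _ : Fin 2 => Measure.pi fun _ : Fin 2 => P) (Measure.pi fun _ => P) :=
    ⟨by fun_prop, map_pi_pi he⟩
  exact (h2.prod h3).comp h1

/-- One uniform variable and two independent triples, each of a uniform variable and two copies, are
three uniform variables and four copies. -/
lemma measurePreserving_regroup_par (he : Function.Bijective e) :
    MeasurePreserving (fun q : I × (Fin 2 → I × (Fin 2 → E)) =>
        ((q.1, (q.2 0).1, (q.2 1).1), fun i => (q.2 (e i).1).2 (e i).2))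
      ((volume : Measure I).prod
        (Measure.pi fun _ => (volume : Measure I).prod (Measure.pi fun _ => P)))
      ((volume : Measure (I × I × I)).prod (Measure.pi fun _ => P)) :=
  ((measurePreserving_prodAssoc (volume : Measure I) ((volume : Measure I).prod volume)
    (Measure.pi fun _ : Fin 4 => P)).symm).comp
    ((MeasurePreserving.id (volume : Measure I)).prod (measurePreserving_pair_regroup he))

lemma measurePreserving_rotate :
    MeasurePreserving (fun θ : I × I × I => (θ.2.1, θ.2.2, θ.1)) volume volume :=
  (measurePreserving_prodAssoc (volume : Measure I) (volume : Measure I) (volume : Measure I)).comp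
    (Measure.measurePreserving_swap (μ := (volume : Measure I)) (ν := (volume : Measure (I × I))))

/-- The same regrouping, with the three uniform variables in the order used by `perpOp`. -/
lemma measurePreserving_regroup_perp (he : Function.Bijective e) :
    MeasurePreserving (fun q : I × (Fin 2 → I × (Fin 2 → E)) =>
        (((q.2 0).1, (q.2 1).1, q.1), fun i => (q.2 (e i).1).2 (e i).2))
      ((volume : Measure I).prod
        (Measure.pi fun _ => (volume : Measure I).prod (Measure.pi fun _ => P)))
      ((volume : Measure (I × I × I)).prod (Measure.pi fun _ => P)) :=
  (measurePreserving_rotate.prod (MeasurePreserving.id (Measure.pi fun _ : Fin 4 => P))).comp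
    (measurePreserving_regroup_par he)

end Regroup

/-- `(β + 1) / 2 (v ^ β f₀ + (1 - v) ^ β f₁)` as an element of `C[0,1]`. -/
noncomputable def perpC (q : I × (Fin 2 → C(I, ℝ))) : C(I, ℝ) :=
  ((bexp + 1) / 2) • (((q.1 : ℝ) ^ bexp) • q.2 0 + ((1 - (q.1 : ℝ)) ^ bexp) • q.2 1)

lemma perpC_apply (q : I × (Fin 2 → C(I, ℝ))) (s : I) :
    perpC q s = (bexp + 1) / 2 * mixOp q.1 (fun i => (q.2 i : I → ℝ)) s := rfl

lemma measurable_mixOp (s : I) : Measurable fun q : I × (Fin 2 → I → ℝ) => mixOp q.1 q.2 s := by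
  unfold mixOp; fun_prop

lemma measurable_eval_pi (i : Fin 2) (s : I) : Measurable fun g : Fin 2 → C(I, ℝ) => g i s :=
  (continuous_eval_const s).measurable.comp (measurable_pi_apply i)

lemma measurable_mixOp_coe : Measurable fun q : I × (Fin 2 → C(I, ℝ)) =>
    mixOp q.1 (fun i => (q.2 i : I → ℝ)) := by
  refine measurable_pi_lambda _ fun s => ?_
  have he : ∀ i, Measurable fun q : I × (Fin 2 → C(I, ℝ)) => q.2 i s := fun i =>
    (measurable_eval_pi i s).comp measurable_snd
  have c0 : Measurable fun q : I × (Fin 2 → C(I, ℝ)) => (q.1 : ℝ) ^ bexp := by fun_prop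
  have c1 : Measurable fun q : I × (Fin 2 → C(I, ℝ)) => (1 - (q.1 : ℝ)) ^ bexp := by fun_prop
  exact (c0.mul (he 0)).add (c1.mul (he 1))

lemma measurable_perpC : Measurable perpC :=
  measurable_of_eval fun s => ((measurable_pi_apply s).comp measurable_mixOp_coe).const_mul _

lemma measurable_splitOp_coe : Measurable fun q : I × (Fin 2 → C(I, ℝ)) =>
    splitOp q.1 (fun i => (q.2 i : I → ℝ)) := by
  refine measurable_pi_lambda _ fun s => ?_
  have hp : Measurable fun q : I × (Fin 2 → C(I, ℝ)) => segPos q.1 s :=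
    (measurable_fix_segPos s).comp measurable_fst
  have hl : Measurable fun q : I × (Fin 2 → C(I, ℝ)) => segLen q.1 s :=
    (measurable_fix_segLen s).comp measurable_fst
  have he : ∀ i, Measurable fun q : I × (Fin 2 → C(I, ℝ)) => q.2 i (segPos q.1 s) := fun i =>
    measurable_evalPair.comp (Measurable.prodMk (by fun_prop) hp)
  have e : ∀ q : I × (Fin 2 → C(I, ℝ)), splitOp q.1 (fun i => (q.2 i : I → ℝ)) s
      = segLen q.1 s ^ bexp * if s < q.1 then q.2 0 (segPos q.1 s) else q.2 1 (segPos q.1 s) :=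
    fun q => by rw [splitOp_eq]; split_ifs <;> rfl
  simp_rw [e]
  exact (hl.pow_const _).mul
    (Measurable.ite (measurableSet_lt measurable_const measurable_fst) (he 0) (he 1))

lemma measurable_const_mul_fun (a : ℝ) : Measurable fun (g : I → ℝ) (s : I) => a * g s := by fun_prop

lemma measurable_const_mul_coe (a : ℝ) : Measurable fun (f : C(I, ℝ)) (s : I) => a * f s :=
  (measurable_const_mul_fun a).comp measurable_coeFn

/-- The law of `(β + 1) / 2 (V ^ β f₀ + (1 - V) ^ β f₁)` for independent `f₀`, `f₁` of law `μ`. -/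
noncomputable def perpLaw (μ : Measure C(I, ℝ)) : Measure C(I, ℝ) :=
  ((volume : Measure I).prod (Measure.pi fun _ => μ)).map perpC

lemma map_mul_perpLaw (μ : Measure C(I, ℝ)) :
    (perpLaw μ).map (fun f (s : I) => 2 / (bexp + 1) * f s)
      = ((volume : Measure I).prod (Measure.pi fun _ => μ)).map
        (fun q => mixOp q.1 (fun i => (q.2 i : I → ℝ))) := by
  have hb := bexp_pos
  rw [perpLaw, Measure.map_map (measurable_const_mul_coe _)
    measurable_perpC]
  congr 1
  funext q s
  simp only [Function.comp_apply, perpC_apply]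
  field_simp

section PerpLaw

variable {μ : Measure C(I, ℝ)} [IsProbabilityMeasure μ]

instance : IsProbabilityMeasure (perpLaw μ) :=
  Measure.isProbabilityMeasure_map measurable_perpC.aemeasurable

/-- Splitting two independent perpendicular processes gives a multiple of the parallel one. -/
lemma map_splitOp_perpLaw (hμ : IsTreeLaw (fun θ => parOp θ.1 θ.2.1 θ.2.2) μ) :
    μ.map (fun f (s : I) => (bexp + 1) / 2 * f s)
      = ((volume : Measure I).prod (Measure.pi fun _ => perpLaw μ)).map
        (fun q => splitOp q.1 (fun i => (q.2 i : I → ℝ))) := by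
  set e : Fin 4 → Fin 2 × Fin 2 := ![(0, 0), (0, 1), (1, 0), (1, 1)]
  have he : Function.Bijective e := by decide
  have hr := measurePreserving_regroup_par (P := μ) he
  have hpar : Measurable fun q : (I × I × I) × (Fin 4 → C(I, ℝ)) =>
      parOp q.1.1 q.1.2.1 q.1.2.2 (fun i => (q.2 i : I → ℝ)) :=
    measurable_parOp_comp measurable_id
  have h1 := map_prod_pi_comp (τ := (volume : Measure I)) (k := 2)
    (P := (volume : Measure I).prod (Measure.pi fun _ => μ)) measurable_perpC
    measurable_splitOp_coe
  have h2 : μ.map (fun f (s : I) => (bexp + 1) / 2 * f s)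
      = (μ.map (fun f : C(I, ℝ) => (f : I → ℝ))).map (fun g s => (bexp + 1) / 2 * g s) := by
    rw [Measure.map_map (measurable_const_mul_fun _) measurable_coeFn]; rfl
  rw [perpLaw, ← h1, h2, hμ.invariant, Measure.map_map (measurable_const_mul_fun _) hpar,
    ← hr.map_eq, Measure.map_map ((measurable_const_mul_fun _).comp hpar) hr.measurable]
  congr 1
  funext q s
  simp only [Function.comp_apply, parOp_eq_splitOp_mixOp, splitOp]
  split_ifs <;> simp [mixOp, perpC_apply, e] <;> ring

/-- The perpendicular law is invariant under the perpendicular recursion. -/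
lemma perpLaw_invariant (hμ : IsTreeLaw (fun θ => parOp θ.1 θ.2.1 θ.2.2) μ) :
    (perpLaw μ).map (fun f : C(I, ℝ) => (f : I → ℝ))
      = ((volume : Measure (I × I × I)).prod (Measure.pi fun _ => perpLaw μ)).map
        (fun q => perpOp q.1.1 q.1.2.1 q.1.2.2 (fun i => (q.2 i : I → ℝ))) := by
  have hb := bexp_pos
  set e : Fin 4 → Fin 2 × Fin 2 := ![(0, 0), (1, 0), (0, 1), (1, 1)]
  have he : Function.Bijective e := by decide
  have hr := measurePreserving_regroup_perp (P := perpLaw μ) he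
  have hperp : Measurable fun q : (I × I × I) × (Fin 4 → C(I, ℝ)) =>
      perpOp q.1.1 q.1.2.1 q.1.2.2 (fun i => (q.2 i : I → ℝ)) :=
    measurable_pi_iff.2 isTreeOp_perpOp.measurable_eval_apply
  have hG : Measurable fun q : I × (Fin 2 → I → ℝ) =>
      fun s : I => (bexp + 1) / 2 * mixOp q.1 q.2 s :=
    measurable_pi_lambda _ fun s => (measurable_mixOp s).const_mul _
  have hW : Measurable fun q : I × (Fin 2 → C(I, ℝ)) =>
      fun s : I => ((bexp + 1) / 2)⁻¹ * splitOp q.1 (fun i => (q.2 i : I → ℝ)) s :=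
    (measurable_const_mul_fun _).comp measurable_splitOp_coe
  -- the recursion of the parallel process, in the form given by the splitting identity
  have h1 : μ.map (fun f : C(I, ℝ) => (f : I → ℝ))
      = ((volume : Measure I).prod (Measure.pi fun _ => perpLaw μ)).map
        (fun q s => ((bexp + 1) / 2)⁻¹ * splitOp q.1 (fun i => (q.2 i : I → ℝ)) s) := by
    have := congrArg (Measure.map fun (g : I → ℝ) (s : I) => ((bexp + 1) / 2)⁻¹ * g s)
      (map_splitOp_perpLaw hμ)
    rw [Measure.map_map (measurable_const_mul_fun _) (measurable_const_mul_coe _), Measure.map_map (measurable_const_mul_fun _) measurable_splitOp_coe] at this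
    refine Eq.trans ?_ this
    congr 1
    funext f s
    simp only [Function.comp_apply]
    field_simp
  have h2 := map_prod_pi_comp (τ := (volume : Measure I)) (k := 2) (P := μ) measurable_coeFn hG
  have h3 := map_prod_pi_comp (τ := (volume : Measure I)) (k := 2)
    (P := (volume : Measure I).prod (Measure.pi fun _ => perpLaw μ)) hW hG
  rw [h1, ← h3] at h2
  have h4 : (perpLaw μ).map (fun f : C(I, ℝ) => (f : I → ℝ))
      = ((volume : Measure I).prod (Measure.pi fun _ => μ)).map
        (fun q s => (bexp + 1) / 2 * mixOp q.1 (fun i => (q.2 i : I → ℝ)) s) := by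
    rw [perpLaw, Measure.map_map measurable_coeFn measurable_perpC]; rfl
  rw [h4, h2, ← hr.map_eq, Measure.map_map hperp hr.measurable]
  congr 1
  funext q s
  simp only [Function.comp_apply, perpOp_eq_mixOp_splitOp, mixOp]
  simp [splitOp, e]
  split_ifs <;> field_simp

end PerpLaw

/-! ### Moments and variances -/

lemma integral_perpLaw {μ : Measure C(I, ℝ)} {g : C(I, ℝ) → ℝ} (hg : Measurable g) :
    ∫ f, g f ∂(perpLaw μ)
      = ∫ q, g (perpC q) ∂((volume : Measure I).prod (Measure.pi fun _ => μ)) :=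
  integral_map measurable_perpC.aemeasurable hg.aestronglyMeasurable

section Moments

variable {μ : Measure C(I, ℝ)} [IsProbabilityMeasure μ]

lemma memLp_perpC {p : ℝ≥0∞} (hμ : MemLp (fun f : C(I, ℝ) => f) p μ) :
    MemLp perpC p ((volume : Measure I).prod (Measure.pi fun _ => μ)) := by
  have hb := bexp_pos
  have hi : ∀ i : Fin 2, MemLp (fun q : I × (Fin 2 → C(I, ℝ)) => q.2 i) p
      ((volume : Measure I).prod (Measure.pi fun _ => μ)) := fun i =>
    hμ.comp_measurePreserving ((measurePreserving_eval (fun _ : Fin 2 => μ) i).comp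
      measurePreserving_snd)
  refine (((hi 0).norm.add (hi 1).norm).const_mul ((bexp + 1) / 2)).mono
    measurable_perpC.aestronglyMeasurable (ae_of_all _ fun q => ?_)
  have h0 : |(q.1 : ℝ) ^ bexp| ≤ 1 := abs_rpow_le_one q.1.2.1 q.1.2.2 hb.le
  have h1 : |(1 - (q.1 : ℝ)) ^ bexp| ≤ 1 :=
    abs_rpow_le_one (by linarith [q.1.2.2]) (by linarith [q.1.2.1]) hb.le
  refine le_trans ?_ (le_abs_self _)
  rw [perpC, norm_smul, Real.norm_of_nonneg (by positivity)]
  refine mul_le_mul_of_nonneg_left ((norm_add_le _ _).trans (add_le_add ?_ ?_)) (by positivity)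
  · rw [norm_smul]; exact mul_le_of_le_one_left (norm_nonneg _) h0
  · rw [norm_smul]; exact mul_le_of_le_one_left (norm_nonneg _) h1

lemma memLp_perpLaw {p : ℝ≥0∞} (hμ : MemLp (fun f : C(I, ℝ) => f) p μ) :
    MemLp (fun f : C(I, ℝ) => f) p (perpLaw μ) :=
  (memLp_map_measure_iff aestronglyMeasurable_id measurable_perpC.aemeasurable).2 (memLp_perpC hμ)

lemma integral_perpLaw_eval (hμ : MemLp (fun f : C(I, ℝ) => f) 2 μ) {s : I}
    (hmean : ∫ f, f s ∂μ = h s) : ∫ f, f s ∂(perpLaw μ) = h s := by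
  have hb := bexp_pos
  have hp : MemLp (fun q => perpC q s) 2 ((volume : Measure I).prod (Measure.pi fun _ => μ)) :=
    memLp_eval (memLp_perpC hμ) s
  have hX : Integrable (fun f : C(I, ℝ) => f s) μ := (memLp_eval hμ s).integrable (by norm_num)
  rw [integral_perpLaw (continuous_eval_const s).measurable,
    integral_prod _ (hp.integrable (by norm_num))]
  have e : ∀ v : I, ∫ g : Fin 2 → C(I, ℝ), perpC (v, g) s ∂(Measure.pi fun _ => μ)
      = (bexp + 1) / 2 * (((v : ℝ) ^ bexp + (1 - v : ℝ) ^ bexp) * h s) := fun v => by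
    have hg : Measurable fun p : C(I, ℝ) × C(I, ℝ) =>
        (bexp + 1) / 2 * ((v : ℝ) ^ bexp * p.1 s + (1 - v : ℝ) ^ bexp * p.2 s) :=
      ((((continuous_eval_const s).measurable.comp measurable_fst).const_mul _).add
        (((continuous_eval_const s).measurable.comp measurable_snd).const_mul _)).const_mul _
    rw [← hmean, ← integral_prod_linear hX, ← integral_const_mul,
      ← map_pi_pair (P := μ) (show (0 : Fin 2) ≠ 1 by decide),
      integral_map (by fun_prop) hg.aestronglyMeasurable]
    rfl
  simp_rw [e]
  rw [integral_const_mul, integral_mul_const, integral_add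
    (integrable_rpow_unitInterval hb.le) (integrable_one_sub_rpow_unitInterval hb.le),
    integral_rpow_unitInterval hb.le, integral_one_sub_rpow_unitInterval hb.le]
  field_simp
  ring

lemma integral_perpLaw_eval_sq (hμ : MemLp (fun f : C(I, ℝ) => f) 2 μ) {s : I}
    (hmean : ∫ f, f s ∂μ = h s) (hsq : ∫ f, f s ^ 2 ∂μ = c2 * h s ^ 2) :
    ∫ f, f s ^ 2 ∂(perpLaw μ) = (K2perp + 1) * h s ^ 2 := by
  have hb := bexp_pos
  have hp : MemLp (fun q => perpC q s) 2 ((volume : Measure I).prod (Measure.pi fun _ => μ)) :=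
    memLp_eval (memLp_perpC hμ) s
  rw [integral_perpLaw ((continuous_eval_const s).measurable.pow_const 2),
    integral_prod _ hp.integrable_sq]
  have e : ∀ v : I, ∫ g : Fin 2 → C(I, ℝ), perpC (v, g) s ^ 2 ∂(Measure.pi fun _ => μ)
      = ((v : ℝ) ^ (2 * bexp) + (1 - v : ℝ) ^ (2 * bexp)) * (((bexp + 1) / 2) ^ 2 * c2 * h s ^ 2)
        + (v : ℝ) ^ bexp * (1 - v : ℝ) ^ bexp * (2 * ((bexp + 1) / 2) ^ 2 * h s ^ 2) := fun v => by
    have hg : Measurable fun p : C(I, ℝ) × C(I, ℝ) =>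
        (((bexp + 1) / 2) * (v : ℝ) ^ bexp * p.1 s
          + ((bexp + 1) / 2) * (1 - v : ℝ) ^ bexp * p.2 s) ^ 2 :=
      ((((continuous_eval_const s).measurable.comp measurable_fst).const_mul _).add
        (((continuous_eval_const s).measurable.comp measurable_snd).const_mul _)).pow_const 2
    have h1 := integral_prod_linear_sq (memLp_eval hμ s) ((bexp + 1) / 2 * (v : ℝ) ^ bexp)
      ((bexp + 1) / 2 * (1 - v : ℝ) ^ bexp)
    rw [← map_pi_pair (P := μ) (show (0 : Fin 2) ≠ 1 by decide),
      integral_map (by fun_prop) hg.aestronglyMeasurable, hmean, hsq] at h1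
    rw [← sq_rpow_bexp v.2.1, ← sq_rpow_bexp (show 0 ≤ 1 - (v : ℝ) by linarith [v.2.2])]
    refine Eq.trans ?_ (h1.trans (by ring))
    refine integral_congr_ae (ae_of_all _ fun g => ?_)
    simp only [perpC_apply, mixOp]
    ring
  have i1 : Integrable fun v : I => (v : ℝ) ^ (2 * bexp) :=
    integrable_rpow_unitInterval (by positivity)
  have i2 : Integrable fun v : I => (1 - v : ℝ) ^ (2 * bexp) :=
    integrable_one_sub_rpow_unitInterval (by positivity)
  have i12 : Integrable fun v : I => (v : ℝ) ^ (2 * bexp) + (1 - v : ℝ) ^ (2 * bexp) := i1.add i2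
  have i3 : Integrable fun v : I => (v : ℝ) ^ bexp * (1 - v : ℝ) ^ bexp := by
    refine integrable_of_bound (by fun_prop) 1 fun v => ?_
    rw [abs_mul]
    exact mul_le_one₀ (abs_rpow_le_one v.2.1 v.2.2 hb.le) (abs_nonneg _)
      (abs_rpow_le_one (by linarith [v.2.2]) (by linarith [v.2.1]) hb.le)
  simp_rw [e]
  rw [integral_add (i12.mul_const _) (i3.mul_const _), integral_mul_const,
    integral_mul_const, integral_add i1 i2, integral_rpow_unitInterval (by positivity),
    integral_one_sub_rpow_unitInterval (by positivity), integral_rpow_mul_one_sub_rpow, K2perp]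
  field_simp
  ring

end Moments

section Variance

variable {Ω : Type*} [MeasurableSpace Ω] {P : Measure Ω} [IsProbabilityMeasure P]
  {Z : Ω → C(I, ℝ)} {K : ℝ}

lemma variance_eval (hZ : MemLp Z 2 P) {s : I} (hmean : ∫ ω, Z ω s ∂P = h s)
    (hsq : ∫ ω, Z ω s ^ 2 ∂P = K * h s ^ 2) :
    variance (fun ω => Z ω s) P = (K - 1) * h s ^ 2 := by
  rw [variance_eq_sub (memLp_eval hZ s), hmean]
  simp only [Pi.pow_apply]
  rw [hsq]
  ring

/-- The variance at an independent uniform location, by Fubini's theorem. -/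
lemma variance_uniform (hm : Measurable Z) (hZ : MemLp Z 2 P) (hmean : ∀ s, ∫ ω, Z ω s ∂P = h s)
    (hsq : ∀ s, ∫ ω, Z ω s ^ 2 ∂P = K * h s ^ 2) :
    variance (fun q : Ω × I => Z q.1 q.2) (P.prod volume)
      = K * beta (bexp + 1) (bexp + 1) - beta (bexp / 2 + 1) (bexp / 2 + 1) ^ 2 := by
  have hmeas : Measurable fun q : Ω × I => Z q.1 q.2 :=
    measurable_evalPair.comp ((hm.comp measurable_fst).prodMk measurable_snd)
  have hL : MemLp (fun q : Ω × I => Z q.1 q.2) 2 (P.prod volume) :=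
    (hZ.comp_fst volume).mono hmeas.aestronglyMeasurable
      (ae_of_all _ fun q => (Z q.1).norm_coe_le_norm q.2)
  rw [variance_eq_sub hL]
  simp only [Pi.pow_apply]
  rw [integral_prod_symm _ (hL.integrable (by norm_num)), integral_prod_symm _ hL.integrable_sq]
  simp only [hmean, hsq]
  rw [integral_const_mul, integral_h, integral_h_sq]

end Variance

section Realization

variable {Ω : Type*} [MeasurableSpace Ω] {P : Measure Ω} {Z : Ω → C(I, ℝ)}
  {μ : Measure C(I, ℝ)}

lemma isAdmissible_of_map_eq (hZ : MeasurePreserving Z P μ)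
    (hμ : ∀ p : ℝ≥0, MemLp (fun f : C(I, ℝ) => f) p μ) (hmean : ∀ s, ∫ f, f s ∂μ = h s) :
    IsAdmissible Z P where
  measurable := hZ.measurable
  memLp s p := memLp_eval ((hμ p).comp_measurePreserving hZ) s
  mean s := by
    rw [← hmean s, ← hZ.map_eq, integral_map hZ.measurable.aemeasurable
      (continuous_eval_const s).measurable.aestronglyMeasurable]

lemma integral_eval_sq_of_map_eq (hZ : MeasurePreserving Z P μ) (s : I) :
    ∫ ω, Z ω s ^ 2 ∂P = ∫ f, f s ^ 2 ∂μ := by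
  rw [← hZ.map_eq, integral_map hZ.measurable.aemeasurable
    ((continuous_eval_const s).measurable.pow_const 2).aestronglyMeasurable]

/-- Identities in law between functionals of one process and of independent copies of another one
follow from the identities between the laws on `C[0,1]`. -/
lemma identDistrib_of_map_eq [IsProbabilityMeasure P] {Θ Y : Type*} [MeasurableSpace Θ] [MeasurableSpace Y] {τ : Measure Θ}
    [IsProbabilityMeasure τ] {k : ℕ} {Z' : Ω → C(I, ℝ)} {ν : Measure C(I, ℝ)}
    (hZ : MeasurePreserving Z P μ) (hZ' : MeasurePreserving Z' P ν) {F : C(I, ℝ) → Y}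
    (hF : Measurable F) {G : Θ × (Fin k → C(I, ℝ)) → Y} (hG : Measurable G)
    (hFG : μ.map F = (τ.prod (Measure.pi fun _ => ν)).map G) :
    IdentDistrib (fun ω => F (Z ω)) (fun q : Θ × (Fin k → Ω) => G (q.1, fun i => Z' (q.2 i)))
      P (τ.prod (Measure.pi fun _ => P)) where
  aemeasurable_fst := (hF.comp hZ.measurable).aemeasurable
  aemeasurable_snd := by
    have hm : Measurable fun (f : Fin k → Ω) i => Z' (f i) :=
      measurable_pi_lambda _ fun i => hZ'.measurable.comp (measurable_pi_apply i)
    exact (hG.comp (measurable_id.prodMap hm)).aemeasurable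
  map_eq := by
    rw [map_prod_pi_comp hZ'.measurable hG, hZ'.map_eq, ← hFG, ← hZ.map_eq,
      Measure.map_map hF hZ.measurable]
    rfl

end Realization

/-- The limit process of quadtrees is the limit for equal lower cuts; it shares its one-dimensional
marginals with the one for independent lower cuts. -/
lemma exists_isQuadLimit {Y : (List (Fin 4) → I × I × I) → C(I, ℝ)}
    (hY : IsParLimit (volume : Measure (I × I × I)) Y) :
    ∃ Z : (List (Fin 4) → I × I) → C(I, ℝ), IsQuadLimit Z ∧ MemLp Z 2 quadMeasure ∧
      (∀ s, quadMeasure.map (fun w => Z w s) = (treeMeasure volume).map (fun w => Y w s)) ∧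
      (∀ s, ∫ w, Z w s ∂quadMeasure = h s) ∧ ∀ s, ∫ w, Z w s ^ 2 ∂quadMeasure = c2 * h s ^ 2 := by
  obtain ⟨Z, hZ⟩ := exists_isParLimit isSplitLaw_dupCut
  have mp : MeasurePreserving (fun (w : List (Fin 4) → I × I) u => dupCut (w u)) quadMeasure
      (treeMeasure ((volume : Measure (I × I)).map dupCut)) :=
    ⟨measurable_pi_lambda _ fun u => measurable_dupCut.comp (measurable_pi_apply u),
      map_dupCut_tree⟩
  have mE : ∀ s, Measurable fun w => Z w s := fun s =>
    (continuous_eval_const s).measurable.comp hZ.measurable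
  refine ⟨fun w => Z fun u => dupCut (w u), ⟨hZ.measurable.comp mp.measurable, ?_⟩,
    (hZ.memLp 2).comp_measurePreserving mp, fun s => ?_, fun s => ?_, fun s => ?_⟩
  · filter_upwards [mp.quasiMeasurePreserving.ae hZ.tendsto] with w hw
    have e : (fun n => quadApprox n w) = fun n s => parApproxC n (fun u => dupCut (w u)) s :=
      funext fun n => quadApprox_eq_parApprox n w
    rw [e]
    exact ContinuousMap.tendsto_iff_tendstoUniformly.1 hw
  · rw [← hZ.map_eval_eq hY isSplitLaw_dupCut isSplitLaw_volume s, ← mp.map_eq,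
      Measure.map_map (mE s) mp.measurable]
    rfl
  · rw [← hZ.integral_eval isSplitLaw_dupCut s, ← mp.map_eq,
      integral_map mp.measurable.aemeasurable (mE s).aestronglyMeasurable]
  · rw [← hZ.integral_eval_sq isSplitLaw_dupCut s, ← mp.map_eq,
      integral_map mp.measurable.aemeasurable ((mE s).pow_const 2).aestronglyMeasurable]

end PartialMatch

/-- In the last lines, `P.prod volume` is the law of the pair consisting of the process and an
independent uniform location. -/
theorem mainTheorem11 :
    ∃ (Ω : Type) (_ : MeasurableSpace Ω) (P : Measure Ω) (_ : IsProbabilityMeasure P)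
      (Zpar Zperp : Ω → C(I, ℝ)),
      -- existence, with all moments of the supremum norm finite
      PartialMatch.IsAdmissible Zpar P ∧ PartialMatch.SolvesPar Zpar P ∧
      PartialMatch.IsAdmissible Zperp P ∧ PartialMatch.SolvesPerp Zperp P ∧
      (∀ p : ℝ≥0, MemLp Zpar p P ∧ MemLp Zperp p P) ∧
      -- uniqueness of the two laws
      (∀ (Ω' : Type*) [MeasurableSpace Ω'] (P' : Measure Ω') [IsProbabilityMeasure P']
        (Z' : Ω' → C(I, ℝ)),
        PartialMatch.IsAdmissible Z' P' → PartialMatch.SolvesPar Z' P' →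
          IdentDistrib Z' Zpar P' P) ∧
      (∀ (Ω' : Type*) [MeasurableSpace Ω'] (P' : Measure Ω') [IsProbabilityMeasure P']
        (Z' : Ω' → C(I, ℝ)),
        PartialMatch.IsAdmissible Z' P' → PartialMatch.SolvesPerp Z' P' →
          IdentDistrib Z' Zperp P' P) ∧
      -- the two distributional identities, as processes in `s`
      IdentDistrib (fun ω (s : I) => 2 / (PartialMatch.bexp + 1) * Zperp ω s)
        (fun q : I × (Fin 2 → Ω) =>
          PartialMatch.mixOp q.1 (fun i => (Zpar (q.2 i) : I → ℝ)))
        P ((volume : Measure I).prod (Measure.pi fun _ => P)) ∧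
      IdentDistrib (fun ω (s : I) => (PartialMatch.bexp + 1) / 2 * Zpar ω s)
        (fun q : I × (Fin 2 → Ω) =>
          PartialMatch.splitOp q.1 (fun i => (Zperp (q.2 i) : I → ℝ)))
        P ((volume : Measure I).prod (Measure.pi fun _ => P)) ∧
      -- comparison with the limit process of quadtrees, and variances
      (∃ Z : (List (Fin 4) → I × I) → C(I, ℝ), PartialMatch.IsQuadLimit Z ∧
        (∀ s : I, IdentDistrib (fun ω => Zpar ω s) (fun w => Z w s)
          P PartialMatch.quadMeasure) ∧
        variance (fun q : Ω × I => Zpar q.1 q.2) (P.prod volume)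
          = variance (fun q : (List (Fin 4) → I × I) × I => Z q.1 q.2)
              (PartialMatch.quadMeasure.prod volume)) ∧
      (∀ s : I, variance (fun ω => Zpar ω s) P = PartialMatch.K2 * PartialMatch.h s ^ 2) ∧
      (∀ s : I, variance (fun ω => Zperp ω s) P = PartialMatch.K2perp * PartialMatch.h s ^ 2) ∧
      variance (fun q : Ω × I => Zpar q.1 q.2) (P.prod volume) = PartialMatch.K3 ∧
      variance (fun q : Ω × I => Zperp q.1 q.2) (P.prod volume) = PartialMatch.K3perp := by
  open PartialMatch in
  obtain ⟨Y, hY⟩ := exists_isParLimit isSplitLaw_volume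
  let μ : Measure C(I, ℝ) := (treeMeasure volume).map Y
  have mY : MeasurePreserving Y (treeMeasure volume) μ := ⟨hY.measurable, rfl⟩
  have : IsProbabilityMeasure μ := Measure.isProbabilityMeasure_map hY.measurable.aemeasurable
  have hμ : IsTreeLaw (fun θ => parOp θ.1 θ.2.1 θ.2.2) μ :=
    isTreeOp_parOp.isTreeLaw_map ⟨hY.measurable, fun s p => memLp_eval (hY.memLp p) s,
      fun s => hY.integral_eval isSplitLaw_volume s⟩ hY.solvesPar
  have hμp : ∀ p : ℝ≥0, MemLp (fun f : C(I, ℝ) => f) p μ := fun p =>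
    (memLp_map_measure_iff aestronglyMeasurable_id hY.measurable.aemeasurable).2 (hY.memLp p)
  have hμ2 : MemLp (fun f : C(I, ℝ) => f) 2 μ := hμp 2
  have sqμ : ∀ s, ∫ f, f s ^ 2 ∂μ = c2 * h s ^ 2 := fun s => by
    rw [← integral_eval_sq_of_map_eq mY, hY.integral_eval_sq isSplitLaw_volume]
  let ν := perpLaw μ
  have hνp : ∀ p : ℝ≥0, MemLp (fun f : C(I, ℝ) => f) p ν := fun p => memLp_perpLaw (hμp p)
  have meanν : ∀ s, ∫ f, f s ∂ν = h s := fun s => integral_perpLaw_eval hμ2 (hμ.mean s)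
  have sqν : ∀ s, ∫ f, f s ^ 2 ∂ν = (K2perp + 1) * h s ^ 2 := fun s =>
    integral_perpLaw_eval_sq hμ2 (hμ.mean s) (sqμ s)
  have m1 : MeasurePreserving (Prod.fst : C(I, ℝ) × C(I, ℝ) → C(I, ℝ)) (μ.prod ν) μ :=
    measurePreserving_fst
  have m2 : MeasurePreserving (Prod.snd : C(I, ℝ) × C(I, ℝ) → C(I, ℝ)) (μ.prod ν) ν :=
    measurePreserving_snd
  have a1 : IsAdmissible Prod.fst (μ.prod ν) := isAdmissible_of_map_eq m1 hμp hμ.mean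
  have a2 : IsAdmissible Prod.snd (μ.prod ν) := isAdmissible_of_map_eq m2 hνp meanν
  have s1 : SolvesPar Prod.fst (μ.prod ν) := identDistrib_of_map_eq m1 m1 measurable_coeFn
    (measurable_parOp_comp measurable_id) hμ.invariant
  have s2 : SolvesPerp Prod.snd (μ.prod ν) := identDistrib_of_map_eq m2 m2 measurable_coeFn
    (measurable_pi_iff.2 isTreeOp_perpOp.measurable_eval_apply) (perpLaw_invariant hμ)
  have L1 : ∀ p : ℝ≥0, MemLp (Prod.fst : C(I, ℝ) × C(I, ℝ) → C(I, ℝ)) p (μ.prod ν) := fun p =>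
    (hμp p).comp_measurePreserving m1
  have L2 : ∀ p : ℝ≥0, MemLp (Prod.snd : C(I, ℝ) × C(I, ℝ) → C(I, ℝ)) p (μ.prod ν) := fun p =>
    (hνp p).comp_measurePreserving m2
  have q1 : ∀ s, ∫ ω : C(I, ℝ) × C(I, ℝ), ω.1 s ^ 2 ∂(μ.prod ν) = c2 * h s ^ 2 := fun s =>
    (integral_eval_sq_of_map_eq m1 s).trans (sqμ s)
  have q2 : ∀ s, ∫ ω : C(I, ℝ) × C(I, ℝ), ω.2 s ^ 2 ∂(μ.prod ν) = (K2perp + 1) * h s ^ 2 :=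
    fun s => (integral_eval_sq_of_map_eq m2 s).trans (sqν s)
  obtain ⟨Z, hZ, LZ, lawZ, meanZ, sqZ⟩ := exists_isQuadLimit hY
  have : IsProbabilityMeasure quadMeasure := inferInstanceAs
    (IsProbabilityMeasure (Measure.infinitePi fun _ => (volume : Measure (I × I))))
  have v1 := variance_uniform a1.measurable (L1 2) a1.mean q1
  have v2 := variance_uniform a2.measurable (L2 2) a2.mean q2
  have vZ := variance_uniform hZ.1 LZ meanZ sqZ
  refine ⟨C(I, ℝ) × C(I, ℝ), inferInstance, μ.prod ν, inferInstance, Prod.fst, Prod.snd,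
    a1, s1, a2, s2, fun p => ⟨L1 p, L2 p⟩,
    fun Ω' _ P' _ Z' a' s' => isTreeOp_parOp.identDistrib a1 s1 a' s',
    fun Ω' _ P' _ Z' a' s' => isTreeOp_perpOp.identDistrib a2 s2 a' s',
    identDistrib_of_map_eq m2 m1 (measurable_const_mul_coe _) measurable_mixOp_coe
      (map_mul_perpLaw μ),
    identDistrib_of_map_eq m1 m2 (measurable_const_mul_coe _) measurable_splitOp_coe
      (map_splitOp_perpLaw hμ),
    ⟨Z, hZ, fun s => ⟨(a1.memLp s 1).1.aemeasurable,
      ((continuous_eval_const s).measurable.comp hZ.1).aemeasurable, ?_⟩, v1.trans vZ.symm⟩,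
    fun s => ?_, fun s => ?_, ?_, ?_⟩
  · have hE : Measurable fun f : C(I, ℝ) => f s := (continuous_eval_const s).measurable
    have e1 : (μ.prod ν).map (fun ω => ω.1 s) = μ.map (fun f => f s) :=
      (Measure.map_map hE m1.measurable).symm.trans (congrArg (Measure.map _) m1.map_eq)
    rw [e1, lawZ, Measure.map_map hE hY.measurable]
    rfl
  · exact variance_eval (L1 2) (a1.mean s) (q1 s)
  · rw [variance_eval (L2 2) (a2.mean s) (q2 s), add_sub_cancel_right]
  · rw [v1, K3, c2]; ring
  · rw [v2, K3perp, K2perp]; ring
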